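/- Let $X:\mathbb R^2\times\mathbb R^2\to\mathbb R^2$ be analytic, $r:\mathbb R^2\to[0,h]$ be $C^\infty$, and $X_0(x)=X(x,0)$. Let $\omega_0>0$, $\lambda_0<0$, and let $K:\mathbb T\times[-1,1]\to\mathbb R^2$ ($\mathbb T=\mathbb R/\mathbb Z$) be an analytic local diffeomorphism with $X_0(K(\theta,s))=DK(\theta,s)\binom{\omega_0}{\lambda_0 s}$, so that $K$ parameterizes a limit cycle ($s=0$) of $\dot x=X_0(x)$ and its isochrons ($\theta$ fixed). Consider the state-dependent delay equation $$\dot x(t)=X\bigl(x(t),\,\varepsilon x(t-r(x(t)))\bigr).\tag{1}$$ Let $P$ be defined by $\varepsilon P(x,y,\varepsilon)=X(x,\varepsilon y)-X(x,0)$ (extended to $\varepsilon=0$ by continuity) and $Y(w,v,\varepsilon)=DK(w)^{-1}P(K(w),K(v),\varepsilon)$. Let $\phi:\mathbb R\to[0,1]$ be $C^\infty$ with $\phi(x)=1$ for $|x|\le\frac12$ and $\phi(x)=0$ for $|x|>1$, and put $\overline{r\circ K}(w)=r(K(w))\phi(w_2)$, $\overline Y(w,v,\varepsilon)=Y(w,v,\varepsilon)\phi(w_2)\phi(v_2)$.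 For $\omega>0$, $\lambda<0$ and a continuous $W:\mathbb T\times\mathbb R\to\mathbb T\times\mathbb R$ with lift satisfying $W(\theta+1,s)=W(\theta,s)+\binom10$, the extended invariance equation is $$DW(\theta,s)\binom{\omega}{\lambda s}=\binom{\omega_0}{\lambda_0W_2(\theta,s)}+\varepsilon\,\overline Y\bigl(W(\theta,s),\widetilde W(\theta,s),\varepsilon\bigr),\tag{2}$$ $$\widetilde W(\theta,s)=W\bigl(\theta-\omega\,\overline{r\circ K}(W(\theta,s)),\;s\,e^{-\lambda\,\overline{r\circ K}(W(\theta,s))}\bigr);$$ a triple $(\omega,\lambda,W)$ solves (2) if, for some $\delta>0$, $W$ is differentiable and (2) holds at all $(\theta,s)$ with $|s|<\delta$. For $0<s_0<\frac12$ say that $K\circ W$ *parameterizes a limit cycle of (1) with its isochrons on $|s|\le s_0$* if: * $|W_2(\theta+\omega t,se^{\lambda t})|\le\frac12$ for all $\theta$, $|s|\le s_0$, $t\ge-h$; * $\theta\mapsto K\circ W(\theta,0)$ is $1$-periodic and not constant, and for every $\theta$ the function $t\mapsto K\circ W(\theta+\omega t,0)$ solves (1) for all $t\in\mathbb R$; *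 for every $\theta$ and every $|s|\le s_0$ the function $t\mapsto K\circ W(\theta+\omega t,se^{\lambda t})$ solves (1) for all $t\ge0$, and $K\circ W(\theta+\omega t,se^{\lambda t})-K\circ W(\theta+\omega t,0)\to0$ as $t\to\infty$. **Corollary (Isochrons).** For every $k\in\mathbb N$ and $\eta>0$ there is $\varepsilon_0>0$ such that for all $0\le\varepsilon<\varepsilon_0$: 1. There are $\omega>0$, $\lambda<0$, a $C^k$ map $W$ and $0<s_0<\frac12$ such that $(\omega,\lambda,W)$ solves (2), $|\omega-\omega_0|\le\eta$, $|\lambda-\lambda_0|\le\eta$, $|W(\theta,0)-(\theta,0)|\le\eta$ for all $\theta$ (maximum norm, suitable lift of $W$), $K\circ W$ parameterizes a limit cycle of (1) with its isochrons on $|s|\le s_0$, and $D(K\circ W)(\theta,s)$ is invertible for all $\theta$ and $|s|\le s_0$. 2. Whenever $\omega>0$, $\lambda<0$ and $W$ solve (2), there is $0<s_0<\frac12$ such that $K\circ W$ parameterizes a limit cycle of (1) with its isochrons on $|s|\le s_0$; in particular, for all $\theta$ and all $|s|\le s_0$, $K\circ W(\theta+\omega t,se^{\lambda t})$ solves (1)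 for all $t\ge0$. -/

import Mathlib

noncomputable section

/-- `K`, `ω₀ > 0`, `lam₀ < 0` parameterize a limit cycle of the planar ODE `x' = X₀ x` and its
isochrons: `K` is (the lift to `ℝ × [-1,1]` of) an analytic local diffeomorphism on
`𝕋 × [-1,1]`, `1`-periodic in the angle, that conjugates `(ω₀, lam₀ s)` to `X₀`. Values of `K`
at points `(θ, s)` with `|s| > 1` are irrelevant, apart from analyticity at `|s| = 1`. -/
structure IsLimitCycleParam (X₀ : ℝ × ℝ → ℝ × ℝ) (K : ℝ × ℝ → ℝ × ℝ) (ω₀ lam₀ : ℝ) : Prop where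
  omega_pos : 0 < ω₀
  lam_neg : lam₀ < 0
  analytic : AnalyticOnNhd ℝ K (Set.univ ×ˢ Set.Icc (-1) 1)
  periodic : ∀ θ s : ℝ, |s| ≤ 1 → K (θ + 1, s) = K (θ, s)
  localDiffeo : ∀ θ s : ℝ, |s| ≤ 1 → (fderiv ℝ K (θ, s)).IsInvertible
  invariance : ∀ θ s : ℝ, |s| ≤ 1 → X₀ (K (θ, s)) = fderiv ℝ K (θ, s) (ω₀, lam₀ * s)

/-- A `C^∞` cut-off function with values in `[0,1]`, equal to `1` for `|x| ≤ 1/2` and to `0` for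
`|x| > 1`. -/
structure IsCutoff (φ : ℝ → ℝ) : Prop where
  smooth : ContDiff ℝ (⊤ : ℕ∞) φ
  mem_Icc : ∀ x, φ x ∈ Set.Icc (0 : ℝ) 1
  eq_one : ∀ x, |x| ≤ 1 / 2 → φ x = 1
  eq_zero : ∀ x, 1 < |x| → φ x = 0

/-- The state-dependent delay equation `x'(t) = X(x(t), ε x(t - r(x(t))))` at all times `t ∈ I`. -/
def SolvesSDDE (X : (ℝ × ℝ) × (ℝ × ℝ) → ℝ × ℝ) (r : ℝ × ℝ → ℝ) (ε : ℝ) (x : ℝ → ℝ × ℝ)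
    (I : Set ℝ) : Prop :=
  ∀ t ∈ I, HasDerivAt x (X (x t, ε • x (t - r (x t)))) t

/-- The perturbation `P`, determined by `ε P(x, y, ε) = X(x, ε y) - X(x, 0)`: the difference
quotient for `ε ≠ 0`, and its limit, the derivative of `e ↦ X(x, e y)` at `0`, for `ε = 0`. -/
def pertP (X : (ℝ × ℝ) × (ℝ × ℝ) → ℝ × ℝ) (x y : ℝ × ℝ) (ε : ℝ) : ℝ × ℝ :=
  dslope (fun e : ℝ => X (x, e • y)) 0 ε

/-- `Y(w, v, ε) = DK(w)⁻¹ P(K(w), K(v), ε)`. -/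
def fieldY (X : (ℝ × ℝ) × (ℝ × ℝ) → ℝ × ℝ) (K : ℝ × ℝ → ℝ × ℝ) (w v : ℝ × ℝ) (ε : ℝ) : ℝ × ℝ :=
  (fderiv ℝ K w).inverse (pertP X (K w) (K v) ε)

/-- The extension of `Y` by cut-off. -/
def extY (X : (ℝ × ℝ) × (ℝ × ℝ) → ℝ × ℝ) (K : ℝ × ℝ → ℝ × ℝ) (φ : ℝ → ℝ) (w v : ℝ × ℝ) (ε : ℝ) :
    ℝ × ℝ :=
  (φ w.2 * φ v.2) • fieldY X K w v ε

/-- The extension of `r ∘ K` by cut-off. -/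
def extDelay (r : ℝ × ℝ → ℝ) (K : ℝ × ℝ → ℝ × ℝ) (φ : ℝ → ℝ) (w : ℝ × ℝ) : ℝ :=
  r (K w) * φ w.2

/-- The delayed term `W̃(θ, s)` of the extended invariance equation. -/
def delayedW (r : ℝ × ℝ → ℝ) (K : ℝ × ℝ → ℝ × ℝ) (φ : ℝ → ℝ) (ω lam : ℝ) (W : ℝ × ℝ → ℝ × ℝ)
    (θ s : ℝ) : ℝ × ℝ :=
  W (θ - ω * extDelay r K φ (W (θ, s)), s * Real.exp (-lam * extDelay r K φ (W (θ, s))))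

/-- `(ω, lam, W)` solves the extended invariance equation
`DW(θ,s) (ω, lam s) = (ω₀, lam₀ W₂(θ,s)) + ε Ȳ(W(θ,s), W̃(θ,s), ε)` in a neighborhood of `s = 0`.
Here `W` is the lift to `ℝ × ℝ` of a continuous map of `𝕋 × ℝ` to itself of degree one in the
angle. -/
structure SolvesExtInvariance (X : (ℝ × ℝ) × (ℝ × ℝ) → ℝ × ℝ) (r : ℝ × ℝ → ℝ)
    (K : ℝ × ℝ → ℝ × ℝ) (φ : ℝ → ℝ) (ω₀ lam₀ ε ω lam : ℝ) (W : ℝ × ℝ → ℝ × ℝ) : Prop where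
  continuous : Continuous W
  periodic : ∀ θ s : ℝ, W (θ + 1, s) = W (θ, s) + (1, 0)
  equation : ∃ δ : ℝ, 0 < δ ∧ ∀ θ s : ℝ, |s| < δ →
    DifferentiableAt ℝ W (θ, s) ∧
    fderiv ℝ W (θ, s) (ω, lam * s) =
      (ω₀, lam₀ * (W (θ, s)).2) +
        ε • extY X K φ (W (θ, s)) (delayedW r K φ ω lam W θ s) ε

/-- The map `(θ, s) ↦ K (W (θ, s))`, `|s| ≤ s₀`, parameterizes a limit cycle (`s = 0`) of the
delay equation together with its isochrons (`θ` fixed). -/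
structure ParamCycleAndIsochrons (X : (ℝ × ℝ) × (ℝ × ℝ) → ℝ × ℝ) (r : ℝ × ℝ → ℝ) (h : ℝ)
    (K : ℝ × ℝ → ℝ × ℝ) (ε ω lam : ℝ) (W : ℝ × ℝ → ℝ × ℝ) (s₀ : ℝ) : Prop where
  /-- At all times that enter the equation for `t ≥ 0`, `W` takes values where `K` is defined. -/
  mem_domain : ∀ θ s t : ℝ, |s| ≤ s₀ → -h ≤ t →
    |(W (θ + ω * t, s * Real.exp (lam * t))).2| ≤ 1 / 2
  cycle_periodic : ∀ θ : ℝ, K (W (θ + 1, 0)) = K (W (θ, 0))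
  cycle_nonconst : ∃ θ : ℝ, K (W (θ, 0)) ≠ K (W (0, 0))
  cycle_solves : ∀ θ : ℝ, SolvesSDDE X r ε (fun t => K (W (θ + ω * t, 0))) Set.univ
  solves : ∀ θ s : ℝ, |s| ≤ s₀ →
    SolvesSDDE X r ε (fun t => K (W (θ + ω * t, s * Real.exp (lam * t)))) (Set.Ici 0)
  /-- Solutions starting on the isochron of `K (W (θ, 0))` share its asymptotic phase. -/
  asymptotic_phase : ∀ θ s : ℝ, |s| ≤ s₀ →
    Filter.Tendsto
      (fun t : ℝ => K (W (θ + ω * t, s * Real.exp (lam * t))) - K (W (θ + ω * t, 0)))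
      Filter.atTop (nhds 0)

end

/-! The second claim is an a priori argument. At a maximum of `W₂²` on the circle `s = 0` the
derivative of `W₂` along the circle vanishes or `W₂` itself does, so the equation forces `|W₂| ≤
1/4` once `ε` is small. By continuity and periodicity `|W₂| ≤ 1/2` on a strip. There the cut-offs
equal one, and the chain rule along the characteristics `(θ + ω t, s exp (lam t))` turns the
extended invariance equation into the delay equation. This is
`SolvesExtInvariance.paramCycleAndIsochrons`; its threshold for `ε` does not depend on `ω`, `lam`,
`W`.

For existence, the functional equation is traded for a planar ordinary differential equation. One
looks for a field `(ω₀, lam₀ w₂) + g(w)` whose own backward flow `U` supplies the delayed argument: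
`g(w) = ε Y(w, U(-ρ(w), w), ε)`, with `ρ` the cut-off delay. The variation of constants formula
makes the deviation of `U` from the free flow a fixed point (`exists_reducedField`). Composition
with an unknown function is not Lipschitz in `C^n`, so the contraction is run in the uniform norm on
a class bounded in `C^(m+1)`. Interpolation then makes the limit `C^m`
(`exists_contDiff_fixedPoint`).

The planar field is a small periodic perturbation of `(ω₀, lam₀ s)`. It has an invariant circle that
is a graph (`exists_invariant_graph`), on which the motion is conjugate to a rotation
(`exists_circle_conjugacy`). Floquet coordinates bring it to the form `(ω + y α, lam y + y² β)`
(`exists_floquet_coordinates`). The factors of `y` make the remaining conjugacy equation solvable by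
an integral over forward time, which converges because `lam < 0` (`exists_semilinear_solution`,
`exists_linearization`). The result is a `W` conjugating `(ω, lam s)` to the planar field.

Finally, `U` and `W` along a characteristic solve the same Lipschitz equation backward from the same
point. Hence `U(-ρ(w), w)` is the delayed term, and `W` solves the extended equation
(`solvesExtInvariance_of_linearization`). -/

open Set Filter Topology MeasureTheory

/-! ### Families with uniformly bounded derivatives -/

section UniformBounds

variable {ι ι' E F G : Type*} [NormedAddCommGroup E] [NormedSpace ℝ E] [NormedAddCommGroup F]
  [NormedSpace ℝ F] [NormedAddCommGroup G] [NormedSpace ℝ G] {a n : ℕ}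

/-- A family of `C^n` functions whose derivatives of orders between `a` and `n` are bounded,
uniformly on the whole space and uniformly over the family. -/
def UBdd (a n : ℕ) (f : ι → E → F) : Prop :=
  (∀ i, ContDiff ℝ n (f i)) ∧
    ∃ C : ℝ, ∀ i, ∀ j : ℕ, a ≤ j → j ≤ n → ∀ x, ‖iteratedFDeriv ℝ j (f i) x‖ ≤ C

theorem UBdd.reindex {f : ι → E → F} (hf : UBdd a n f) (e : ι' → ι) :
    UBdd a n (fun i => f (e i)) :=
  ⟨fun i => hf.1 (e i), hf.2.imp fun _ hC i => hC (e i)⟩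

theorem UBdd.mono {f : ι → E → F} {b m : ℕ} (hf : UBdd a n f) (hab : a ≤ b) (hmn : m ≤ n) :
    UBdd b m f :=
  ⟨fun i => (hf.1 i).of_le (by exact_mod_cast hmn),
    hf.2.imp fun _ hC i j h1 h2 => hC i j (hab.trans h1) (h2.trans hmn)⟩

theorem UBdd.nonneg_bound {f : ι → E → F} (hf : UBdd a n f) :
    ∃ C : ℝ, 0 ≤ C ∧ ∀ i, ∀ j : ℕ, a ≤ j → j ≤ n → ∀ x, ‖iteratedFDeriv ℝ j (f i) x‖ ≤ C := by
  obtain ⟨C, hC⟩ := hf.2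
  exact ⟨max C 0, le_max_right _ _, fun i j h1 h2 x => (hC i j h1 h2 x).trans (le_max_left _ _)⟩

theorem UBdd.norm_le {f : ι → E → F} (hf : UBdd 0 n f) : ∃ C : ℝ, 0 ≤ C ∧ ∀ i x, ‖f i x‖ ≤ C := by
  obtain ⟨C, h0, hC⟩ := hf.nonneg_bound
  exact ⟨C, h0, fun i x => by simpa using hC i 0 le_rfl (Nat.zero_le _) x⟩

theorem UBdd.lipschitz {f : ι → E → F} (hf : UBdd a n f) (ha : a ≤ 1) (hn : 1 ≤ n) :
    ∃ C : ℝ, 0 ≤ C ∧ ∀ i x y, ‖f i x - f i y‖ ≤ C * ‖x - y‖ := by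
  obtain ⟨C, h0, hC⟩ := hf.nonneg_bound
  refine ⟨C, h0, fun i x y => ?_⟩
  refine Convex.norm_image_sub_le_of_norm_fderiv_le (𝕜 := ℝ) (s := univ)
    (fun z _ => ((hf.1 i).differentiable (by exact_mod_cast (by omega))).differentiableAt)
    (fun z _ => ?_) convex_univ (mem_univ _) (mem_univ _)
  have := hC i 1 ha hn z
  rwa [← norm_iteratedFDeriv_fderiv, norm_iteratedFDeriv_zero] at this

theorem iteratedFDeriv_sub_const_of_ne {u : E → F} {x : E} {j : ℕ} (hu : ContDiffAt ℝ j u x)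
    (hj : j ≠ 0) (c : F) :
    iteratedFDeriv ℝ j (fun y => u y - c) x = iteratedFDeriv ℝ j u x := by
  rw [show (fun y => u y - c) = u - fun _ => c from rfl,
    iteratedFDeriv_sub_apply hu contDiff_const.contDiffAt, iteratedFDeriv_const_of_ne hj]
  simp

/-- Only derivatives of the inner map enter the chain rule, so it needs no bound on its values. This
is why the lower index `a` exists: identities, affine maps and flows, which are unbounded in the
angle, satisfy bounds from order `1` on. -/
theorem UBdd.comp {g : ι → F → G} {f : ι → E → F} (hg : UBdd a n g) (hf : UBdd 1 n f)
    (ha1 : a ≤ 1 := by norm_num) :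
    UBdd a n (fun i x => g i (f i x)) := by
  obtain ⟨C, hC0, hC⟩ := hg.nonneg_bound
  obtain ⟨D, hD0, hD⟩ := hf.nonneg_bound
  have hD1 : ∀ i, ∀ x, ∀ k : ℕ, 1 ≤ k → k ≤ n → ‖iteratedFDeriv ℝ k (f i) x‖ ≤ (max D 1) ^ k :=
    fun i x k h1 h2 => (hD i k h1 h2 x).trans <|
      (le_max_left D 1).trans (le_self_pow₀ (le_max_right D 1) (by omega))
  refine ⟨fun i => (hg.1 i).comp (hf.1 i), n.factorial * C * (max D 1) ^ n, ?_⟩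
  have key : ∀ j ≤ n, (j.factorial : ℝ) * C * (max D 1) ^ j ≤ n.factorial * C * (max D 1) ^ n := by
    intro j hj
    gcongr
    exact le_max_right _ _
  intro i j haj hjn x
  refine le_trans ?_ (key j hjn)
  rcases Nat.eq_zero_or_pos j with rfl | hj
  · have := hC i 0 haj hjn (f i x)
    simpa using this
  rcases Nat.eq_zero_or_pos a with rfl | ha
  · exact norm_iteratedFDeriv_comp_le (hg.1 i) (hf.1 i) (by exact_mod_cast hjn) x
      (fun k hk => hC i k (Nat.zero_le _) (hk.trans hjn) _)
      (fun k h1 h2 => hD1 i x k h1 (h2.trans hjn))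
  -- The estimate for compositions also asks for a bound on the value of the outer map, which is
  -- missing for `a = 1`. Subtracting the value at `f i x` makes it zero there and leaves higher
  -- derivatives unchanged.
  have hcd : ContDiff ℝ n (fun y => g i y - g i (f i x)) := (hg.1 i).sub contDiff_const
  have e1 := iteratedFDeriv_sub_const_of_ne (u := fun x => g i (f i x)) (x := x)
    (((hg.1 i).comp (hf.1 i)).contDiffAt.of_le (by exact_mod_cast hjn)) hj.ne' (g i (f i x))
  rw [← e1]
  refine norm_iteratedFDeriv_comp_le hcd (hf.1 i) (by exact_mod_cast hjn) x
    (fun k hk => ?_) (fun k h1 h2 => hD1 i x k h1 (h2.trans hjn))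
  rcases Nat.eq_zero_or_pos k with rfl | hk0
  · simpa using hC0
  · rw [iteratedFDeriv_sub_const_of_ne ((hg.1 i).contDiffAt.of_le
      (by exact_mod_cast (hk.trans hjn))) hk0.ne']
    exact hC i k (by omega) (hk.trans hjn) _

theorem UBdd.clm_comp_left {f : ι → E → F} (hf : UBdd a n f) (L : F →L[ℝ] G) :
    UBdd a n (fun i x => L (f i x)) := by
  obtain ⟨C, hC0, hC⟩ := hf.nonneg_bound
  refine ⟨fun i => L.contDiff.comp (hf.1 i), ‖L‖ * C, fun i j h1 h2 x => ?_⟩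
  exact (L.norm_iteratedFDeriv_comp_left (hf.1 i).contDiffAt (by exact_mod_cast h2)).trans
    (by gcongr; exact hC i j h1 h2 x)

theorem UBdd.fst {f : ι → E → F × G} (hf : UBdd a n f) : UBdd a n (fun i x => (f i x).1) :=
  hf.clm_comp_left (ContinuousLinearMap.fst ℝ F G)

theorem UBdd.snd {f : ι → E → F × G} (hf : UBdd a n f) : UBdd a n (fun i x => (f i x).2) :=
  hf.clm_comp_left (ContinuousLinearMap.snd ℝ F G)

theorem UBdd.prodMk {f : ι → E → F} {g : ι → E → G} (hf : UBdd a n f) (hg : UBdd a n g) :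
    UBdd a n (fun i x => (f i x, g i x)) := by
  obtain ⟨C, hC0, hC⟩ := hf.nonneg_bound
  obtain ⟨D, hD0, hD⟩ := hg.nonneg_bound
  refine ⟨fun i => (hf.1 i).prodMk (hg.1 i), max C D, fun i j h1 h2 x => ?_⟩
  rw [iteratedFDeriv_prodMk (hf.1 i).contDiffAt (hg.1 i).contDiffAt (by exact_mod_cast h2),
    ContinuousMultilinearMap.opNorm_prod]
  exact max_le_max (hC i j h1 h2 x) (hD i j h1 h2 x)

theorem UBdd.add {f g : ι → E → F} (hf : UBdd a n f) (hg : UBdd a n g) :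
    UBdd a n (fun i x => f i x + g i x) := by
  simpa using (hf.prodMk hg).clm_comp_left
    (ContinuousLinearMap.fst ℝ F F + ContinuousLinearMap.snd ℝ F F)

theorem UBdd.smul {f : ι → E → ℝ} {g : ι → E → F} (hf : UBdd 0 n f) (hg : UBdd 0 n g) :
    UBdd 0 n (fun i x => f i x • g i x) := by
  obtain ⟨C, hC0, hC⟩ := hf.nonneg_bound
  obtain ⟨D, hD0, hD⟩ := hg.nonneg_bound
  refine ⟨fun i => (hf.1 i).smul (hg.1 i), 2 ^ n * (C * D), fun i j h1 h2 x => ?_⟩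
  refine (norm_iteratedFDeriv_smul_le (hf.1 i) (hg.1 i) x (by exact_mod_cast h2)).trans ?_
  calc ∑ k ∈ Finset.range (j + 1), (j.choose k : ℝ) * ‖iteratedFDeriv ℝ k (f i) x‖ *
        ‖iteratedFDeriv ℝ (j - k) (g i) x‖
      ≤ ∑ k ∈ Finset.range (j + 1), (j.choose k : ℝ) * (C * D) := by
        refine Finset.sum_le_sum fun k hk => ?_
        rw [mul_assoc]
        have hk' := Finset.mem_range.1 hk
        gcongr
        · exact hC i k (Nat.zero_le _) (by omega) x
        · exact hD i (j - k) (Nat.zero_le _) (by omega) x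
    _ = 2 ^ j * (C * D) := by
        rw [← Finset.sum_mul]
        congr 1
        exact_mod_cast Nat.sum_range_choose j
    _ ≤ 2 ^ n * (C * D) := by gcongr; norm_num

theorem UBdd.mul {f g : ι → E → ℝ} (hf : UBdd 0 n f) (hg : UBdd 0 n g) :
    UBdd 0 n (fun i x => f i x * g i x) := hf.smul hg

theorem UBdd.affine (L : ι → E →L[ℝ] F) (c : ι → F) {C : ℝ} (hL : ∀ i, ‖L i‖ ≤ C) :
    UBdd 1 n (fun i x => L i x + c i) := by
  refine ⟨fun i => (L i).contDiff.add contDiff_const, C, fun i j h1 h2 x => ?_⟩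
  obtain ⟨j, rfl⟩ : ∃ k, j = k + 1 := ⟨j - 1, by omega⟩
  rw [← norm_iteratedFDeriv_fderiv]
  have : fderiv ℝ (fun x => L i x + c i) = fun _ => L i := by
    ext1 y
    rw [fderiv_add_const]; exact (L i).fderiv
  rw [this]
  rcases Nat.eq_zero_or_pos j with rfl | hj
  · simpa using hL i
  · rw [iteratedFDeriv_const_of_ne (by omega)]
    simpa using (norm_nonneg _).trans (hL i)

theorem UBdd.clm (L : E →L[ℝ] F) : UBdd 1 n (fun (_ : ι) x => L x) := by
  simpa using UBdd.affine (ι := ι) (n := n) (fun _ => L) (fun _ => 0) (fun _ => le_refl ‖L‖)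

theorem UBdd.id : UBdd 1 n (fun (_ : ι) (x : E) => x) := UBdd.clm (ContinuousLinearMap.id ℝ E)

/-- A smooth function all of whose values are, up to a translation symmetry, taken on a compact set
has bounded derivatives, apart from the open set on which it vanishes. -/
theorem UBdd.of_periodic {f : E → F} (hf : ContDiff ℝ n f) {S : Set E} (hS : IsCompact S)
    (h : ∀ x, (∃ v, (∀ z, f (z + v) = f z) ∧ x + v ∈ S) ∨ f =ᶠ[𝓝 x] fun _ => 0) :
    UBdd 0 n (fun _ : ι => f) := by
  have hb : ∀ j : ℕ, ∃ C : ℝ, j ≤ n → ∀ x ∈ S, ‖iteratedFDeriv ℝ j f x‖ ≤ C := by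
    intro j
    by_cases hj : j ≤ n
    · obtain ⟨C, hC⟩ := hS.exists_bound_of_continuousOn
        (hf.continuous_iteratedFDeriv (m := j) (by exact_mod_cast hj)).continuousOn
      exact ⟨C, fun _ => hC⟩
    · exact ⟨0, fun h => absurd h hj⟩
  choose C hC using hb
  refine ⟨fun _ => hf, ∑ j ∈ Finset.range (n + 1), |C j|, fun _ j _ hj x => ?_⟩
  have h1 : |C j| ≤ ∑ j ∈ Finset.range (n + 1), |C j| :=
    Finset.single_le_sum (f := fun j => |C j|) (fun _ _ => abs_nonneg _) (Finset.mem_range.2 (by omega))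
  rcases h x with ⟨v, hv, hx⟩ | h0
  · have : f = fun z => f (z + v) := funext fun z => (hv z).symm
    rw [this, iteratedFDeriv_comp_add_right]
    exact ((hC j hj _ hx).trans (le_abs_self _)).trans h1
  · rw [(h0.iteratedFDeriv ℝ j).eq_of_nhds]
    have : iteratedFDeriv ℝ j (fun _ : E => (0 : F)) x = 0 := by simp
    rw [this, norm_zero]
    exact (abs_nonneg _).trans h1

theorem UBdd.of_hasCompactSupport {f : E → F} (hf : ContDiff ℝ n f) (hs : HasCompactSupport f) :
    UBdd 0 n (fun _ : ι => f) := by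
  refine UBdd.of_periodic hf hs fun x => ?_
  by_cases hx : x ∈ tsupport f
  · exact Or.inl ⟨0, by simp, by simpa using hx⟩
  · exact Or.inr (notMem_tsupport_iff_eventuallyEq.1 hx)

end UniformBounds

/-! ### Contraction in the uniform norm, regularity by interpolation -/

section FixedPoint

universe u

/-- Interpolation: a function bounded by `d` with second derivative bounded by `B` has first
derivative of size `√d`. -/
theorem norm_fderiv_le_sqrt {E F : Type*} [NormedAddCommGroup E] [NormedSpace ℝ E]
    [NormedAddCommGroup F] [NormedSpace ℝ F] {g : E → F} (hg : Differentiable ℝ g) {d B : ℝ}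
    (hd : 0 < d) (hB : 0 ≤ B) (h0 : ∀ x, ‖g x‖ ≤ d)
    (h2 : ∀ x y, ‖fderiv ℝ g x - fderiv ℝ g y‖ ≤ B * ‖x - y‖) (x : E) :
    ‖fderiv ℝ g x‖ ≤ (2 + B) * √d := by
  have hs : 0 < √d := Real.sqrt_pos.2 hd
  refine ContinuousLinearMap.opNorm_le_of_unit_norm (by positivity) fun v hv => ?_
  -- The step length `√d` balances the error `2 d / √d` of the difference quotient against the
  -- curvature error `B √d`.
  have key : ‖g (x + √d • v) - g x - fderiv ℝ g x (x + √d • v - x)‖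
      ≤ (B * √d) * ‖x + √d • v - x‖ := by
    refine Convex.norm_image_sub_le_of_norm_fderiv_le' (𝕜 := ℝ) (s := Metric.closedBall x (√d))
      (fun z _ => hg z) (fun z hz => ?_) (convex_closedBall _ _) (Metric.mem_closedBall_self hs.le)
      ?_
    · refine (h2 z x).trans ?_
      gcongr
      simpa [dist_eq_norm] using hz
    · simp [norm_smul, hv, abs_of_pos hs]
  simp only [add_sub_cancel_left, norm_smul, hv, mul_one, map_smul, Real.norm_eq_abs,
    abs_of_pos hs] at key
  have h3 : ‖√d • fderiv ℝ g x v‖ ≤ 2 * d + B * d := by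
    have e : √d • fderiv ℝ g x v = g (x + √d • v) - g x
        - (g (x + √d • v) - g x - √d • fderiv ℝ g x v) := by abel
    rw [e]
    refine (norm_sub_le _ _).trans ?_
    have h4 := norm_sub_le (g (x + √d • v)) (g x)
    have h5 := h0 (x + √d • v)
    have h6 := h0 x
    have h7 : B * √d * √d = B * d := by rw [mul_assoc, Real.mul_self_sqrt hd.le]
    linarith
  rw [norm_smul, Real.norm_eq_abs, abs_of_pos hs] at h3
  have h4 : (2 * d + B * d) = √d * ((2 + B) * √d) := by
    have := Real.mul_self_sqrt hd.le
    linear_combination -(2 + B) * this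
  rw [h4] at h3
  exact le_of_mul_le_mul_left h3 hs

/-- Each differentiation replaces the rate `κ` by `√κ`, still less than one, at the price of one
bounded derivative in reserve. The induction passes to the derivatives, so the target space varies.
-/
theorem exists_summable_bound_iteratedFDeriv {E : Type u} [NormedAddCommGroup E] [NormedSpace ℝ E]
    (j : ℕ) : ∀ (N : ℕ) (F : Type u) [NormedAddCommGroup F] [NormedSpace ℝ F] (v : ℕ → E → F)
      (C κ : ℝ), 0 < C → 0 < κ → κ < 1 → UBdd 0 (N + 1) v → (∀ n x, ‖v n x‖ ≤ C * κ ^ n) → j ≤ N →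
      ∃ b : ℕ → ℝ, Summable b ∧ ∀ n x, ‖iteratedFDeriv ℝ j (v n) x‖ ≤ b n := by
  induction j with
  | zero =>
    intro N F _ _ v C κ hC hκ hκ1 _ hv _
    exact ⟨fun n => C * κ ^ n, (summable_geometric_of_lt_one hκ.le hκ1).mul_left C,
      fun n x => by simpa using hv n x⟩
  | succ j ih =>
    intro N F _ _ v C κ hC hκ hκ1 hb hv hj
    obtain ⟨N, rfl⟩ : ∃ M, N = M + 1 := ⟨N - 1, by omega⟩
    have hfd : UBdd 0 (N + 1) (fun n => fderiv ℝ (v n)) := by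
      obtain ⟨B, hB⟩ := hb.2
      refine ⟨fun n => (hb.1 n).fderiv_right (by norm_cast), B, fun n i _ hi x => ?_⟩
      rw [norm_iteratedFDeriv_fderiv]
      exact hB n (i + 1) (by omega) (by omega) x
    obtain ⟨B, hB0, hB⟩ := hfd.lipschitz (by norm_num) (by omega)
    have hsm : ∀ n x, ‖fderiv ℝ (v n) x‖ ≤ ((2 + B) * √C) * (√κ) ^ n := by
      intro n x
      have h1 := norm_fderiv_le_sqrt ((hb.1 n).differentiable (by norm_num))
        (d := C * κ ^ n) (by positivity) hB0 (hv n) (hB n) x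
      have h2 : √(κ ^ n) = √κ ^ n := by
        rw [← Real.sqrt_sq (by positivity : 0 ≤ √κ ^ n), ← pow_mul, mul_comm n 2, pow_mul,
          Real.sq_sqrt hκ.le]
      rwa [Real.sqrt_mul hC.le, h2, ← mul_assoc] at h1
    obtain ⟨b, hb1, hb2⟩ := ih N (E →L[ℝ] F) (fun n => fderiv ℝ (v n)) _ (√κ) (by positivity)
      (by positivity) ((Real.sqrt_lt' one_pos).2 (by simpa using hκ1)) hfd hsm (by omega)
    refine ⟨b, hb1, fun n x => ?_⟩
    rw [← norm_iteratedFDeriv_fderiv]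
    exact hb2 n x

variable {E F : Type u} [NormedAddCommGroup E] [NormedSpace ℝ E] [NormedAddCommGroup F]
  [NormedSpace ℝ F] [CompleteSpace F]

/-- A geometrically convergent sequence that is bounded in `C^(N+1)` has a `C^N` limit. -/
theorem exists_contDiff_limit {N : ℕ} {f : ℕ → E → F} {C κ : ℝ} (hC : 0 < C) (hκ : 0 < κ)
    (hκ1 : κ < 1) (hf : UBdd 0 (N + 1) f) (hc : ∀ n x, ‖f (n + 1) x - f n x‖ ≤ C * κ ^ n) :
    ∃ g : E → F, ContDiff ℝ N g ∧ ∀ x, Tendsto (fun n => f n x) atTop (𝓝 (g x)) := by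
  have hv : UBdd 0 (N + 1) (fun n x => f (n + 1) x - f n x) := by
    simpa [sub_eq_add_neg] using (hf.reindex (fun n => n + 1)).add
      (hf.clm_comp_left (-ContinuousLinearMap.id ℝ F))
  have hb : ∀ j : ℕ, ∃ b : ℕ → ℝ, j ≤ N → Summable b ∧
      ∀ n x, ‖iteratedFDeriv ℝ j (fun x => f (n + 1) x - f n x) x‖ ≤ b n := by
    intro j
    by_cases hj : j ≤ N
    · obtain ⟨b, h1, h2⟩ := exists_summable_bound_iteratedFDeriv j N F
        (fun n x => f (n + 1) x - f n x) C κ hC hκ hκ1 hv hc hj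
      exact ⟨b, fun _ => ⟨h1, h2⟩⟩
    · exact ⟨0, fun h => absurd h hj⟩
  choose b hb using hb
  refine ⟨fun x => f 0 x + ∑' n, (f (n + 1) x - f n x), ?_, fun x => ?_⟩
  · refine ContDiff.add ((hf.1 0).of_le (by norm_cast; omega)) ?_
    refine contDiff_tsum (N := (N : ℕ∞)) (v := b)
      (fun i => (hv.1 i).of_le (by norm_cast; omega)) (fun k hk => (hb k (by exact_mod_cast hk)).1)
      (fun k i x hk => (hb k (by exact_mod_cast hk)).2 i x)
  · have hs : Summable fun n => f (n + 1) x - f n x :=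
      .of_norm_bounded ((summable_geometric_of_lt_one hκ.le hκ1).mul_left C) fun n => hc n x
    have h1 := (hs.hasSum.tendsto_sum_nat).const_add (f 0 x)
    refine h1.congr fun n => ?_
    rw [Finset.sum_range_sub (fun n => f n x)]
    abel

/-- A map that preserves a class of functions bounded in `C^(N+1)` and contracts the uniform
distance has a `C^N` fixed point. -/
theorem exists_contDiff_fixedPoint {N : ℕ} (Γ : (E → F) → E → F) (P : (E → F) → Prop)
    (f₀ : E → F) (h₀ : P f₀) (hP : ∀ f, P f → P (Γ f))
    (hb : UBdd 0 (N + 1) (fun f : {f : E → F // P f} => f.1)) {κ : ℝ} (hκ : 0 < κ) (hκ1 : κ < 1)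
    (hc : ∀ f g : E → F, ∀ d : ℝ, P f → Continuous g → (∀ x, ‖f x - g x‖ ≤ d) →
      ∀ x, ‖Γ f x - Γ g x‖ ≤ κ * d) :
    ∃ f, ContDiff ℝ N f ∧ Γ f = f ∧
      ∃ v : ℕ → E → F, (∀ n, P (v n)) ∧ ∀ x, Tendsto (fun n => v n x) atTop (𝓝 (f x)) := by
  set v : ℕ → E → F := fun n => Γ^[n] f₀ with hvdef
  have hvs : ∀ n, v (n + 1) = Γ (v n) := fun n => Function.iterate_succ_apply' Γ n f₀
  have hPv : ∀ n, P (v n) := by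
    intro n
    induction n with
    | zero => exact h₀
    | succ n ih => rw [hvs]; exact hP _ ih
  have hcont : ∀ n, Continuous (v n) := fun n => (hb.1 ⟨v n, hPv n⟩).continuous
  obtain ⟨B, hB0, hB⟩ := hb.norm_le
  have hgeo : ∀ n x, ‖v (n + 1) x - v n x‖ ≤ (2 * B + 1) * κ ^ n := by
    intro n
    induction n with
    | zero =>
      intro x
      have h1 := hB ⟨v 1, hPv 1⟩ x
      have h2 := hB ⟨v 0, hPv 0⟩ x
      have h3 := norm_sub_le (v 1 x) (v 0 x)
      simp only [zero_add, pow_zero, mul_one] at *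
      linarith
    | succ n ih =>
      intro x
      rw [hvs (n + 1), hvs n, pow_succ]
      have := hc (v (n + 1)) (v n) _ (hPv _) (hcont n) ih x
      rw [hvs n] at this
      linarith
  obtain ⟨f, hf, hlim⟩ := exists_contDiff_limit (by positivity) hκ hκ1
    (hb.reindex (fun n => ⟨v n, hPv n⟩)) hgeo
  refine ⟨f, hf, ?_, v, hPv, hlim⟩
  have hdist : ∀ n x, ‖v n x - f x‖ ≤ (2 * B + 1) * κ ^ n / (1 - κ) := by
    intro n x
    have := dist_le_of_le_geometric_of_tendsto κ (2 * B + 1) hκ1 (f := fun n => v n x)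
      (fun n => by rw [dist_comm, dist_eq_norm]; exact hgeo n x) (hlim x) n
    rwa [dist_eq_norm] at this
  ext1 x
  have h1 : Tendsto (fun n => v (n + 1) x) atTop (𝓝 (Γ f x)) := by
    rw [tendsto_iff_norm_sub_tendsto_zero]
    refine squeeze_zero (fun _ => norm_nonneg _)
      (g := fun n => κ * ((2 * B + 1) * κ ^ n / (1 - κ))) (fun n => ?_) ?_
    · rw [hvs]
      -- The limit may leave the class, having lost one derivative. The contraction estimate is
      -- therefore required only with one argument in the class and the other merely continuous.
      exact hc _ _ _ (hPv n) hf.continuous (hdist n) x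
    · have h0 := tendsto_pow_atTop_nhds_zero_of_lt_one hκ.le hκ1
      have := ((h0.const_mul (2 * B + 1)).div_const (1 - κ)).const_mul κ
      simpa using this
  exact tendsto_nhds_unique h1 ((tendsto_add_atTop_iff_nat 1).2 (hlim x))

end FixedPoint

/-! ### Smoothness of integrals depending on parameters -/

section ParametricIntegral

universe u

/-- Dominated differentiation under the integral sign, repeated. The induction replaces `F` by `E
→L[ℝ] F`, so `F` is quantified after `n` and shares a universe with `E`. -/
theorem contDiff_integral_of_bound {E : Type u} [NormedAddCommGroup E] [NormedSpace ℝ E]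
    {μ : Measure ℝ} {b : ℝ → ℝ} (hb : Integrable b μ) (n : ℕ) :
    ∀ (F : Type u) [NormedAddCommGroup F] [NormedSpace ℝ F] (Φ : ℝ → E → F),
      ContDiff ℝ n (Function.uncurry Φ) →
      (∀ᵐ τ ∂μ, ∀ j ≤ n, ∀ x, ‖iteratedFDeriv ℝ j (Φ τ) x‖ ≤ b τ) →
      ContDiff ℝ n (fun x => ∫ τ, Φ τ x ∂μ) ∧
        ∀ j ≤ n, ∀ x, ‖iteratedFDeriv ℝ j (fun x => ∫ τ, Φ τ x ∂μ) x‖ ≤ ∫ τ, b τ ∂μ := by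
  have h0 : ∀ (F : Type u) [NormedAddCommGroup F] [NormedSpace ℝ F] (Φ : ℝ → E → F),
      (∀ᵐ τ ∂μ, ∀ x, ‖iteratedFDeriv ℝ 0 (Φ τ) x‖ ≤ b τ) →
        ∀ x, ‖∫ τ, Φ τ x ∂μ‖ ≤ ∫ τ, b τ ∂μ := by
    intro F _ _ Φ h x
    refine norm_integral_le_of_norm_le hb ?_
    filter_upwards [h] with τ hτ
    simpa using hτ x
  induction n with
  | zero =>
    intro F _ _ Φ hΦ h
    have h' : ∀ᵐ τ ∂μ, ∀ x, ‖iteratedFDeriv ℝ 0 (Φ τ) x‖ ≤ b τ := h.mono fun τ hτ => hτ 0 le_rfl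
    constructor
    · simp only [CharP.cast_eq_zero, contDiff_zero] at hΦ ⊢
      refine continuous_of_dominated (bound := b) (fun x => ?_) (fun x => ?_) hb ?_
      · exact (hΦ.comp (by fun_prop : Continuous fun τ : ℝ => (τ, x))).aestronglyMeasurable
      · filter_upwards [h'] with τ hτ
        simpa using hτ x
      · exact Eventually.of_forall fun τ => hΦ.comp (by fun_prop : Continuous fun x : E => (τ, x))
    · intro j hj x
      obtain rfl : j = 0 := by omega
      simpa using h0 F Φ h' x
  | succ n ih =>
    intro F _ _ Φ hΦ h
    have h' : ∀ᵐ τ ∂μ, ∀ x, ‖iteratedFDeriv ℝ 0 (Φ τ) x‖ ≤ b τ :=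
      h.mono fun τ hτ => hτ 0 (by omega)
    have hcd : ∀ τ, ContDiff ℝ (n + 1 : ℕ) (Φ τ) := fun τ =>
      hΦ.comp (contDiff_prodMk_right τ)
    have hΦ' : ContDiff ℝ n (Function.uncurry fun τ => fderiv ℝ (Φ τ)) := by
      refine ContDiff.fderiv (f := fun p : ℝ × E => Φ p.1) (g := fun p : ℝ × E => p.2)
        (m := (n + 1 : ℕ)) ?_ contDiff_snd (by norm_cast)
      exact hΦ.comp (f := fun q : (ℝ × E) × E => (q.1.1, q.2)) (by fun_prop)
    obtain ⟨h1, h2⟩ := ih (E →L[ℝ] F) (fun τ => fderiv ℝ (Φ τ)) hΦ' (by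
      filter_upwards [h] with τ hτ j hj x
      rw [norm_iteratedFDeriv_fderiv]
      exact hτ (j + 1) (by omega) x)
    have hd : ∀ x, HasFDerivAt (fun x => ∫ τ, Φ τ x ∂μ) (∫ τ, fderiv ℝ (Φ τ) x ∂μ) x := by
      intro x
      have hmeas : ∀ x, AEStronglyMeasurable (fun τ => Φ τ x) μ := fun x =>
        (hΦ.continuous.comp (by fun_prop : Continuous fun τ : ℝ => (τ, x))).aestronglyMeasurable
      refine hasFDerivAt_integral_of_dominated_of_fderiv_le (F := fun x τ => Φ τ x)
        (F' := fun x τ => fderiv ℝ (Φ τ) x) (bound := b) univ_mem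
        (Eventually.of_forall hmeas) (hb.mono' (hmeas x) ?_)
        (hΦ'.continuous.comp (by fun_prop : Continuous fun τ : ℝ => (τ, x))).aestronglyMeasurable
        ?_ hb ?_
      · filter_upwards [h'] with τ hτ
        simpa using hτ x
      · filter_upwards [h] with τ hτ y _
        have := hτ 1 (by omega) y
        rwa [← norm_iteratedFDeriv_fderiv, norm_iteratedFDeriv_zero] at this
      · exact Eventually.of_forall fun τ y _ =>
          ((hcd τ).differentiable (by norm_cast)).differentiableAt.hasFDerivAt
    have hfd : fderiv ℝ (fun x => ∫ τ, Φ τ x ∂μ) = fun x => ∫ τ, fderiv ℝ (Φ τ) x ∂μ :=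
      funext fun x => (hd x).fderiv
    constructor
    · push_cast
      refine contDiff_succ_iff_fderiv.2 ⟨fun x => (hd x).differentiableAt, by simp, ?_⟩
      rw [hfd]
      exact h1
    · intro j hj x
      rcases Nat.eq_zero_or_pos j with rfl | hj0
      · simpa using h0 F Φ h' x
      · obtain ⟨j, rfl⟩ : ∃ k, j = k + 1 := ⟨j - 1, by omega⟩
        rw [← norm_iteratedFDeriv_fderiv, hfd]
        exact h2 j (by omega) x

theorem UBdd.integral {ι : Type*} {E F : Type u} [NormedAddCommGroup E] [NormedSpace ℝ E]
    [NormedAddCommGroup F] [NormedSpace ℝ F] {μ : Measure ℝ} {b : ℝ → ℝ} (hb : Integrable b μ)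
    {n : ℕ} {Φ : ι → ℝ → E → F} (hΦ : ∀ i, ContDiff ℝ n (Function.uncurry (Φ i)))
    (h : ∀ᵐ τ ∂μ, ∀ i, ∀ j ≤ n, ∀ x, ‖iteratedFDeriv ℝ j (Φ i τ) x‖ ≤ b τ) :
    UBdd 0 n (fun i x => ∫ τ, Φ i τ x ∂μ) := by
  have := fun i => contDiff_integral_of_bound hb n F (Φ i) (hΦ i) (h.mono fun τ hτ => hτ i)
  exact ⟨fun i => (this i).1, ∫ τ, b τ ∂μ, fun i j _ hj x => (this i).2 j hj x⟩

end ParametricIntegral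

/-! ### Cut-off functions -/

section Cutoffs

theorem exists_smooth_cutoff (R : ℝ) (hR : 0 < R) : ∃ b : ℝ → ℝ, (∀ n : ℕ, ContDiff ℝ n b) ∧
    (∀ t, |t| ≤ R → b t = 1) ∧ (∀ t, R + 1 ≤ |t| → b t = 0) ∧ (∀ t, 0 ≤ b t) ∧ ∀ t, b t ≤ 1 := by
  let B : ContDiffBump (0 : ℝ) := ⟨R, R + 1, hR, by linarith⟩
  refine ⟨B, fun n => B.contDiff, fun t ht => ?_, fun t ht => ?_, fun t => B.nonneg, fun t => B.le_one⟩
  · exact B.one_of_mem_closedBall (by simpa using ht)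
  · exact B.zero_of_le_dist (by simpa using ht)

/-- Smooth dependence of an integral over `[0,1]` on parameters, without any global bound. -/
theorem contDiff_intervalIntegral {E F : Type} [NormedAddCommGroup E] [NormedSpace ℝ E]
    [FiniteDimensional ℝ E] [NormedAddCommGroup F] [NormedSpace ℝ F] {n : ℕ} {Φ : ℝ → E → F}
    (hΦ : ContDiff ℝ n (Function.uncurry Φ)) :
    ContDiff ℝ n (fun x => ∫ σ in (0 : ℝ)..1, Φ σ x) := by
  rw [contDiff_iff_contDiffAt]
  intro x₀
  obtain ⟨b, hb, hb1, hb0, -, -⟩ := exists_smooth_cutoff 1 one_pos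
  let B : ContDiffBump x₀ := ⟨1, 2, by norm_num, by norm_num⟩
  -- Cutting off in both variables gives compact support and hence uniform bounds, without changing
  -- the integral for `x` near `x₀`.
  let Ψ : ℝ → E → F := fun σ x => b σ • B x • Φ σ x
  have hΨ : ContDiff ℝ n (Function.uncurry Ψ) :=
    ((hb n).comp contDiff_fst).smul ((B.contDiff.comp contDiff_snd).smul hΦ)
  have hs : HasCompactSupport (Function.uncurry Ψ) := by
    refine HasCompactSupport.intro
      ((isCompact_closedBall (0 : ℝ) 2).prod (isCompact_closedBall x₀ 2)) ?_
    rintro ⟨σ, x⟩ hx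
    simp only [mem_prod, Metric.mem_closedBall, dist_zero_right, Real.norm_eq_abs, not_and_or,
      not_le] at hx
    rcases hx with hx | hx
    · simp [Ψ, hb0 σ (by linarith)]
    · simp [Ψ, B.zero_of_le_dist hx.le]
  have hbd : UBdd 0 n (fun (σ : ℝ) (x : E) => Ψ σ x) := by
    have h1 : UBdd 1 n (fun (σ : ℝ) (x : E) => (σ, x)) := by
      simpa using UBdd.affine (n := n) (fun _ : ℝ => ContinuousLinearMap.inr ℝ ℝ E)
        (fun σ => (σ, (0 : E))) (fun _ => le_rfl)
    exact (UBdd.of_hasCompactSupport (ι := ℝ) hΨ hs).comp h1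
  obtain ⟨C, hC⟩ := hbd.2
  have h2 := (contDiff_integral_of_bound (μ := volume.restrict (Ioc (0 : ℝ) 1)) (b := fun _ => C)
    (integrable_const C) n F Ψ hΨ
    (Eventually.of_forall fun σ j hj x => hC σ j (Nat.zero_le _) hj x)).1
  refine h2.contDiffAt.congr_of_eventuallyEq ?_
  filter_upwards [Metric.closedBall_mem_nhds x₀ one_pos] with x hx
  rw [intervalIntegral.integral_of_le zero_le_one]
  refine setIntegral_congr_fun measurableSet_Ioc fun σ hσ => ?_
  simp [Ψ, B.one_of_mem_closedBall hx, hb1 σ (by rw [abs_of_pos hσ.1]; exact hσ.2)]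

end Cutoffs

/-! ### Regularity and periodicity of the cut-off field and delay -/

section Fields

variable {X : (ℝ × ℝ) × (ℝ × ℝ) → ℝ × ℝ} {r : ℝ × ℝ → ℝ} {h : ℝ} {K : ℝ × ℝ → ℝ × ℝ}
  {ω₀ lam₀ : ℝ} {φ : ℝ → ℝ}

/-- Hadamard's formula removes the division by `ε`, so joint smoothness up to `ε = 0` becomes
visible. -/
theorem pertP_eq_integral (hX : AnalyticOnNhd ℝ X univ) (x y : ℝ × ℝ) (ε : ℝ) :
    pertP X x y ε = ∫ σ in (0 : ℝ)..1, fderiv ℝ X (x, (σ * ε) • y) (0, y) := by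
  have hd : ∀ z, HasFDerivAt X (fderiv ℝ X z) z := fun z =>
    (hX z (mem_univ z)).differentiableAt.hasFDerivAt
  have hc : ∀ e : ℝ, HasDerivAt (fun e : ℝ => (x, e • y)) ((0 : ℝ × ℝ), y) e := fun e => by
    simpa using (hasDerivAt_const e x).prodMk ((hasDerivAt_id e).smul_const y)
  have h1 : ∀ e : ℝ, HasDerivAt (fun e : ℝ => X (x, e • y)) (fderiv ℝ X (x, e • y) (0, y)) e :=
    fun e => (hd _).comp_hasDerivAt e (hc e)
  unfold pertP
  by_cases hε : ε = 0
  · subst hε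
    rw [dslope_same, (h1 0).deriv]
    simp
  · rw [dslope_of_ne _ hε, slope_def_module]
    have hcont : Continuous fun σ : ℝ => fderiv ℝ X (x, (σ * ε) • y) (0, y) := by
      have : Continuous (fderiv ℝ X) :=
        (contDiffOn_univ.1 (hX.contDiffOn (n := 1) uniqueDiffOn_univ)).continuous_fderiv (by norm_num)
      fun_prop
    have h2 : ∀ σ ∈ uIcc (0 : ℝ) 1, HasDerivAt (fun σ : ℝ => X (x, (σ * ε) • y))
        (ε • fderiv ℝ X (x, (σ * ε) • y) (0, y)) σ := fun σ _ => by
      have := (h1 (σ * ε)).scomp σ ((hasDerivAt_id σ).mul_const ε)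
      simpa [Function.comp_def] using this
    have h3 := intervalIntegral.integral_eq_sub_of_hasDerivAt h2
      ((hcont.const_smul ε).intervalIntegrable _ _)
    rw [intervalIntegral.integral_smul] at h3
    simp only [one_mul, zero_mul] at h3
    rw [← h3, sub_zero, smul_smul, inv_mul_cancel₀ hε, one_smul]

theorem smul_pertP (X : (ℝ × ℝ) × (ℝ × ℝ) → ℝ × ℝ) (x y : ℝ × ℝ) (ε : ℝ) :
    ε • pertP X x y ε = X (x, ε • y) - X (x, 0) := by
  have := sub_smul_dslope (fun e : ℝ => X (x, e • y)) 0 ε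
  simpa [pertP] using this

theorem contDiff_pertP (hX : AnalyticOnNhd ℝ X univ) (n : ℕ) :
    ContDiff ℝ n (fun q : ((ℝ × ℝ) × (ℝ × ℝ)) × ℝ => pertP X q.1.1 q.1.2 q.2) := by
  simp_rw [pertP_eq_integral hX]
  have hXc : ContDiff ℝ (n + 1 : ℕ) X := contDiffOn_univ.1 (hX.contDiffOn uniqueDiffOn_univ)
  have hf : ContDiff ℝ n (fderiv ℝ X) := hXc.fderiv_right (by norm_cast)
  refine contDiff_intervalIntegral (Φ := fun σ (q : ((ℝ × ℝ) × (ℝ × ℝ)) × ℝ) =>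
    fderiv ℝ X (q.1.1, (σ * q.2) • q.1.2) (0, q.1.2)) ?_
  refine ContDiff.clm_apply (hf.comp (f := fun p : ℝ × ((ℝ × ℝ) × (ℝ × ℝ)) × ℝ =>
    (p.2.1.1, (p.1 * p.2.2) • p.2.1.2)) (by fun_prop)) (by fun_prop)

/-- At `|s| = 1` the derivative of `K` is not known to be periodic, since `K` is only periodic for
`|s| ≤ 1`. Continuity makes the cut-off vanish there, which closes the gap. -/
theorem IsCutoff.eq_zero_of_le (hφ : IsCutoff φ) {x : ℝ} (hx : 1 ≤ |x|) : φ x = 0 := by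
  rcases hx.lt_or_eq with h1 | h1
  · exact hφ.eq_zero x h1
  · have hx0 : x ≠ 0 := by rintro rfl; simp at h1
    have h2 : Tendsto (fun k : ℕ => φ (x * (1 + 1 / ((k : ℝ) + 1)))) atTop (𝓝 (φ x)) := by
      refine (hφ.smooth.continuous.tendsto x).comp ?_
      have := (tendsto_one_div_add_atTop_nhds_zero_nat (𝕜 := ℝ)).const_add 1 |>.const_mul x
      simpa using this
    refine tendsto_nhds_unique h2 (tendsto_const_nhds.congr fun k => ?_)
    refine (hφ.eq_zero _ ?_).symm
    rw [abs_mul, ← h1, one_mul, abs_of_pos (by positivity)]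
    have : (0 : ℝ) < 1 / ((k : ℝ) + 1) := by positivity
    linarith

theorem IsLimitCycleParam.contDiffAt {X₀ : ℝ × ℝ → ℝ × ℝ} (hK : IsLimitCycleParam X₀ K ω₀ lam₀)
    {w : ℝ × ℝ} (hw : |w.2| ≤ 1) (n : WithTop ℕ∞) : ContDiffAt ℝ n K w :=
  (hK.analytic w ⟨mem_univ _, abs_le.1 hw⟩).contDiffAt

theorem IsLimitCycleParam.fderiv_periodic {X₀ : ℝ × ℝ → ℝ × ℝ}
    (hK : IsLimitCycleParam X₀ K ω₀ lam₀) {w : ℝ × ℝ} (hw : |w.2| < 1) :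
    fderiv ℝ K (w + (1, 0)) = fderiv ℝ K w := by
  rw [← fderiv_comp_add_right]
  refine Filter.EventuallyEq.fderiv_eq ?_
  have : ∀ᶠ z : ℝ × ℝ in 𝓝 w, |z.2| < 1 :=
    (continuous_abs.comp continuous_snd).continuousAt.eventually_lt continuousAt_const hw
  filter_upwards [this] with z hz
  obtain ⟨θ, s⟩ := z
  simpa using hK.periodic θ s hz.le

/-- Where both second coordinates are at most one in modulus, `K` is analytic nearby and inversion
is smooth at the invertible `DK`. At every other point the cut-offs vanish in a neighborhood. -/
theorem contDiff_extY (hX : AnalyticOnNhd ℝ X univ)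
    (hK : IsLimitCycleParam (fun x => X (x, 0)) K ω₀ lam₀) (hφ : IsCutoff φ) (n : ℕ) :
    ContDiff ℝ n (fun q : ((ℝ × ℝ) × (ℝ × ℝ)) × ℝ => extY X K φ q.1.1 q.1.2 q.2) := by
  rw [contDiff_iff_contDiffAt]
  rintro ⟨⟨a, b⟩, ε⟩
  have hφn : ContDiff ℝ n φ := hφ.smooth.of_le (by exact_mod_cast le_top)
  by_cases hab : |a.2| ≤ 1 ∧ |b.2| ≤ 1
  · obtain ⟨ha, hb⟩ := hab
    have h1 : ContDiffAt ℝ n (fun q : ((ℝ × ℝ) × (ℝ × ℝ)) × ℝ => K q.1.1) ((a, b), ε) :=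
      (hK.contDiffAt ha n).comp ((a, b), ε) (f := fun q : ((ℝ × ℝ) × (ℝ × ℝ)) × ℝ => q.1.1)
        (by fun_prop)
    have h2 : ContDiffAt ℝ n (fun q : ((ℝ × ℝ) × (ℝ × ℝ)) × ℝ => K q.1.2) ((a, b), ε) :=
      (hK.contDiffAt hb n).comp ((a, b), ε) (f := fun q : ((ℝ × ℝ) × (ℝ × ℝ)) × ℝ => q.1.2)
        (by fun_prop)
    have h3 : ContDiffAt ℝ n (fun q : ((ℝ × ℝ) × (ℝ × ℝ)) × ℝ =>
        pertP X (K q.1.1) (K q.1.2) q.2) ((a, b), ε) :=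
      (contDiff_pertP hX n).contDiffAt.comp ((a, b), ε)
        (f := fun q : ((ℝ × ℝ) × (ℝ × ℝ)) × ℝ => ((K q.1.1, K q.1.2), q.2))
        ((h1.prodMk h2).prodMk contDiffAt_snd)
    have h4 : ContDiffAt ℝ n (fderiv ℝ K) a :=
      (hK.contDiffAt ha (n + 1 : ℕ)).fderiv_right (by norm_cast)
    obtain ⟨e, he⟩ := hK.localDiffeo a.1 a.2 ha
    have h5 : ContDiffAt ℝ n (fun w => (fderiv ℝ K w).inverse) a := by
      have h6 : ContDiffAt ℝ n (ContinuousLinearMap.inverse (R := ℝ) (M := ℝ × ℝ) (M₂ := ℝ × ℝ))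
          (fderiv ℝ K a) := by
        rw [← he]
        exact contDiffAt_map_inverse e
      exact h6.comp a h4
    have h7 : ContDiffAt ℝ n (fun q : ((ℝ × ℝ) × (ℝ × ℝ)) × ℝ => (fderiv ℝ K q.1.1).inverse)
        ((a, b), ε) :=
      h5.comp ((a, b), ε) (f := fun q : ((ℝ × ℝ) × (ℝ × ℝ)) × ℝ => q.1.1) (by fun_prop)
    have h8 : ContDiff ℝ n (fun q : ((ℝ × ℝ) × (ℝ × ℝ)) × ℝ => φ q.1.1.2 * φ q.1.2.2) :=
      (hφn.comp (by fun_prop)).mul (hφn.comp (by fun_prop))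
    exact h8.contDiffAt.smul (h7.clm_apply h3)
  · refine (contDiffAt_const (c := (0 : ℝ × ℝ))).congr_of_eventuallyEq ?_
    rw [not_and_or, not_le, not_le] at hab
    rcases hab with ha | hb
    · have : ∀ᶠ q : ((ℝ × ℝ) × (ℝ × ℝ)) × ℝ in 𝓝 ((a, b), ε), 1 < |q.1.1.2| :=
        ContinuousAt.eventually_lt continuousAt_const (by fun_prop) ha
      filter_upwards [this] with q hq
      simp [extY, hφ.eq_zero _ hq]
    · have : ∀ᶠ q : ((ℝ × ℝ) × (ℝ × ℝ)) × ℝ in 𝓝 ((a, b), ε), 1 < |q.1.2.2| :=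
        ContinuousAt.eventually_lt continuousAt_const (by fun_prop) hb
      filter_upwards [this] with q hq
      simp [extY, hφ.eq_zero _ hq]

theorem extY_add_left (hK : IsLimitCycleParam (fun x => X (x, 0)) K ω₀ lam₀) (hφ : IsCutoff φ)
    (a b : ℝ × ℝ) (ε : ℝ) : extY X K φ (a + (1, 0)) b ε = extY X K φ a b ε := by
  unfold extY
  by_cases ha : |a.2| < 1
  · unfold fieldY
    rw [hK.fderiv_periodic ha]
    have := hK.periodic a.1 a.2 ha.le
    simp [show a + (1, 0) = (a.1 + 1, a.2) from by ext <;> simp, this]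
  · have := hφ.eq_zero_of_le (not_lt.1 ha)
    simp [this]

theorem extY_add_right (hK : IsLimitCycleParam (fun x => X (x, 0)) K ω₀ lam₀) (hφ : IsCutoff φ)
    (a b : ℝ × ℝ) (ε : ℝ) : extY X K φ a (b + (1, 0)) ε = extY X K φ a b ε := by
  unfold extY
  by_cases hb : |b.2| < 1
  · unfold fieldY
    have := hK.periodic b.1 b.2 hb.le
    simp [show b + (1, 0) = (b.1 + 1, b.2) from by ext <;> simp, this]
  · have := hφ.eq_zero_of_le (not_lt.1 hb)
    simp [this]

theorem extY_eq_zero (hφ : IsCutoff φ) {a : ℝ × ℝ} (ha : 1 ≤ |a.2|) (b : ℝ × ℝ) (ε : ℝ) :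
    extY X K φ a b ε = 0 := by
  simp [extY, hφ.eq_zero_of_le ha]

theorem uBdd_extY (hX : AnalyticOnNhd ℝ X univ)
    (hK : IsLimitCycleParam (fun x => X (x, 0)) K ω₀ lam₀) (hφ : IsCutoff φ) (n : ℕ) :
    UBdd 0 n (fun (ε : Icc (0 : ℝ) 1) (p : (ℝ × ℝ) × (ℝ × ℝ)) => extY X K φ p.1 p.2 ε) := by
  obtain ⟨β, hβ, hβ1, hβ0, -, -⟩ := exists_smooth_cutoff 1 one_pos
  -- Treating `ε` as one more variable, cut off by `β`, turns uniformity over `ε ∈ [0,1]` into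
  -- compactness modulo the two angle translations.
  let f : ((ℝ × ℝ) × (ℝ × ℝ)) × ℝ → ℝ × ℝ := fun q => β q.2 • extY X K φ q.1.1 q.1.2 q.2
  have hf : ContDiff ℝ n f := ((hβ n).comp contDiff_snd).smul (contDiff_extY hX hK hφ n)
  have hp1 : Function.Periodic f (((1, 0), 0), 0) := fun q => by
    simp [f, extY_add_left hK hφ]
  have hp2 : Function.Periodic f ((0, (1, 0)), 0) := fun q => by
    simp [f, extY_add_right hK hφ]
  have hU : UBdd 0 n (fun _ : Icc (0 : ℝ) 1 => f) := by
    refine UBdd.of_periodic hf (isCompact_closedBall (0 : ((ℝ × ℝ) × (ℝ × ℝ)) × ℝ) 2) ?_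
    rintro ⟨⟨⟨a1, a2⟩, ⟨b1, b2⟩⟩, ε⟩
    by_cases hq : |a2| ≤ 1 ∧ |b2| ≤ 1 ∧ |ε| ≤ 2
    · left
      refine ⟨(-⌊a1⌋) • (((1, 0), 0), 0) + (-⌊b1⌋) • ((0, (1, 0)), 0),
        (hp1.zsmul _).add_period (hp2.zsmul _), ?_⟩
      have h1 := Int.fract_nonneg a1
      have h2 := (Int.fract_lt_one a1).le
      have h3 := Int.fract_nonneg b1
      have h4 := (Int.fract_lt_one b1).le
      rw [← Int.self_sub_floor] at h1 h2 h3 h4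
      simp only [mem_closedBall_zero_iff, Prod.norm_def, Real.norm_eq_abs, sup_le_iff]
      simp
      refine ⟨⟨⟨?_, by linarith⟩, ?_, by linarith⟩, hq.2.2⟩ <;>
      · rw [abs_le]; constructor <;> linarith
    · right
      rw [not_and_or, not_and_or, not_le, not_le, not_le] at hq
      rcases hq with ha | hb | hε
      · have : ∀ᶠ q : ((ℝ × ℝ) × (ℝ × ℝ)) × ℝ in 𝓝 (((a1, a2), (b1, b2)), ε), 1 < |q.1.1.2| :=
          ContinuousAt.eventually_lt continuousAt_const (by fun_prop) ha
        filter_upwards [this] with q hq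
        simp [f, extY, hφ.eq_zero _ hq]
      · have : ∀ᶠ q : ((ℝ × ℝ) × (ℝ × ℝ)) × ℝ in 𝓝 (((a1, a2), (b1, b2)), ε), 1 < |q.1.2.2| :=
          ContinuousAt.eventually_lt continuousAt_const (by fun_prop) hb
        filter_upwards [this] with q hq
        simp [f, extY, hφ.eq_zero _ hq]
      · have : ∀ᶠ q : ((ℝ × ℝ) × (ℝ × ℝ)) × ℝ in 𝓝 (((a1, a2), (b1, b2)), ε), 2 < |q.2| :=
          ContinuousAt.eventually_lt continuousAt_const (by fun_prop) hε
        filter_upwards [this] with q hq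
        simp [f, hβ0 q.2 (by linarith)]
  have hA : UBdd 1 n (fun (ε : Icc (0 : ℝ) 1) (p : (ℝ × ℝ) × (ℝ × ℝ)) => (p, (ε : ℝ))) := by
    simpa using UBdd.affine (n := n)
      (fun _ : Icc (0 : ℝ) 1 => ContinuousLinearMap.inl ℝ ((ℝ × ℝ) × (ℝ × ℝ)) ℝ)
      (fun ε => (0, (ε : ℝ))) (fun _ => le_rfl)
  have := hU.comp hA
  refine cast ?_ this
  congr 1
  ext1 ε
  ext1 p
  simp [f, hβ1 ε (by rw [abs_of_nonneg ε.2.1]; exact ε.2.2)]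

theorem uBdd_extDelay {ι : Type*} (hr : ContDiff ℝ (⊤ : ℕ∞) r) {X₀ : ℝ × ℝ → ℝ × ℝ}
    (hK : IsLimitCycleParam X₀ K ω₀ lam₀) (hφ : IsCutoff φ) (n : ℕ) :
    UBdd 0 n (fun (_ : ι) => extDelay r K φ) := by
  have hφn : ContDiff ℝ n φ := hφ.smooth.of_le (by exact_mod_cast le_top)
  have hrn : ContDiff ℝ n r := hr.of_le (by exact_mod_cast le_top)
  have hev : ∀ a : ℝ × ℝ, 1 < |a.2| → extDelay r K φ =ᶠ[𝓝 a] fun _ => 0 := fun a ha => by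
    have : ∀ᶠ q : ℝ × ℝ in 𝓝 a, 1 < |q.2| :=
      ContinuousAt.eventually_lt continuousAt_const (by fun_prop) ha
    filter_upwards [this] with q hq
    simp [extDelay, hφ.eq_zero _ hq]
  have hp : Function.Periodic (extDelay r K φ) (1, 0) := by
    rintro ⟨θ, s⟩
    by_cases hs : |s| ≤ 1
    · simp [extDelay, hK.periodic θ s hs]
    · simp [extDelay, hφ.eq_zero s (not_le.1 hs)]
  refine UBdd.of_periodic ?_ (isCompact_closedBall (0 : ℝ × ℝ) 2) ?_
  · rw [contDiff_iff_contDiffAt]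
    intro a
    by_cases ha : |a.2| ≤ 1
    · exact (hrn.contDiffAt.comp a (hK.contDiffAt ha n)).mul
        ((hφn.comp contDiff_snd).contDiffAt)
    · exact contDiffAt_const.congr_of_eventuallyEq (hev a (not_le.1 ha))
  · rintro ⟨a1, a2⟩
    by_cases ha : |a2| ≤ 1
    · refine Or.inl ⟨(-⌊a1⌋) • (1, 0), hp.zsmul _, ?_⟩
      have h1 := Int.fract_nonneg a1
      have h2 := (Int.fract_lt_one a1).le
      rw [← Int.self_sub_floor] at h1 h2
      simp only [mem_closedBall_zero_iff, Prod.norm_def, Real.norm_eq_abs, sup_le_iff]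
      simp
      refine ⟨?_, by linarith⟩
      rw [abs_le]; constructor <;> linarith
    · exact Or.inr (hev _ (not_le.1 ha))

theorem extDelay_mem_Icc (hrh : ∀ x, r x ∈ Icc 0 h) (hφ : IsCutoff φ) (w : ℝ × ℝ) :
    extDelay r K φ w ∈ Icc 0 h := by
  have h1 := hrh (K w)
  have h2 := hφ.mem_Icc w.2
  refine ⟨mul_nonneg h1.1 h2.1, ?_⟩
  calc r (K w) * φ w.2 ≤ r (K w) * 1 := by gcongr; exacts [h1.1, h2.2]
    _ ≤ h := by simpa using h1.2

theorem extDelay_periodic {X₀ : ℝ × ℝ → ℝ × ℝ} (hK : IsLimitCycleParam X₀ K ω₀ lam₀)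
    (hφ : IsCutoff φ) (a : ℝ × ℝ) : extDelay r K φ (a + (1, 0)) = extDelay r K φ a := by
  obtain ⟨θ, s⟩ := a
  by_cases hs : |s| ≤ 1
  · simp [extDelay, hK.periodic θ s hs]
  · simp [extDelay, hφ.eq_zero s (not_le.1 hs)]

end Fields

/-! ### From the invariance equation to limit cycle and isochrons -/

section Cycle

variable {X : (ℝ × ℝ) × (ℝ × ℝ) → ℝ × ℝ} {r : ℝ × ℝ → ℝ} {h : ℝ} {K : ℝ × ℝ → ℝ × ℝ}
  {ω₀ lam₀ : ℝ} {φ : ℝ → ℝ}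

theorem Function.Periodic.exists_forall_le {f : ℝ → ℝ} (hp : Function.Periodic f 1)
    (hf : Continuous f) : ∃ x, ∀ y, f y ≤ f x := by
  obtain ⟨x, _, hx⟩ := isCompact_Icc.exists_isMaxOn (nonempty_Icc.2 zero_le_one) hf.continuousOn
  refine ⟨x, fun y => ?_⟩
  obtain ⟨z, hz, hyz⟩ := hp.exists_mem_Ico₀ one_pos y
  rw [hyz]
  exact hx (Ico_subset_Icc_self hz)

/-- A property that is periodic in the angle and holds near `s = 0` holds on a strip. -/
theorem exists_strip {P : ℝ × ℝ → Prop} (hP : ∀ θ s, P (θ + 1, s) ↔ P (θ, s))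
    (h0 : ∀ θ : ℝ, ∀ᶠ z in 𝓝 (θ, (0 : ℝ)), P z) :
    ∃ δ : ℝ, 0 < δ ∧ ∀ θ s, |s| ≤ δ → P (θ, s) := by
  have h1 : ∀ᶠ s in 𝓝 (0 : ℝ), ∀ θ ∈ Icc (0 : ℝ) 1, P (θ, s) := by
    refine isCompact_Icc.eventually_forall_of_forall_eventually fun θ _ => ?_
    have : Tendsto (fun z : ℝ × ℝ => (z.2, z.1)) (𝓝 (0, θ)) (𝓝 (θ, 0)) := by
      rw [nhds_prod_eq, nhds_prod_eq]
      exact tendsto_snd.prodMk tendsto_fst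
    exact this.eventually (h0 θ)
  obtain ⟨δ, hδ, hs⟩ := Metric.eventually_nhds_iff_ball.1 h1
  refine ⟨δ / 2, by linarith, fun θ s hsδ => ?_⟩
  have hp : Function.Periodic (fun θ => P (θ, s)) 1 := fun θ => propext (hP θ s)
  obtain ⟨θ', hθ', he⟩ := hp.exists_mem_Ico₀ one_pos θ
  rw [show P (θ, s) = P (θ', s) from he]
  refine hs s ?_ θ' (Ico_subset_Icc_self hθ')
  rw [Metric.mem_ball, dist_zero_right, Real.norm_eq_abs]
  linarith

theorem hasDerivAt_characteristic (ω lam θ s t : ℝ) :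
    HasDerivAt (fun t : ℝ => (θ + ω * t, s * Real.exp (lam * t)))
      (ω, lam * (s * Real.exp (lam * t))) t := by
  have h1 : HasDerivAt (fun t : ℝ => θ + ω * t) ω t := by
    simpa using ((hasDerivAt_id t).const_mul ω).const_add θ
  have h2 : HasDerivAt (fun t : ℝ => s * Real.exp (lam * t)) (lam * (s * Real.exp (lam * t))) t := by
    have := (((hasDerivAt_id t).const_mul lam).exp).const_mul s
    simp only [id, mul_one] at this
    exact this.congr_deriv (by ring)
  exact h1.prodMk h2

theorem DifferentiableAt.hasDerivAt_comp_characteristic {W : ℝ × ℝ → ℝ × ℝ} {ω lam θ s t : ℝ}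
    (hW : DifferentiableAt ℝ W (θ + ω * t, s * Real.exp (lam * t))) :
    HasDerivAt (fun t : ℝ => W (θ + ω * t, s * Real.exp (lam * t)))
      (fderiv ℝ W (θ + ω * t, s * Real.exp (lam * t)) (ω, lam * (s * Real.exp (lam * t)))) t :=
  hW.hasFDerivAt.comp_hasDerivAt t (hasDerivAt_characteristic ω lam θ s t)

/-- Pushing forward by `DK` turns the linear part into `X(·, 0)` by invariance, and cancels `DK⁻¹`
in the perturbation, which restores the missing difference of `X`. -/
theorem IsLimitCycleParam.apply_fieldY
    (hK : IsLimitCycleParam (fun x => X (x, 0)) K ω₀ lam₀) {w v : ℝ × ℝ} (hw : |w.2| ≤ 1) (ε : ℝ) :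
    fderiv ℝ K w ((ω₀, lam₀ * w.2) + ε • fieldY X K w v ε) = X (K w, ε • K v) := by
  obtain ⟨e, he⟩ := hK.localDiffeo w.1 w.2 hw
  rw [Prod.mk.eta] at he
  have h1 : fderiv ℝ K w (fieldY X K w v ε) = pertP X (K w) (K v) ε := by
    unfold fieldY
    rw [← he, ContinuousLinearMap.inverse_equiv]
    simp
  have h2 := hK.invariance w.1 w.2 hw
  simp only [Prod.mk.eta] at h2
  rw [map_add, map_smul, h1, smul_pertP, ← h2]
  abel

/-- The bounds by `1/2` at the current and at the delayed point make all cut-offs equal to one. The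
delayed term is then `W` further back on the same characteristic, and the chain rule gives the delay
equation. -/
theorem SolvesExtInvariance.hasDerivAt {ε ω lam : ℝ} {W : ℝ × ℝ → ℝ × ℝ}
    (hK : IsLimitCycleParam (fun x => X (x, 0)) K ω₀ lam₀) (hφ : IsCutoff φ) {θ s t : ℝ}
    (hd : DifferentiableAt ℝ W (θ + ω * t, s * Real.exp (lam * t)))
    (heq : fderiv ℝ W (θ + ω * t, s * Real.exp (lam * t)) (ω, lam * (s * Real.exp (lam * t))) =
      (ω₀, lam₀ * (W (θ + ω * t, s * Real.exp (lam * t))).2) +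
        ε • extY X K φ (W (θ + ω * t, s * Real.exp (lam * t)))
          (delayedW r K φ ω lam W (θ + ω * t) (s * Real.exp (lam * t))) ε)
    (h1 : |(W (θ + ω * t, s * Real.exp (lam * t))).2| ≤ 1 / 2)
    (h2 : ∀ ρ, ρ = r (K (W (θ + ω * t, s * Real.exp (lam * t)))) →
      |(W (θ + ω * (t - ρ), s * Real.exp (lam * (t - ρ)))).2| ≤ 1 / 2) :
    HasDerivAt (fun t => K (W (θ + ω * t, s * Real.exp (lam * t))))
      (X (K (W (θ + ω * t, s * Real.exp (lam * t))),
        ε • (fun t => K (W (θ + ω * t, s * Real.exp (lam * t))))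
          (t - r (K (W (θ + ω * t, s * Real.exp (lam * t))))))) t := by
  set w := W (θ + ω * t, s * Real.exp (lam * t)) with hw
  have hdelay : extDelay r K φ w = r (K w) := by simp [extDelay, hφ.eq_one _ h1]
  have hv : delayedW r K φ ω lam W (θ + ω * t) (s * Real.exp (lam * t)) =
      W (θ + ω * (t - r (K w)), s * Real.exp (lam * (t - r (K w)))) := by
    unfold delayedW
    rw [← hw, hdelay, mul_assoc s, ← Real.exp_add]
    congr 3 <;> ring_nf
  have hKw : HasFDerivAt K (fderiv ℝ K w) w :=
    ((hK.contDiffAt (by linarith) 1).differentiableAt (by norm_num)).hasFDerivAt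
  have h3 := hKw.comp_hasDerivAt t (DifferentiableAt.hasDerivAt_comp_characteristic hd)
  rw [heq, hv] at h3
  have h4 := h2 _ rfl
  set v := W (θ + ω * (t - r (K w)), s * Real.exp (lam * (t - r (K w)))) with hvdef
  have h5 : extY X K φ w v ε = fieldY X K w v ε := by
    simp [extY, hφ.eq_one _ h1, hφ.eq_one _ h4]
  rw [h5, hK.apply_fieldY (by linarith)] at h3
  exact h3

/-- Solutions of the extended invariance equation parameterize limit cycles and isochrons. -/
theorem SolvesExtInvariance.paramCycleAndIsochrons (hX : AnalyticOnNhd ℝ X univ)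
    (hrh : ∀ x, r x ∈ Icc 0 h) (hK : IsLimitCycleParam (fun x => X (x, 0)) K ω₀ lam₀)
    (hφ : IsCutoff φ) :
    ∃ ε₀ : ℝ, 0 < ε₀ ∧ ∀ ε : ℝ, 0 ≤ ε → ε < ε₀ → ∀ (ω lam : ℝ) (W : ℝ × ℝ → ℝ × ℝ),
      0 < ω → lam < 0 → SolvesExtInvariance X r K φ ω₀ lam₀ ε ω lam W →
      ∃ s₁ : ℝ, 0 < s₁ ∧ ∀ s₀ : ℝ, 0 < s₀ → s₀ ≤ s₁ →
        ParamCycleAndIsochrons X r h K ε ω lam W s₀ := by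
  obtain ⟨M, hM0, hM⟩ := (uBdd_extY hX hK hφ 0).norm_le
  have hω₀ := hK.omega_pos
  have hlam₀ := hK.lam_neg
  have hh : 0 ≤ h := (hrh 0).1.trans (hrh 0).2
  -- The bound `M` holds for `ε ≤ 1`. The second entry yields `|W₂| ≤ 1/4` on the cycle, and the
  -- third keeps the angular velocity positive, so that the cycle is not constant.
  refine ⟨min 1 (min (-lam₀ / (4 * (M + 1))) (ω₀ / (M + 1))), ?_, ?_⟩
  · refine lt_min one_pos (lt_min ?_ ?_)
    · exact div_pos (by linarith) (by linarith)
    · positivity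
  intro ε hε hε₀ ω lam W hω hlam hW
  have hε1 : ε < 1 := hε₀.trans_le (min_le_left _ _)
  have hε2 : ε * (4 * (M + 1)) < -lam₀ :=
    (lt_div_iff₀ (by positivity)).1 (hε₀.trans_le ((min_le_right _ _).trans (min_le_left _ _)))
  have hε3 : ε * (M + 1) < ω₀ :=
    (lt_div_iff₀ (by positivity)).1 (hε₀.trans_le ((min_le_right _ _).trans (min_le_right _ _)))
  have hMY : ∀ a b, ‖ε • extY X K φ a b ε‖ ≤ ε * M := fun a b => by
    rw [norm_smul, Real.norm_eq_abs, abs_of_nonneg hε]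
    gcongr
    exact hM ⟨ε, hε, hε1.le⟩ (a, b)
  obtain ⟨δ, hδ, heq⟩ := hW.equation
  have hper2 : ∀ θ s, (W (θ + 1, s)).2 = (W (θ, s)).2 := fun θ s => by simp [hW.periodic]
  have hcyc : ∀ θ t : ℝ, HasDerivAt (fun t => W (θ + ω * t, 0))
      (fderiv ℝ W (θ + ω * t, 0) (ω, lam * 0)) t := fun θ t => by
    have := DifferentiableAt.hasDerivAt_comp_characteristic (ω := ω) (lam := lam) (θ := θ) (s := 0) (t := t)
      (by simpa using (heq (θ + ω * t) 0 (by simpa using hδ)).1)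
    simpa using this
  -- At a maximum of `W₂²` either `W₂ = 0` or `lam₀ W₂` balances the perturbation, which is smaller
  -- than `-lam₀ / 4`.
  have hcyc_bound : ∀ θ, |(W (θ, 0)).2| ≤ 1 / 4 := by
    obtain ⟨θ₁, hθ₁⟩ := Function.Periodic.exists_forall_le (f := fun θ => (W (θ, 0)).2 ^ 2)
      (fun θ => by simp [hper2]) (by have := hW.continuous; fun_prop)
    have hd : HasDerivAt (fun t => (W (θ₁ + ω * t, 0)).2 ^ 2)
        (2 * (W (θ₁, 0)).2 * (fderiv ℝ W (θ₁, 0) (ω, lam * 0)).2) 0 := by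
      have := (hasFDerivAt_snd.comp_hasDerivAt 0 (hcyc θ₁ 0)).fun_pow 2
      simpa [Function.comp_def] using this
    have hmax : IsLocalMax (fun t => (W (θ₁ + ω * t, 0)).2 ^ 2) 0 :=
      Eventually.of_forall fun t => by simpa using hθ₁ (θ₁ + ω * t)
    have h0 := hmax.hasDerivAt_eq_zero hd
    rw [(heq θ₁ 0 (by simpa using hδ)).2] at h0
    have hY := (norm_snd_le _).trans (hMY (W (θ₁, 0)) (delayedW r K φ ω lam W θ₁ 0))
    set y := (ε • extY X K φ (W (θ₁, 0)) (delayedW r K φ ω lam W θ₁ 0) ε).2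
    rw [Real.norm_eq_abs] at hY
    simp only [Prod.snd_add] at h0
    have h1 : |(W (θ₁, 0)).2| ≤ 1 / 4 := by
      rcases mul_eq_zero.1 h0 with h0 | h0
      · have : (W (θ₁, 0)).2 = 0 := by linarith
        rw [this]; norm_num
      · change lam₀ * (W (θ₁, 0)).2 + y = 0 at h0
        have h2 : -lam₀ * |(W (θ₁, 0)).2| = |y| := by
          rw [← abs_of_pos (show 0 < -lam₀ by linarith), ← abs_mul]
          congr 1
          linarith
        by_contra hcon
        push Not at hcon
        have : -lam₀ * (1 / 4) < -lam₀ * |(W (θ₁, 0)).2| := by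
          apply mul_lt_mul_of_pos_left hcon; linarith
        linarith
    intro θ
    exact (sq_le_sq.1 (hθ₁ θ)).trans h1
  obtain ⟨σ, hσ, hstrip⟩ := exists_strip (P := fun z => |(W z).2| ≤ 1 / 2)
    (fun θ s => by rw [hper2]) (fun θ => by
      have : ∀ᶠ z in 𝓝 (θ, (0 : ℝ)), |(W z).2| < 1 / 2 := by
        refine ContinuousAt.eventually_lt (by have := hW.continuous; fun_prop)
          continuousAt_const ?_
        have := hcyc_bound θ
        linarith
      exact this.mono fun z hz => hz.le)
  -- Going back by time `h` stretches `s` by `exp (-lam h)`; the factor `exp (lam h)` compensates,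
  -- so delayed points stay in the strip.
  refine ⟨min (1 / 4) (min σ (δ / 2) * Real.exp (lam * h)), ?_, fun s₀ hs₀ hs₁ => ?_⟩
  · refine lt_min (by norm_num) (mul_pos (lt_min hσ (by linarith)) (Real.exp_pos _))
  have hsmall : ∀ s t : ℝ, |s| ≤ s₀ → -h ≤ t → |s * Real.exp (lam * t)| ≤ min σ (δ / 2) := by
    intro s t hs ht
    rw [abs_mul, abs_of_pos (Real.exp_pos _)]
    calc |s| * Real.exp (lam * t) ≤ (min σ (δ / 2) * Real.exp (lam * h)) * Real.exp (-(lam * h)) := by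
          have h1 : |s| ≤ min σ (δ / 2) * Real.exp (lam * h) :=
            (hs.trans hs₁).trans (min_le_right _ _)
          have h2 : lam * t ≤ -(lam * h) := by nlinarith
          gcongr
      _ = min σ (δ / 2) := by
          rw [mul_assoc, ← Real.exp_add]; simp
  have hdom : ∀ θ s t : ℝ, |s| ≤ s₀ → -h ≤ t →
      |(W (θ + ω * t, s * Real.exp (lam * t))).2| ≤ 1 / 2 := fun θ s t hs ht =>
    hstrip _ _ ((hsmall s t hs ht).trans (min_le_left _ _))
  have hδs : ∀ s t : ℝ, |s| ≤ s₀ → -h ≤ t → |s * Real.exp (lam * t)| < δ := fun s t hs ht =>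
    ((hsmall s t hs ht).trans (min_le_right _ _)).trans_lt (by linarith)
  refine ⟨hdom, ?_, ?_, ?_, ?_, ?_⟩
  · intro θ
    have := hK.periodic (W (θ, 0)).1 (W (θ, 0)).2 (by have := hcyc_bound θ; linarith)
    rw [hW.periodic, ← this]
    congr 1
    ext <;> simp
  -- If `K ∘ W` were constant on the cycle, invertibility of `DK` would make the velocity of `W`
  -- vanish. Its first component is `ω₀` plus a term of modulus at most `ε M < ω₀`.
  · by_contra hcon
    push Not at hcon
    have hKW : ∀ w : ℝ × ℝ, |w.2| ≤ 1 → HasFDerivAt K (fderiv ℝ K w) w := fun w hw =>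
      ((hK.contDiffAt hw 1).differentiableAt (by norm_num)).hasFDerivAt
    have h1 := (hcyc 0 0)
    have h3 := HasFDerivAt.comp_hasDerivAt (x := (0 : ℝ)) (f := fun t => W (0 + ω * t, 0))
      (hl := hKW (W (0 + ω * 0, 0)) (by have := hcyc_bound (0 + ω * 0); linarith)) h1
    have h4 : (K ∘ fun t => W (0 + ω * t, 0)) = fun _ => K (W (0, 0)) := by
      ext1 t
      exact hcon _
    rw [h4] at h3
    have h5 := h3.unique (hasDerivAt_const (0 : ℝ) (K (W (0, 0))))
    simp only [mul_zero, add_zero] at h5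
    obtain ⟨e, he⟩ := hK.localDiffeo (W (0, 0)).1 (W (0, 0)).2
      (by have := hcyc_bound 0; linarith)
    rw [Prod.mk.eta] at he
    rw [← he] at h5
    have h6 := (heq 0 0 (by simpa using hδ)).2
    simp only [mul_zero] at h6
    have h7 := (e.map_eq_zero_iff).1 h5
    rw [h7] at h6
    have hY := (norm_fst_le _).trans (hMY (W (0, 0)) (delayedW r K φ ω lam W 0 0))
    have h8 := congrArg Prod.fst h6
    simp only [Prod.fst_zero, Prod.fst_add] at h8
    rw [Real.norm_eq_abs] at hY
    have h9 := (abs_le.1 hY).1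
    nlinarith
  · intro θ t _
    have := SolvesExtInvariance.hasDerivAt (X := X) (r := r) (ε := ε) (ω := ω) (lam := lam) (W := W)
      hK hφ (θ := θ) (s := 0) (t := t)
      (by simpa using (heq (θ + ω * t) 0 (by simpa using hδ)).1)
      (by simpa using (heq (θ + ω * t) 0 (by simpa using hδ)).2)
      (by have := hcyc_bound (θ + ω * t); simp only [zero_mul]; linarith)
      (fun ρ _ => by have := hcyc_bound (θ + ω * (t - ρ)); simp only [zero_mul]; linarith)
    simpa using this
  · intro θ s hs t ht
    have ht0 : 0 ≤ t := ht
    exact SolvesExtInvariance.hasDerivAt (X := X) (r := r) (ε := ε) (ω := ω) (lam := lam) (W := W)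
      hK hφ (heq _ _ (hδs s t hs (by linarith))).1 (heq _ _ (hδs s t hs (by linarith))).2
      (hdom θ s t hs (by linarith)) (fun ρ hρ => hdom θ s _ hs (by
        have := (hrh (K (W (θ + ω * t, s * Real.exp (lam * t))))).2
        rw [← hρ] at this
        linarith))
  · intro θ s hs
    rw [Metric.tendsto_nhds]
    intro e he
    have hKper : ∀ w : ℝ × ℝ, |w.2| ≤ 1 → K (w + (1, 0)) = K w := fun w hw => by
      have := hK.periodic w.1 w.2 hw
      rw [← this]
      congr 1
      ext <;> simp
    -- The bound on `W₂` is a premise inside the predicate because `K` is periodic only for `|s| ≤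
    -- 1`; without it the predicate need not be periodic in the angle.
    obtain ⟨d, hd, hst⟩ := exists_strip (P := fun z => |(W z).2| ≤ 1 / 2 →
        ‖K (W z) - K (W (z.1, 0))‖ < e)
      (fun θ s => by
        rw [hper2]
        refine forall_congr' fun hz => ?_
        simp only [hW.periodic]
        rw [hKper _ (by linarith), hKper _ (by have := hcyc_bound θ; linarith)])
      (fun θ => by
        have hKc : ContinuousAt K (W (θ, 0)) :=
          (hK.contDiffAt (by have := hcyc_bound θ; linarith) 1).continuousAt
        have hc : ContinuousAt (fun z : ℝ × ℝ => ‖K (W z) - K (W (z.1, 0))‖) (θ, 0) := by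
          have hWc := hW.continuous
          refine ContinuousAt.norm (ContinuousAt.sub ?_ ?_)
          · exact ContinuousAt.comp (f := W) hKc hWc.continuousAt
          · exact ContinuousAt.comp (f := fun z : ℝ × ℝ => W (z.1, 0)) hKc (by fun_prop)
        have := hc.eventually_lt continuousAt_const (show _ < e by simpa using he)
        exact this.mono fun z hz _ => hz)
    have hexp : Tendsto (fun t : ℝ => s * Real.exp (lam * t)) atTop (𝓝 0) := by
      have h1 : Tendsto (fun t : ℝ => lam * t) atTop atBot :=
        tendsto_id.const_mul_atTop_of_neg hlam
      simpa using (Real.tendsto_exp_atBot.comp h1).const_mul s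
    have hev : ∀ᶠ t : ℝ in atTop, |s * Real.exp (lam * t)| < d := by
      have := (Metric.tendsto_nhds.1 hexp) d hd
      simpa using this
    filter_upwards [hev, eventually_ge_atTop (0 : ℝ)] with t h1 h2
    rw [dist_zero_right]
    exact hst (θ + ω * t) _ h1.le (hdom θ s t hs (by linarith))

end Cycle

/-! ### Reduction of the delay equation to a planar field -/

section Reduction

/-- The flow of `(ω₀, lam₀ s)`, cut off for large times and large `s`. -/
noncomputable def freeFlow (ω₀ lam₀ : ℝ) (b : ℝ → ℝ) (x : ℝ × ℝ × ℝ) : ℝ × ℝ :=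
  (x.2.1 + ω₀ * (x.1 * b x.1), Real.exp (lam₀ * x.1) * b x.1 * (x.2.2 * b x.2.2))

/-- The perturbation `Y`, with its delayed argument expressed through the flow
`freeFlow + V` of the current point. -/
noncomputable def reducedField (Y : ℝ × ℝ → ℝ × ℝ → ℝ → ℝ × ℝ) (ρ : ℝ × ℝ → ℝ) (ω₀ lam₀ : ℝ)
    (b : ℝ → ℝ) (ε : ℝ) (V : ℝ × ℝ × ℝ → ℝ × ℝ) (a : ℝ × ℝ) : ℝ × ℝ :=
  Y a (freeFlow ω₀ lam₀ b (-ρ a, a) + V (-ρ a, a)) ε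

/-- The integrand of the variation of constants formula, with time rescaled to `[0,1]`. -/
noncomputable def duhamelIntegrand (Y : ℝ × ℝ → ℝ × ℝ → ℝ → ℝ × ℝ) (ρ : ℝ × ℝ → ℝ) (ω₀ lam₀ : ℝ)
    (b : ℝ → ℝ) (ε : ℝ) (V : ℝ × ℝ × ℝ → ℝ × ℝ) (q : ℝ × ℝ × ℝ × ℝ) : ℝ × ℝ :=
  let z : ℝ × ℝ × ℝ := (q.1 * q.2.1 * b q.2.1 * b q.1, q.2.2)
  let Q := reducedField Y ρ ω₀ lam₀ b ε V (freeFlow ω₀ lam₀ b z + V z)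
  (q.2.1 * b q.2.1 * b q.1 * Q.1,
    q.2.1 * Real.exp (lam₀ * (1 - q.1) * q.2.1) * b q.2.1 * b q.1 * Q.2)

/-- The right-hand side of the variation of constants formula for the deviation `V` of the flow
of the perturbed field from the free flow. -/
noncomputable def duhamelMap (Y : ℝ × ℝ → ℝ × ℝ → ℝ → ℝ × ℝ) (ρ : ℝ × ℝ → ℝ) (ω₀ lam₀ : ℝ)
    (b : ℝ → ℝ) (ε : ℝ) (V : ℝ × ℝ × ℝ → ℝ × ℝ) (x : ℝ × ℝ × ℝ) : ℝ × ℝ :=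
  ε • ∫ σ in (0 : ℝ)..1, duhamelIntegrand Y ρ ω₀ lam₀ b ε V (σ, x)

/-- Functions bounded by `1` in `C^n` and periodic in the angle. -/
def IsUnitPeriodic (n : ℕ) (V : ℝ × ℝ × ℝ → ℝ × ℝ) : Prop :=
  ContDiff ℝ n V ∧ (∀ j ≤ n, ∀ x, ‖iteratedFDeriv ℝ j V x‖ ≤ 1) ∧
    ∀ t w, V (t, w + (1, 0)) = V (t, w)

theorem uBdd_isUnitPeriodic (n : ℕ) :
    UBdd 0 n (fun V : {V : ℝ × ℝ × ℝ → ℝ × ℝ // IsUnitPeriodic n V} => V.1) :=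
  ⟨fun V => V.2.1, 1, fun V j _ hj x => V.2.2.1 j hj x⟩

variable {ι : Type*} {Y : ℝ × ℝ → ℝ × ℝ → ℝ → ℝ × ℝ} {ρ : ℝ × ℝ → ℝ} {ω₀ lam₀ : ℝ} {b : ℝ → ℝ}
  {R : ℝ}

theorem freeFlow_add (t : ℝ) (w : ℝ × ℝ) :
    freeFlow ω₀ lam₀ b (t, w + (1, 0)) = freeFlow ω₀ lam₀ b (t, w) + (1, 0) := by
  ext
  · simp [freeFlow]; ring
  · simp [freeFlow]

theorem uBdd_cutoff {n : ℕ} {c : ℝ × ℝ → ℝ} (hc : ContDiff ℝ n c)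
    (h1 : ∀ q : ℝ × ℝ, R + 1 ≤ |q.1| ∨ R + 1 ≤ |q.2| → c q = 0) :
    UBdd 0 n (fun _ : ι => c) := by
  refine UBdd.of_hasCompactSupport hc (HasCompactSupport.intro
    ((isCompact_closedBall (0 : ℝ) (R + 1)).prod (isCompact_closedBall (0 : ℝ) (R + 1))) ?_)
  rintro ⟨s, t⟩ hx
  simp only [mem_prod, mem_closedBall_zero_iff, Real.norm_eq_abs, not_and_or, not_le] at hx
  exact h1 _ (hx.imp le_of_lt le_of_lt)

/-- The angle enters additively, hence bounds only from order `1`. The remaining terms are functions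
of time and `s` that the cut-offs make compactly supported. -/
theorem uBdd_freeFlow (hb : ∀ n : ℕ, ContDiff ℝ n b) (hb0 : ∀ t, R + 1 ≤ |t| → b t = 0) (n : ℕ) :
    UBdd 1 n (fun _ : ι => freeFlow ω₀ lam₀ b) := by
  have hbn := hb n
  have h1 : UBdd 1 n (fun (_ : ι) (x : ℝ × ℝ × ℝ) => x.2.1) :=
    UBdd.clm ((ContinuousLinearMap.fst ℝ ℝ ℝ).comp (ContinuousLinearMap.snd ℝ ℝ (ℝ × ℝ)))
  have h2 : UBdd 1 n (fun (_ : ι) (x : ℝ × ℝ × ℝ) => (x.1, x.2.2)) :=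
    (UBdd.clm (ContinuousLinearMap.fst ℝ ℝ (ℝ × ℝ))).prodMk
      (UBdd.clm ((ContinuousLinearMap.snd ℝ ℝ ℝ).comp (ContinuousLinearMap.snd ℝ ℝ (ℝ × ℝ))))
  have h3 : UBdd 0 n (fun (_ : ι) (t : ℝ) => ω₀ * (t * b t)) := by
    refine UBdd.of_hasCompactSupport (by fun_prop) (HasCompactSupport.intro
      (isCompact_closedBall (0 : ℝ) (R + 1)) fun t ht => ?_)
    simp only [mem_closedBall_zero_iff, Real.norm_eq_abs, not_le] at ht
    simp [hb0 t ht.le]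
  have h4 : UBdd 0 n (fun (_ : ι) (q : ℝ × ℝ) => Real.exp (lam₀ * q.1) * b q.1 * (q.2 * b q.2)) := by
    refine uBdd_cutoff (R := R) (by fun_prop) ?_
    rintro ⟨s, t⟩ (h | h) <;> simp [hb0 _ h]
  have h5 := h3.comp (f := fun (_ : ι) (x : ℝ × ℝ × ℝ) => x.1)
    (UBdd.clm (ContinuousLinearMap.fst ℝ ℝ (ℝ × ℝ)))
  exact (h1.add (h5.mono zero_le_one le_rfl)).prodMk ((h4.comp h2).mono zero_le_one le_rfl)

theorem uBdd_reducedField (hb : ∀ n : ℕ, ContDiff ℝ n b) (hb0 : ∀ t, R + 1 ≤ |t| → b t = 0)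
    {n : ℕ} {ε : ι → Icc (0 : ℝ) 1} {V : ι → ℝ × ℝ × ℝ → ℝ × ℝ} (hV : UBdd 0 n V)
    (hY : UBdd 0 n (fun (ε : Icc (0 : ℝ) 1) (p : (ℝ × ℝ) × (ℝ × ℝ)) => Y p.1 p.2 ε))
    (hρ : UBdd 0 n (fun _ : ι => ρ)) :
    UBdd 0 n (fun i => reducedField Y ρ ω₀ lam₀ b (ε i) (V i)) := by
  have hU : UBdd 1 n (fun i x => freeFlow ω₀ lam₀ b x + V i x) :=
    (uBdd_freeFlow hb hb0 n).add (hV.mono zero_le_one le_rfl)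
  have hz : UBdd 1 n (fun (_ : ι) (a : ℝ × ℝ) => (-ρ a, a)) := by
    refine UBdd.prodMk ?_ UBdd.id
    simpa using (hρ.mono zero_le_one le_rfl).clm_comp_left (-ContinuousLinearMap.id ℝ ℝ)
  exact (hY.reindex ε).comp (UBdd.id.prodMk (hU.comp hz))

theorem uBdd_duhamelIntegrand (hb : ∀ n : ℕ, ContDiff ℝ n b) (hb0 : ∀ t, R + 1 ≤ |t| → b t = 0)
    {n : ℕ} {ε : ι → Icc (0 : ℝ) 1} {V : ι → ℝ × ℝ × ℝ → ℝ × ℝ} (hV : UBdd 0 n V)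
    (hY : UBdd 0 n (fun (ε : Icc (0 : ℝ) 1) (p : (ℝ × ℝ) × (ℝ × ℝ)) => Y p.1 p.2 ε))
    (hρ : UBdd 0 n (fun _ : ι => ρ)) :
    UBdd 0 n (fun i => duhamelIntegrand Y ρ ω₀ lam₀ b (ε i) (V i)) := by
  have hbn := hb n
  have hU : UBdd 1 n (fun i x => freeFlow ω₀ lam₀ b x + V i x) :=
    (uBdd_freeFlow hb hb0 n).add (hV.mono zero_le_one le_rfl)
  have hst : UBdd 1 n (fun (_ : ι) (q : ℝ × ℝ × ℝ × ℝ) => (q.1, q.2.1)) :=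
    (UBdd.clm (ContinuousLinearMap.fst ℝ ℝ (ℝ × ℝ × ℝ))).prodMk
      (UBdd.clm ((ContinuousLinearMap.fst ℝ ℝ (ℝ × ℝ)).comp
        (ContinuousLinearMap.snd ℝ ℝ (ℝ × ℝ × ℝ))))
  have hw : UBdd 1 n (fun (_ : ι) (q : ℝ × ℝ × ℝ × ℝ) => q.2.2) :=
    UBdd.clm ((ContinuousLinearMap.snd ℝ ℝ (ℝ × ℝ)).comp (ContinuousLinearMap.snd ℝ ℝ (ℝ × ℝ × ℝ)))
  have c0 : UBdd 0 n (fun (_ : ι) (p : ℝ × ℝ) => p.1 * p.2 * b p.2 * b p.1) := by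
    refine uBdd_cutoff (R := R) (by fun_prop) ?_
    rintro ⟨s, t⟩ (h | h) <;> simp [hb0 _ h]
  have c1 : UBdd 0 n (fun (_ : ι) (p : ℝ × ℝ) => p.2 * b p.2 * b p.1) := by
    refine uBdd_cutoff (R := R) (by fun_prop) ?_
    rintro ⟨s, t⟩ (h | h) <;> simp [hb0 _ h]
  have c2 : UBdd 0 n (fun (_ : ι) (p : ℝ × ℝ) =>
      p.2 * Real.exp (lam₀ * (1 - p.1) * p.2) * b p.2 * b p.1) := by
    refine uBdd_cutoff (R := R) (by fun_prop) ?_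
    rintro ⟨s, t⟩ (h | h) <;> simp [hb0 _ h]
  have hQ := (uBdd_reducedField (ω₀ := ω₀) (lam₀ := lam₀) hb hb0 (ε := ε) hV hY hρ).comp
    (hU.comp (((c0.comp hst).mono zero_le_one le_rfl).prodMk hw))
  exact ((c1.comp hst).mul hQ.fst).prodMk ((c2.comp hst).mul hQ.snd)

theorem reducedField_periodic (hY1 : ∀ a v ε, Y (a + (1, 0)) v ε = Y a v ε)
    (hY2 : ∀ a v ε, Y a (v + (1, 0)) ε = Y a v ε) (hρ : ∀ a, ρ (a + (1, 0)) = ρ a)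
    {V : ℝ × ℝ × ℝ → ℝ × ℝ} (hV : ∀ t w, V (t, w + (1, 0)) = V (t, w)) (ε : ℝ) (a : ℝ × ℝ) :
    reducedField Y ρ ω₀ lam₀ b ε V (a + (1, 0)) = reducedField Y ρ ω₀ lam₀ b ε V a := by
  unfold reducedField
  rw [hY1, hρ, freeFlow_add, hV, add_right_comm, hY2]

theorem duhamelMap_periodic (hY1 : ∀ a v ε, Y (a + (1, 0)) v ε = Y a v ε)
    (hY2 : ∀ a v ε, Y a (v + (1, 0)) ε = Y a v ε) (hρ : ∀ a, ρ (a + (1, 0)) = ρ a)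
    {V : ℝ × ℝ × ℝ → ℝ × ℝ} (hV : ∀ t w, V (t, w + (1, 0)) = V (t, w)) (ε t : ℝ) (w : ℝ × ℝ) :
    duhamelMap Y ρ ω₀ lam₀ b ε V (t, w + (1, 0)) = duhamelMap Y ρ ω₀ lam₀ b ε V (t, w) := by
  unfold duhamelMap duhamelIntegrand
  congr 2
  ext1 σ
  simp only
  rw [freeFlow_add, hV, add_right_comm, reducedField_periodic hY1 hY2 hρ hV]

/-- `V` occurs twice, as the point at which the field is evaluated and inside the field's delayed
argument. Evaluating the field of `V` at the point of `V'` as an intermediate term means that only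
the field of `V` must be Lipschitz; `V'` need only be continuous. -/
theorem norm_duhamelMap_sub_le {L₁ L₂ C d ε : ℝ} (hε : 0 ≤ ε) (hb : Continuous b)
    (hYc : Continuous fun p : (ℝ × ℝ) × (ℝ × ℝ) => Y p.1 p.2 ε) (hρ : Continuous ρ)
    {V V' : ℝ × ℝ × ℝ → ℝ × ℝ} (hV : Continuous V) (hV' : Continuous V')
    (hL₁0 : 0 ≤ L₁)
    (hL₁ : ∀ a a', ‖reducedField Y ρ ω₀ lam₀ b ε V a - reducedField Y ρ ω₀ lam₀ b ε V a'‖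
      ≤ L₁ * ‖a - a'‖)
    (hL₂0 : 0 ≤ L₂) (hL₂ : ∀ a v v', ‖Y a v ε - Y a v' ε‖ ≤ L₂ * ‖v - v'‖) (hC0 : 0 ≤ C)
    (hC1 : ∀ σ t, |t * b t * b σ| ≤ C)
    (hC2 : ∀ σ t, |t * Real.exp (lam₀ * (1 - σ) * t) * b t * b σ| ≤ C)
    (hd : ∀ x, ‖V x - V' x‖ ≤ d) (x : ℝ × ℝ × ℝ) :
    ‖duhamelMap Y ρ ω₀ lam₀ b ε V x - duhamelMap Y ρ ω₀ lam₀ b ε V' x‖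
      ≤ ε * (C * (L₁ + L₂)) * d := by
  have hfree : Continuous (freeFlow ω₀ lam₀ b) := by unfold freeFlow; fun_prop
  have hQc : ∀ V : ℝ × ℝ × ℝ → ℝ × ℝ, Continuous V →
      Continuous (reducedField Y ρ ω₀ lam₀ b ε V) := fun V hV => by
    exact hYc.comp (f := fun a : ℝ × ℝ => (a, freeFlow ω₀ lam₀ b (-ρ a, a) + V (-ρ a, a)))
      (by fun_prop)
  have hIc : ∀ V : ℝ × ℝ × ℝ → ℝ × ℝ, Continuous V →
      Continuous fun σ => duhamelIntegrand Y ρ ω₀ lam₀ b ε V (σ, x) := fun V hV => by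
    have := hQc V hV
    unfold duhamelIntegrand
    fun_prop
  unfold duhamelMap
  rw [← smul_sub, norm_smul, Real.norm_eq_abs, abs_of_nonneg hε, mul_assoc,
    ← intervalIntegral.integral_sub ((hIc V hV).intervalIntegrable _ _)
    ((hIc V' hV').intervalIntegrable _ _)]
  gcongr
  have key : ∀ σ, ‖duhamelIntegrand Y ρ ω₀ lam₀ b ε V (σ, x) -
      duhamelIntegrand Y ρ ω₀ lam₀ b ε V' (σ, x)‖ ≤ C * (L₁ + L₂) * d := by
    intro σ
    set z : ℝ × ℝ × ℝ := (σ * x.1 * b x.1 * b σ, x.2) with hz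
    have h1 : ‖reducedField Y ρ ω₀ lam₀ b ε V (freeFlow ω₀ lam₀ b z + V z) -
        reducedField Y ρ ω₀ lam₀ b ε V' (freeFlow ω₀ lam₀ b z + V' z)‖ ≤ (L₁ + L₂) * d := by
      refine (norm_sub_le_norm_sub_add_norm_sub _
        (reducedField Y ρ ω₀ lam₀ b ε V (freeFlow ω₀ lam₀ b z + V' z)) _).trans ?_
      rw [add_mul]
      refine add_le_add ((hL₁ _ _).trans ?_) ((hL₂ _ _ _).trans ?_)
      · gcongr
        rw [add_sub_add_left_eq_sub]
        exact hd z
      · gcongr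
        rw [add_sub_add_left_eq_sub]
        exact hd _
    unfold duhamelIntegrand
    simp only [Prod.mk_sub_mk, ← mul_sub, ← hz]
    rw [mul_assoc C, Prod.norm_mk]
    refine max_le ?_ ?_
    · rw [norm_mul]
      exact mul_le_mul (hC1 _ _) ((norm_fst_le _).trans h1) (norm_nonneg _) hC0
    · rw [norm_mul]
      exact mul_le_mul (hC2 _ _) ((norm_snd_le _).trans h1) (norm_nonneg _) hC0
  refine (intervalIntegral.norm_integral_le_of_norm_le_const fun σ _ => key σ).trans ?_
  simp

/-- A fixed point of the variation of constants formula yields a flow. -/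
theorem hasDerivAt_of_duhamelMap_eq {ε : ℝ} (hb : Continuous b) (hb1 : ∀ t, |t| ≤ R → b t = 1)
    (hR : 1 ≤ R) (hYc : Continuous fun p : (ℝ × ℝ) × (ℝ × ℝ) => Y p.1 p.2 ε) (hρ : Continuous ρ)
    {V : ℝ × ℝ × ℝ → ℝ × ℝ} (hV : Continuous V) (hfix : duhamelMap Y ρ ω₀ lam₀ b ε V = V)
    (w : ℝ × ℝ) {t : ℝ} (ht : |t| < R) :
    HasDerivAt (fun t => freeFlow ω₀ lam₀ b (t, w) + V (t, w))
      ((ω₀, lam₀ * (freeFlow ω₀ lam₀ b (t, w) + V (t, w)).2) +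
        ε • reducedField Y ρ ω₀ lam₀ b ε V (freeFlow ω₀ lam₀ b (t, w) + V (t, w))) t := by
  have hfree : Continuous (freeFlow ω₀ lam₀ b) := by unfold freeFlow; fun_prop
  have hQc : Continuous (reducedField Y ρ ω₀ lam₀ b ε V) :=
    hYc.comp (f := fun a : ℝ × ℝ => (a, freeFlow ω₀ lam₀ b (-ρ a, a) + V (-ρ a, a)))
      (by fun_prop)
  set U : ℝ → ℝ × ℝ := fun t => freeFlow ω₀ lam₀ b (t, w) + V (t, w) with hU
  set Q : ℝ → ℝ × ℝ := fun t => reducedField Y ρ ω₀ lam₀ b ε V (U t) with hQ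
  have hQtc : Continuous Q := by fun_prop
  -- For `|t| ≤ R` the time cut-offs equal one, and `τ = t σ` undoes the rescaling to `[0,1]`.
  -- Afterwards `t` appears only in limits of integration and in exponentials, and `U` can be
  -- differentiated explicitly.
  have hint : ∀ t, |t| ≤ R → V (t, w) = ε • (∫ τ in (0 : ℝ)..t, (Q τ).1,
      Real.exp (lam₀ * t) * ∫ τ in (0 : ℝ)..t, Real.exp (-(lam₀ * τ)) * (Q τ).2) := by
    intro t ht
    have hIc : Continuous fun σ => duhamelIntegrand Y ρ ω₀ lam₀ b ε V (σ, (t, w)) := by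
      unfold duhamelIntegrand
      fun_prop
    have e1 : ∀ σ ∈ uIcc (0 : ℝ) 1, duhamelIntegrand Y ρ ω₀ lam₀ b ε V (σ, (t, w)) =
        (t * (Q (t * σ)).1, t * Real.exp (lam₀ * (1 - σ) * t) * (Q (t * σ)).2) := by
      intro σ hσ
      rw [uIcc_of_le zero_le_one] at hσ
      have h1 : b σ = 1 := hb1 σ (by rw [abs_of_nonneg hσ.1]; linarith [hσ.2])
      simp only [duhamelIntegrand, hb1 t ht, h1, mul_one, hQ, hU, mul_comm σ t]
    conv_lhs => rw [← hfix]
    unfold duhamelMap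
    rw [intervalIntegral.integral_congr e1]
    congr 1
    have hJc : Continuous fun σ => (t * (Q (t * σ)).1,
      t * Real.exp (lam₀ * (1 - σ) * t) * (Q (t * σ)).2) := by fun_prop
    have hJ := hJc.intervalIntegrable (μ := volume) 0 1
    ext
    · have := (ContinuousLinearMap.fst ℝ ℝ ℝ).intervalIntegral_comp_comm hJ
      rw [ContinuousLinearMap.coe_fst'] at this
      rw [← this]
      simp only [intervalIntegral.integral_const_mul]
      have := intervalIntegral.smul_integral_comp_mul_left (a := 0) (b := 1) (fun τ => (Q τ).1) t
      simpa using this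
    · have := (ContinuousLinearMap.snd ℝ ℝ ℝ).intervalIntegral_comp_comm hJ
      rw [ContinuousLinearMap.coe_snd'] at this
      rw [← this]
      have h2 := intervalIntegral.smul_integral_comp_mul_left (a := 0) (b := 1)
        (fun τ => Real.exp (-(lam₀ * τ)) * (Q τ).2) t
      simp only [mul_zero, mul_one, smul_eq_mul] at h2
      rw [← h2, ← mul_assoc, ← intervalIntegral.integral_const_mul]
      refine intervalIntegral.integral_congr fun σ _ => ?_
      simp only
      rw [show lam₀ * (1 - σ) * t = lam₀ * t + -(lam₀ * (t * σ)) by ring, Real.exp_add]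
      ring
  have hev : U =ᶠ[𝓝 t] fun t => (w.1 + ω₀ * t + ε * ∫ τ in (0 : ℝ)..t, (Q τ).1,
      Real.exp (lam₀ * t) * (w.2 * b w.2 +
        ε * ∫ τ in (0 : ℝ)..t, Real.exp (-(lam₀ * τ)) * (Q τ).2)) := by
    have : ∀ᶠ t in 𝓝 t, |t| < R :=
      ContinuousAt.eventually_lt (by fun_prop) continuousAt_const ht
    filter_upwards [this] with t ht
    simp only [hU, hint t ht.le, freeFlow, hb1 t ht.le]
    ext
    · simp
    · simp
      ring
  have h1 : HasDerivAt (fun t => ∫ τ in (0 : ℝ)..t, (Q τ).1) (Q t).1 t :=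
    ((continuous_fst.comp hQtc).integral_hasStrictDerivAt 0 t).hasDerivAt
  have h2 : HasDerivAt (fun t => ∫ τ in (0 : ℝ)..t, Real.exp (-(lam₀ * τ)) * (Q τ).2)
      (Real.exp (-(lam₀ * t)) * (Q t).2) t :=
    (Continuous.integral_hasStrictDerivAt (by fun_prop) 0 t).hasDerivAt
  have h3 : HasDerivAt (fun t => Real.exp (lam₀ * t)) (Real.exp (lam₀ * t) * lam₀) t := by
    simpa using ((hasDerivAt_id t).const_mul lam₀).exp
  have h4 : HasDerivAt (fun t : ℝ => w.1 + ω₀ * t) ω₀ t := by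
    simpa using ((hasDerivAt_id t).const_mul ω₀).const_add w.1
  have h5 := (h4.add (h1.const_mul ε)).prodMk
    (h3.mul ((h2.const_mul ε).const_add (w.2 * b w.2)))
  change HasDerivAt U ((ω₀, lam₀ * (U t).2) + ε • Q t) t
  refine (h5.congr_of_eventuallyEq hev).congr_deriv ?_
  have hUt := congrArg Prod.snd hev.eq_of_nhds
  have hexp : Real.exp (lam₀ * t) * Real.exp (-(lam₀ * t)) = 1 := by rw [← Real.exp_add]; simp
  ext
  · simp
  · simp only [Prod.snd_add, Prod.smul_snd, smul_eq_mul, hUt]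
    linear_combination ε * (Q t).2 * hexp

/-- For small `ε`, the delay equation `w' = (ω₀, lam₀ w₂) + ε Y(w, w(· - ρ(w)), ε)` restricted to a
slow manifold: there is a planar vector field `(ω₀, lam₀ w₂) + g(w)` of class `C^m` whose flow `U`
on `[-h, 0]` gives the delayed argument. -/
theorem exists_reducedField {h : ℝ} (hh : 0 ≤ h)
    (hY : ∀ n, UBdd 0 n (fun (ε : Icc (0 : ℝ) 1) (p : (ℝ × ℝ) × (ℝ × ℝ)) => Y p.1 p.2 ε))
    (hY1 : ∀ a v ε, Y (a + (1, 0)) v ε = Y a v ε)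
    (hY2 : ∀ a v ε, Y a (v + (1, 0)) ε = Y a v ε)
    (hY0 : ∀ a v ε, 1 ≤ |a.2| → Y a v ε = 0)
    (hρ : ∀ n, UBdd 0 n (fun _ : Unit => ρ)) (hρ1 : ∀ a, ρ (a + (1, 0)) = ρ a) (m : ℕ) :
    ∃ ε₀ C : ℝ, 0 < ε₀ ∧ 0 ≤ C ∧ ∀ ε : ℝ, 0 ≤ ε → ε < ε₀ →
      ∃ (g : ℝ × ℝ → ℝ × ℝ) (U : ℝ → ℝ × ℝ → ℝ × ℝ), ContDiff ℝ m g ∧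
        (∀ w, g (w + (1, 0)) = g w) ∧ (∀ w, ‖g w‖ ≤ ε * C) ∧
        (∀ w w', ‖g w - g w'‖ ≤ ε * C * ‖w - w'‖) ∧ (∀ w : ℝ × ℝ, 1 ≤ |w.2| → g w = 0) ∧
        (∀ w, g w = ε • Y w (U (-ρ w) w) ε) ∧ (∀ w : ℝ × ℝ, |w.2| ≤ 1 → U 0 w = w) ∧
        ∀ w, ∀ t ∈ Icc (-h) 0,
          HasDerivAt (fun t => U t w) ((ω₀, lam₀ * (U t w).2) + g (U t w)) t := by
  -- The radius `h + 1` puts `[-h, 0]` strictly inside the region where time is not cut off, and is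
  -- at least one, so that `|w₂| ≤ 1` is untouched as well.
  obtain ⟨b, hb, hb1, hb0, -, -⟩ := exists_smooth_cutoff (h + 1) (by linarith)
  let J := {V : ℝ × ℝ × ℝ → ℝ × ℝ // IsUnitPeriodic (m + 1) V}
  have hV : UBdd 0 (m + 1) (fun i : J × Icc (0 : ℝ) 1 => i.1.1) :=
    (uBdd_isUnitPeriodic (m + 1)).reindex Prod.fst
  have hρ' := (hρ (m + 1)).reindex (fun _ : J × Icc (0 : ℝ) 1 => ())
  have hΨ := uBdd_duhamelIntegrand (ω₀ := ω₀) (lam₀ := lam₀) hb hb0 (ε := Prod.snd) hV (hY (m + 1)) hρ'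
  have hQ := uBdd_reducedField (ω₀ := ω₀) (lam₀ := lam₀) hb hb0 (ε := Prod.snd) hV (hY (m + 1)) hρ'
  have hI : UBdd 0 (m + 1) (fun (i : J × Icc (0 : ℝ) 1) x =>
      ∫ σ in (0 : ℝ)..1, duhamelIntegrand Y ρ ω₀ lam₀ b i.2 i.1.1 (σ, x)) := by
    have h1 : UBdd 1 (m + 1) (fun (i : (J × Icc (0 : ℝ) 1) × ℝ) (x : ℝ × ℝ × ℝ) => (i.2, x)) := by
      simpa using UBdd.affine (n := m + 1)
        (fun _ : (J × Icc (0 : ℝ) 1) × ℝ => ContinuousLinearMap.inr ℝ ℝ (ℝ × ℝ × ℝ))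
        (fun i => (i.2, 0)) (fun _ => le_rfl)
    obtain ⟨B, hB⟩ := ((hΨ.reindex Prod.fst).comp h1).2
    simp_rw [intervalIntegral.integral_of_le zero_le_one]
    exact UBdd.integral (μ := volume.restrict (Ioc (0 : ℝ) 1)) (b := fun _ => B)
      (integrable_const B) hΨ.1
      (Eventually.of_forall fun σ i j hj x => hB (i, σ) j (Nat.zero_le _) hj x)
  obtain ⟨C₁, hC₁0, hC₁⟩ := hI.nonneg_bound
  obtain ⟨L₁, hL₁0, hL₁⟩ := hQ.lipschitz zero_le_one (by omega)
  obtain ⟨L₂, hL₂0, hL₂⟩ := (hY 1).lipschitz zero_le_one le_rfl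
  obtain ⟨M, hM0, hM⟩ := (hY 0).norm_le
  have hbc : Continuous b := (hb 0).continuous
  have hρc : Continuous ρ := ((hρ 0).1 ()).continuous
  have hcoef : ∃ C₂ : ℝ, 0 ≤ C₂ ∧ (∀ σ t, |t * b t * b σ| ≤ C₂) ∧
      ∀ σ t, |t * Real.exp (lam₀ * (1 - σ) * t) * b t * b σ| ≤ C₂ := by
    have hb' := hb 0
    have c1 : UBdd 0 0 (fun (_ : Unit) (p : ℝ × ℝ) => p.2 * b p.2 * b p.1) := by
      refine uBdd_cutoff (R := h + 1) (by fun_prop) ?_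
      rintro ⟨s, t⟩ (h | h) <;> simp [hb0 _ h]
    have c2 : UBdd 0 0 (fun (_ : Unit) (p : ℝ × ℝ) =>
        p.2 * Real.exp (lam₀ * (1 - p.1) * p.2) * b p.2 * b p.1) := by
      refine uBdd_cutoff (R := h + 1) (by fun_prop) ?_
      rintro ⟨s, t⟩ (h | h) <;> simp [hb0 _ h]
    obtain ⟨C, hC0, hC⟩ := c1.norm_le
    obtain ⟨D, -, hD⟩ := c2.norm_le
    exact ⟨max C D, hC0.trans (le_max_left _ _),
      fun σ t => (hC () (σ, t)).trans (le_max_left _ _),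
      fun σ t => (hD () (σ, t)).trans (le_max_right _ _)⟩
  obtain ⟨C₂, hC₂0, hc1, hc2⟩ := hcoef
  -- The constant `C₁` makes the map preserve the unit ball of `C^(m+1)`, and `C₂ (L₁ + L₂)` makes
  -- it contract by `1/2`. All constants are uniform over that ball and over `ε ∈ [0,1]`.
  refine ⟨min 1 (min (1 / (C₁ + 1)) (1 / (2 * (C₂ * (L₁ + L₂) + 1)))), max M L₁, ?_,
    hM0.trans (le_max_left _ _), ?_⟩
  · refine lt_min one_pos (lt_min ?_ ?_) <;> positivity
  intro ε hε hεlt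
  have hε1 : ε < 1 := hεlt.trans_le (min_le_left _ _)
  have hε2 : ε * (C₁ + 1) < 1 :=
    (lt_div_iff₀ (by positivity)).1 (hεlt.trans_le ((min_le_right _ _).trans (min_le_left _ _)))
  have hε3 : ε * (2 * (C₂ * (L₁ + L₂) + 1)) < 1 :=
    (lt_div_iff₀ (by positivity)).1 (hεlt.trans_le ((min_le_right _ _).trans (min_le_right _ _)))
  have hεI : ε ∈ Icc (0 : ℝ) 1 := ⟨hε, hε1.le⟩
  have hYε : ContDiff ℝ m fun p : (ℝ × ℝ) × (ℝ × ℝ) => Y p.1 p.2 ε := (hY m).1 ⟨ε, hεI⟩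
  have hYL : ∀ a v v', ‖Y a v ε - Y a v' ε‖ ≤ L₂ * ‖v - v'‖ := fun a v v' => by
    have := hL₂ ⟨ε, hεI⟩ (a, v) (a, v')
    simpa [Prod.norm_def] using this
  obtain ⟨V, hVm, hfix, v, hv, hvlim⟩ := exists_contDiff_fixedPoint (N := m)
    (duhamelMap Y ρ ω₀ lam₀ b ε) (IsUnitPeriodic (m + 1)) 0
    ⟨contDiff_const, fun j _ x => by
      rw [show (0 : ℝ × ℝ × ℝ → ℝ × ℝ) = fun _ => 0 from rfl]; simp, fun _ _ => rfl⟩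
    (fun V hV => ⟨(hI.1 (⟨V, hV⟩, ⟨ε, hεI⟩)).const_smul ε, fun j hj x => by
      have hcd := hI.1 (⟨V, hV⟩, ⟨ε, hεI⟩)
      have : duhamelMap Y ρ ω₀ lam₀ b ε V = ε • fun x =>
        ∫ σ in (0 : ℝ)..1, duhamelIntegrand Y ρ ω₀ lam₀ b ε V (σ, x) := rfl
      rw [this, iteratedFDeriv_const_smul_apply (hcd.contDiffAt.of_le (by exact_mod_cast hj)),
        norm_smul, Real.norm_eq_abs, abs_of_nonneg hε]
      have := hC₁ (⟨V, hV⟩, ⟨ε, hεI⟩) j (Nat.zero_le _) hj x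
      calc _ ≤ ε * C₁ := by gcongr
        _ ≤ 1 := by nlinarith,
      duhamelMap_periodic hY1 hY2 hρ1 hV.2.2 ε⟩)
    (uBdd_isUnitPeriodic (m + 1)) (κ := 1 / 2) (by norm_num) (by norm_num)
    (fun V V' d hV hV' hd x => by
      have h1 := norm_duhamelMap_sub_le (Y := Y) (ρ := ρ) (ω₀ := ω₀) (lam₀ := lam₀) (b := b)
        hε hbc hYε.continuous hρc hV.1.continuous hV' hL₁0
        (hL₁ (⟨V, hV⟩, ⟨ε, hεI⟩)) hL₂0 hYL hC₂0 hc1 hc2 hd x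
      refine h1.trans ?_
      have hd0 : 0 ≤ d := (norm_nonneg _).trans (hd x)
      gcongr
      nlinarith)
  have hVper : ∀ t w, V (t, w + (1, 0)) = V (t, w) := fun t w =>
    tendsto_nhds_unique (hvlim _) ((hvlim (t, w)).congr fun n => ((hv n).2.2 t w).symm)
  refine ⟨fun w => ε • reducedField Y ρ ω₀ lam₀ b ε V w,
    fun t w => freeFlow ω₀ lam₀ b (t, w) + V (t, w), ?_, ?_, ?_, ?_, ?_, fun w => rfl, ?_, ?_⟩
  · have hbm := hb m
    have hρm : ContDiff ℝ m ρ := (hρ m).1 ()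
    have hfree : ContDiff ℝ m (freeFlow ω₀ lam₀ b) := by unfold freeFlow; fun_prop
    exact (hYε.comp (f := fun a : ℝ × ℝ =>
      (a, freeFlow ω₀ lam₀ b (-ρ a, a) + V (-ρ a, a))) (by fun_prop)).const_smul ε
  · intro w
    simp only [reducedField_periodic hY1 hY2 hρ1 hVper]
  · intro w
    rw [norm_smul, Real.norm_eq_abs, abs_of_nonneg hε]
    gcongr
    exact (hM ⟨ε, hεI⟩ (_, _)).trans (le_max_left _ _)
  · intro w w'
    -- The limit `V` need not lie in the class, so the Lipschitz constant `L₁` is inherited from the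
    -- iterates by pointwise convergence.
    have hlim : ∀ a, Tendsto (fun n => reducedField Y ρ ω₀ lam₀ b ε (v n) a) atTop
        (𝓝 (reducedField Y ρ ω₀ lam₀ b ε V a)) := fun a => by
      have hc : Continuous fun y => Y a y ε :=
        hYε.continuous.comp (f := fun y : ℝ × ℝ => (a, y)) (by fun_prop)
      exact (hc.tendsto _).comp ((hvlim (-ρ a, a)).const_add _)
    have h1 := le_of_tendsto ((hlim w).sub (hlim w')).norm
      (Eventually.of_forall fun n => hL₁ (⟨v n, hv n⟩, ⟨ε, hεI⟩) w w')
    rw [← smul_sub, norm_smul, Real.norm_eq_abs, abs_of_nonneg hε, mul_assoc]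
    gcongr
    refine h1.trans ?_
    gcongr
    exact le_max_right _ _
  · intro w hw
    simp [reducedField, hY0 _ _ _ hw]
  · intro w hw
    have h0 : V (0, w) = 0 := by
      rw [← hfix]
      simp [duhamelMap, duhamelIntegrand]
    simp [h0, freeFlow, hb1 0 (by simp; linarith), hb1 w.2 (by linarith)]
  · intro w t ht
    refine hasDerivAt_of_duhamelMap_eq hbc hb1 (by linarith) hYε.continuous hρc hVm.continuous hfix
      w (abs_lt.2 ⟨?_, ?_⟩)
    · linarith [ht.1]
    · linarith [ht.2]

end Reduction

/-! ### Periodic solutions of a weakly nonlinear scalar equation -/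

section PeriodicSolution

open BoundedContinuousFunction

theorem integrableOn_exp_mul_of_bound {α M : ℝ} (hα : 0 < α) {f : ℝ → ℝ} (hf : Continuous f)
    (hM : ∀ σ, |f σ| ≤ M) (θ : ℝ) : IntegrableOn (fun σ => Real.exp (α * σ) * f σ) (Iic θ) := by
  refine ((integrableOn_exp_mul_Iic hα θ).mul_const M).mono' (by fun_prop) ?_
  refine Eventually.of_forall fun σ => ?_
  rw [norm_mul, Real.norm_eq_abs, Real.abs_exp]
  gcongr
  exact hM σ

/-- The bounded solution of `x' = -α x + f`. -/
noncomputable def boundedSolution (α : ℝ) (f : ℝ → ℝ) (θ : ℝ) : ℝ :=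
  Real.exp (-(α * θ)) * ∫ σ in Iic θ, Real.exp (α * σ) * f σ

theorem hasDerivAt_boundedSolution {α M : ℝ} (hα : 0 < α) {f : ℝ → ℝ} (hf : Continuous f)
    (hM : ∀ σ, |f σ| ≤ M) (θ : ℝ) :
    HasDerivAt (boundedSolution α f) (-α * boundedSolution α f θ + f θ) θ := by
  have hint := integrableOn_exp_mul_of_bound hα hf hM
  have e1 : (fun θ => ∫ σ in Iic θ, Real.exp (α * σ) * f σ) = fun θ =>
      (∫ σ in Iic (0 : ℝ), Real.exp (α * σ) * f σ) + ∫ σ in (0 : ℝ)..θ, Real.exp (α * σ) * f σ := by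
    ext1 θ
    rw [← intervalIntegral.integral_Iic_sub_Iic (hint 0) (hint θ)]
    ring
  have h1 : HasDerivAt (fun θ => ∫ σ in Iic θ, Real.exp (α * σ) * f σ) (Real.exp (α * θ) * f θ) θ := by
    rw [e1]
    exact (Continuous.integral_hasStrictDerivAt (by fun_prop) 0 θ).hasDerivAt.const_add _
  have h2 : HasDerivAt (fun θ => Real.exp (-(α * θ))) (Real.exp (-(α * θ)) * -α) θ := by
    simpa using ((hasDerivAt_id θ).const_mul α).neg.exp
  refine (h2.mul h1).congr_deriv ?_
  have : Real.exp (-(α * θ)) * Real.exp (α * θ) = 1 := by rw [← Real.exp_add]; simp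
  unfold boundedSolution
  linear_combination f θ * this

theorem abs_boundedSolution_sub_le {α M : ℝ} (hα : 0 < α) {f f' : ℝ → ℝ} (hf : Continuous f)
    (hM : ∀ σ, |f σ| ≤ M) (hf' : Continuous f') (hM' : ∀ σ, |f' σ| ≤ M) {d : ℝ}
    (hd : ∀ σ, |f σ - f' σ| ≤ d) (θ : ℝ) :
    |boundedSolution α f θ - boundedSolution α f' θ| ≤ d / α := by
  unfold boundedSolution
  rw [← mul_sub, ← integral_sub (integrableOn_exp_mul_of_bound hα hf hM θ)
    (integrableOn_exp_mul_of_bound hα hf' hM' θ), abs_mul, Real.abs_exp]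
  have h1 : ‖∫ σ in Iic θ, (Real.exp (α * σ) * f σ - Real.exp (α * σ) * f' σ)‖ ≤
      ∫ σ in Iic θ, Real.exp (α * σ) * d := by
    refine norm_integral_le_of_norm_le ((integrableOn_exp_mul_Iic hα θ).mul_const d) ?_
    refine Eventually.of_forall fun σ => ?_
    rw [← mul_sub, norm_mul, Real.norm_eq_abs, Real.abs_exp]
    gcongr
    exact hd σ
  rw [integral_mul_const, integral_exp_mul_Iic hα] at h1
  calc Real.exp (-(α * θ)) * |∫ σ in Iic θ, (Real.exp (α * σ) * f σ - Real.exp (α * σ) * f' σ)|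
      ≤ Real.exp (-(α * θ)) * (Real.exp (α * θ) / α * d) := by gcongr; exact h1
    _ = (Real.exp (-(α * θ)) * Real.exp (α * θ)) * (d / α) := by ring
    _ = d / α := by rw [← Real.exp_add]; simp

theorem boundedSolution_add_one {α : ℝ} {f : ℝ → ℝ} (θ : ℝ) :
    boundedSolution α f (θ + 1) = boundedSolution α (fun σ => f (σ + 1)) θ := by
  unfold boundedSolution
  have h1 : ∫ σ in Iic (θ + 1), Real.exp (α * σ) * f σ =
      ∫ σ in Iic θ, Real.exp (α * (σ + 1)) * f (σ + 1) := by
    rw [← integral_indicator measurableSet_Iic, ← integral_indicator measurableSet_Iic,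
      ← integral_add_right_eq_self _ (1 : ℝ)]
    congr 1
    ext1 σ
    simp [Set.indicator]
  rw [h1]
  simp_rw [mul_add, mul_one, Real.exp_add, mul_right_comm _ (Real.exp α), neg_add, Real.exp_add]
  rw [integral_mul_const]
  have : Real.exp (-α) * Real.exp α = 1 := by rw [← Real.exp_add]; simp
  linear_combination Real.exp (-(α * θ)) * (∫ σ in Iic θ, Real.exp (α * σ) * f (σ + 1)) * this

/-- A periodic solution of a weakly nonlinear perturbation of `x' = -α x`. -/
theorem exists_periodic_solution {α : ℝ} (hα : 0 < α) {q : ℝ → ℝ → ℝ}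
    (hq : Continuous (Function.uncurry q)) (hper : ∀ θ z, q (θ + 1) z = q θ z) {M L : ℝ}
    (hM : ∀ θ z, |q θ z| ≤ M) (hL0 : 0 ≤ L) (hL : ∀ θ z z', |q θ z - q θ z'| ≤ L * |z - z'|)
    (hLα : L < α) :
    ∃ p : ℝ → ℝ, (∀ θ, p (θ + 1) = p θ) ∧ (∀ θ, |p θ| ≤ M / α) ∧
      ∀ θ, HasDerivAt p (-α * p θ + q θ (p θ)) θ := by
  have hqc : ∀ p : ℝ → ℝ, Continuous p → Continuous fun θ => q θ (p θ) := fun p hp =>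
    hq.comp (by fun_prop : Continuous fun θ => (θ, p θ))
  have hder : ∀ p : ℝ → ℝ, Continuous p → ∀ θ, HasDerivAt (boundedSolution α fun θ => q θ (p θ))
      (-α * boundedSolution α (fun θ => q θ (p θ)) θ + q θ (p θ)) θ := fun p hp =>
    hasDerivAt_boundedSolution hα (hqc p hp) (fun σ => hM _ _)
  have hbd : ∀ p : ℝ → ℝ, Continuous p → ∀ θ, |boundedSolution α (fun θ => q θ (p θ)) θ| ≤ M / α :=
    fun p hp θ => by
      have hM0 : 0 ≤ M := (abs_nonneg _).trans (hM 0 0)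
      have := abs_boundedSolution_sub_le hα (hqc p hp) (fun σ => hM _ _)
        (continuous_const (y := (0 : ℝ))) (fun _ => by simpa using hM0) (d := M)
        (fun σ => by simpa using hM _ _) θ
      have h0 : boundedSolution α (fun _ => (0 : ℝ)) θ = 0 := by simp [boundedSolution]
      rwa [h0, sub_zero] at this
  let Γ : (ℝ →ᵇ ℝ) → (ℝ →ᵇ ℝ) := fun p =>
    BoundedContinuousFunction.ofNormedAddCommGroup (boundedSolution α fun θ => q θ (p θ))
      (continuous_iff_continuousAt.2 fun θ => (hder p p.continuous θ).continuousAt) (M / α)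
      (hbd p p.continuous)
  have hΓ : ContractingWith (Real.toNNReal (L / α)) Γ := by
    refine ⟨Real.toNNReal_lt_one.2 ((div_lt_one hα).2 hLα),
      LipschitzWith.of_dist_le_mul fun p p' => ?_⟩
    refine (BoundedContinuousFunction.dist_le (by positivity)).2 fun θ => ?_
    rw [Real.dist_eq]
    refine (abs_boundedSolution_sub_le hα (hqc p p.continuous) (fun σ => hM _ _)
      (hqc p' p'.continuous) (fun σ => hM _ _) (d := L * dist p p') (fun σ => ?_) θ).trans ?_
    · refine (hL _ _ _).trans ?_
      gcongr
      rw [← Real.dist_eq]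
      exact BoundedContinuousFunction.dist_coe_le_dist σ
    · rw [Real.coe_toNNReal _ (by positivity), div_mul_eq_mul_div]
  set p := ContractingWith.fixedPoint Γ hΓ with hp
  have hfix : Γ p = p := hΓ.fixedPoint_isFixedPt
  have hfix' : ∀ θ, boundedSolution α (fun θ => q θ (p θ)) θ = p θ := fun θ =>
    congrArg (fun u : ℝ →ᵇ ℝ => u θ) hfix
  have hfun : boundedSolution α (fun θ => q θ (p θ)) = p := funext hfix'
  refine ⟨p, ?_, fun θ => ?_, fun θ => ?_⟩
  -- Periodicity comes from uniqueness: the translate by one is a fixed point too.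
  · let p1 : ℝ →ᵇ ℝ := p.compContinuous ⟨fun θ => θ + 1, by fun_prop⟩
    have h1 : Γ p1 = p1 := by
      ext θ
      change boundedSolution α (fun θ => q θ (p (θ + 1))) θ = p (θ + 1)
      rw [← hfix', boundedSolution_add_one]
      simp only [hper]
    have h2 : p1 = p := hΓ.fixedPoint_unique' h1 hfix
    intro θ
    exact congrArg (fun u : ℝ →ᵇ ℝ => u θ) h2
  · rw [← hfix']
    exact hbd p p.continuous θ
  · have := hder p p.continuous θ
    rwa [hfun] at this

end PeriodicSolution

/-! ### The invariant circle and the motion on it -/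

section PeriodicOrbit

/-- A solution of an ODE with `C^m` right-hand side is `C^(m+1)`. -/
theorem contDiff_of_hasDerivAt {m : ℕ} {F : ℝ × ℝ → ℝ} (hF : ContDiff ℝ m F) {p : ℝ → ℝ}
    (hp : ∀ θ, HasDerivAt p (F (θ, p θ)) θ) : ContDiff ℝ (m + 1 : ℕ) p := by
  have hd : deriv p = fun θ => F (θ, p θ) := funext fun θ => (hp θ).deriv
  have key : ∀ j : ℕ, j ≤ m + 1 → ContDiff ℝ j p := by
    intro j
    induction j with
    | zero =>
      intro _
      simp only [CharP.cast_eq_zero, contDiff_zero]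
      exact continuous_iff_continuousAt.2 fun θ => (hp θ).continuousAt
    | succ j ih =>
      intro hj
      push_cast
      refine contDiff_succ_iff_deriv.2 ⟨fun θ => (hp θ).differentiableAt, by simp, ?_⟩
      rw [hd]
      exact (hF.of_le (by exact_mod_cast (by omega : j ≤ m))).comp
        (contDiff_id.prodMk (ih (by omega)))
  exact key _ le_rfl

/-- A small perturbation of `(ω₀, lam₀ s)` has an invariant circle that is a graph. -/
theorem exists_invariant_graph {ω₀ lam₀ : ℝ} (hω₀ : 0 < ω₀) (hlam₀ : lam₀ < 0) :
    ∃ ν₀ C : ℝ, 0 < ν₀ ∧ 0 ≤ C ∧ ∀ ν : ℝ, 0 ≤ ν → ν ≤ ν₀ → ∀ (m : ℕ) (g : ℝ × ℝ → ℝ × ℝ),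
      ContDiff ℝ m g → (∀ w, g (w + (1, 0)) = g w) → (∀ w, ‖g w‖ ≤ ν) →
      (∀ w w', ‖g w - g w'‖ ≤ ν * ‖w - w'‖) →
      ∃ p : ℝ → ℝ, ContDiff ℝ m p ∧ (∀ θ, p (θ + 1) = p θ) ∧ (∀ θ, |p θ| ≤ C * ν) ∧
        ∀ θ, HasDerivAt p ((lam₀ * p θ + (g (θ, p θ)).2) / (ω₀ + (g (θ, p θ)).1)) θ := by
  set α := -lam₀ / ω₀ with hα
  have hα0 : 0 < α := div_pos (by linarith) hω₀
  set A := ω₀ - lam₀ with hA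
  have hA0 : 0 < A := by linarith
  set B := 2 * A / ω₀ ^ 2 with hB
  have hB0 : 0 < B := by positivity
  refine ⟨min (ω₀ / 2) (min (α / B) (α / (3 * B + 1)) / 2), B / α, ?_,
    by positivity, ?_⟩
  · refine lt_min (by positivity) (div_pos (lt_min ?_ ?_) (by norm_num)) <;> positivity
  intro ν hν hν₀ m g hg hgp hgν hgL
  have hν1 : ν ≤ ω₀ / 2 := hν₀.trans (min_le_left _ _)
  have hν2 : 2 * ν ≤ α / B := by
    have := (hν₀.trans (min_le_right _ _)).trans
      (div_le_div_of_nonneg_right (min_le_left _ _) (by norm_num))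
    linarith
  have hν3 : 2 * ν ≤ α / (3 * B + 1) := by
    have := (hν₀.trans (min_le_right _ _)).trans
      (div_le_div_of_nonneg_right (min_le_right _ _) (by norm_num))
    linarith
  rw [le_div_iff₀ (by positivity)] at hν2 hν3
  have hg1 : ∀ w, |(g w).1| ≤ ν := fun w => (norm_fst_le _).trans (hgν w)
  have hg2 : ∀ w, |(g w).2| ≤ ν := fun w => (norm_snd_le _).trans (hgν w)
  have hden : ∀ w, ω₀ / 2 ≤ ω₀ + (g w).1 := fun w => by
    have := (abs_le.1 (hg1 w)).1
    linarith
  have hden0 : ∀ w, ω₀ + (g w).1 ≠ 0 := fun w => (lt_of_lt_of_le (by positivity) (hden w)).ne'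
  -- The nonlinearity contains the term `lam₀ z g₁`, unbounded in `z`. Clamping `z` to `[-1,1]`
  -- gives the global bounds needed for the contraction.
  let c : ℝ → ℝ := fun z => max (-1) (min 1 z)
  have hc1 : ∀ z, |c z| ≤ 1 := fun z =>
    abs_le.2 ⟨le_max_left _ _, max_le (by norm_num) (min_le_left _ _)⟩
  have hcL : ∀ z z', |c z - c z'| ≤ |z - z'| := fun z z' =>
    (abs_max_sub_max_le_max _ _ _ _).trans (by
      rw [sub_self, abs_zero]
      refine max_le (abs_nonneg _) ((abs_min_sub_min_le_max _ _ _ _).trans ?_)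
      simp)
  have hcc : Continuous c := by fun_prop
  -- This is the splitting `(lam₀ z + g₂) / (ω₀ + g₁) = -α z + N / D` with `α = -lam₀ / ω₀`.
  let N : ℝ × ℝ → ℝ := fun w => ω₀ * (g w).2 - lam₀ * w.2 * (g w).1
  let D : ℝ × ℝ → ℝ := fun w => ω₀ * (ω₀ + (g w).1)
  have hD : ∀ w, ω₀ ^ 2 / 2 ≤ D w := fun w => by
    have := mul_le_mul_of_nonneg_left (hden w) hω₀.le
    simp only [D]; nlinarith
  have hDpos : ∀ w, 0 < D w := fun w => lt_of_lt_of_le (by positivity) (hD w)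
  have hN : ∀ w : ℝ × ℝ, |w.2| ≤ 1 → |N w| ≤ A * ν := fun w hw => by
    refine (abs_sub _ _).trans ?_
    rw [abs_mul, abs_mul, abs_mul, abs_of_pos hω₀, abs_of_neg hlam₀]
    have h1 := mul_le_mul hw (hg1 w) (abs_nonneg _) zero_le_one
    have h2 := mul_le_mul_of_nonneg_left (hg2 w) hω₀.le
    have h3 := mul_le_mul_of_nonneg_left h1 (by linarith : 0 ≤ -lam₀)
    rw [hA]; nlinarith
  let q : ℝ → ℝ → ℝ := fun θ z => N (θ, c z) / D (θ, c z)
  have hgc : Continuous g := hg.continuous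
  have hq : Continuous (Function.uncurry q) := by
    refine Continuous.div (by fun_prop) (by fun_prop) fun x => (hDpos _).ne'
  have hqM : ∀ θ z, |q θ z| ≤ B * ν := fun θ z => by
    simp only [q]
    rw [abs_div, abs_of_pos (hDpos _), div_le_iff₀ (hDpos _)]
    refine (hN _ (hc1 z)).trans ?_
    have h1 : B * ν * (ω₀ ^ 2 / 2) = A * ν := by rw [hB]; field_simp
    rw [← h1]
    exact mul_le_mul_of_nonneg_left (hD _) (by positivity)
  have hgL1 : ∀ θ z z', |(g (θ, z)).1 - (g (θ, z')).1| ≤ ν * |z - z'| := fun θ z z' => by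
    have h1 := (norm_fst_le _).trans (hgL (θ, z) (θ, z'))
    simpa [Prod.norm_def] using h1
  have hgL2 : ∀ θ z z', |(g (θ, z)).2 - (g (θ, z')).2| ≤ ν * |z - z'| := fun θ z z' => by
    have h1 := (norm_snd_le _).trans (hgL (θ, z) (θ, z'))
    simpa [Prod.norm_def] using h1
  have hqL : ∀ θ z z', |q θ z - q θ z'| ≤ (3 * B * ν) * |z - z'| := by
    intro θ z z'
    have hcz := hcL z z'
    have d1 : |(g (θ, c z)).1 - (g (θ, c z')).1| ≤ ν * |z - z'| :=
      (hgL1 _ _ _).trans (by gcongr)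
    have d2 : |(g (θ, c z)).2 - (g (θ, c z')).2| ≤ ν * |z - z'| :=
      (hgL2 _ _ _).trans (by gcongr)
    have hNL : |N (θ, c z) - N (θ, c z')| ≤ 2 * A * ν * |z - z'| := by
      have e1 : N (θ, c z) - N (θ, c z') = ω₀ * ((g (θ, c z)).2 - (g (θ, c z')).2) +
          (-lam₀) * ((c z - c z') * (g (θ, c z)).1 + c z' * ((g (θ, c z)).1 - (g (θ, c z')).1)) := by
        simp only [N]; ring
      rw [e1]
      refine (abs_add_le _ _).trans ?_
      rw [abs_mul, abs_mul, abs_of_pos hω₀, abs_of_pos (show 0 < -lam₀ by linarith)]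
      have h3 : |(c z - c z') * (g (θ, c z)).1 + c z' * ((g (θ, c z)).1 - (g (θ, c z')).1)| ≤
          2 * (ν * |z - z'|) := by
        refine (abs_add_le _ _).trans ?_
        rw [abs_mul, abs_mul]
        have h4 := mul_le_mul hcz (hg1 (θ, c z)) (abs_nonneg _) (abs_nonneg _)
        have h5 := mul_le_mul (hc1 z') d1 (abs_nonneg _) zero_le_one
        linarith
      have h6 := mul_le_mul_of_nonneg_left h3 (show 0 ≤ -lam₀ by linarith)
      have h7 := mul_le_mul_of_nonneg_left d2 hω₀.le
      have h8 : 0 ≤ ω₀ * (ν * |z - z'|) := by positivity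
      rw [hA]
      linarith
    have hDL : |D (θ, c z') - D (θ, c z)| ≤ ω₀ * (ν * |z - z'|) := by
      have e1 : D (θ, c z') - D (θ, c z) = ω₀ * ((g (θ, c z')).1 - (g (θ, c z)).1) := by
        simp only [D]; ring
      rw [e1, abs_mul, abs_of_pos hω₀, abs_sub_comm]
      gcongr
    have e2 : q θ z - q θ z' = (N (θ, c z) - N (θ, c z')) / D (θ, c z) +
        q θ z' * (D (θ, c z') - D (θ, c z)) / D (θ, c z) := by
      have h1 := (hDpos (θ, c z)).ne'
      have h2 := (hDpos (θ, c z')).ne'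
      simp only [q]
      field_simp
      ring
    rw [e2]
    refine (abs_add_le _ _).trans ?_
    rw [abs_div, abs_div, abs_of_pos (hDpos _), abs_mul (q θ z'), ← add_div, div_le_iff₀ (hDpos _)]
    have h3 := mul_le_mul (hqM θ z') hDL (abs_nonneg _) (by positivity)
    have h4 : 2 * A * ν * |z - z'| = 2 * B * ν * |z - z'| * (ω₀ ^ 2 / 2) := by
      rw [hB]; field_simp
    have h5 : B * ν * (ω₀ * (ν * |z - z'|)) ≤ B * ν * |z - z'| * (ω₀ ^ 2 / 2) := by
      have : 0 ≤ B * ν * |z - z'| * ω₀ := by positivity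
      have := mul_le_mul_of_nonneg_left hν1 this
      linarith
    have h6 : 3 * B * ν * |z - z'| * (ω₀ ^ 2 / 2) ≤ 3 * B * ν * |z - z'| * D (θ, c z) :=
      mul_le_mul_of_nonneg_left (hD _) (by positivity)
    linarith
  obtain ⟨p, hp1, hpb, hpd⟩ := exists_periodic_solution hα0 hq
    (fun θ z => by
      have : g (θ + 1, c z) = g (θ, c z) := by simpa using hgp (θ, c z)
      simp [q, N, D, this])
    hqM (by positivity) hqL (by nlinarith)
  have hpb' : ∀ θ, |p θ| ≤ B / α * ν := fun θ => by
    rw [div_mul_eq_mul_div]; exact hpb θ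
  -- The solution is bounded by `B ν / α ≤ 1`, so the clamp is inactive a posteriori.
  have hp1' : ∀ θ, c (p θ) = p θ := fun θ => by
    have h1 : |p θ| ≤ 1 := by
      refine (hpb θ).trans ((div_le_one hα0).2 ?_)
      nlinarith
    have h2 := abs_le.1 h1
    simp only [c]
    rw [min_eq_right h2.2, max_eq_right h2.1]
  have hpd' : ∀ θ, HasDerivAt p ((lam₀ * p θ + (g (θ, p θ)).2) / (ω₀ + (g (θ, p θ)).1)) θ := by
    intro θ
    refine (hpd θ).congr_deriv ?_
    simp only [q, hp1', N, D]
    have := hden0 (θ, p θ)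
    rw [hα]
    field_simp
    ring
  refine ⟨p, ?_, hp1, hpb', hpd'⟩
  have hF : ContDiff ℝ m fun w : ℝ × ℝ => (lam₀ * w.2 + (g w).2) / (ω₀ + (g w).1) :=
    ContDiff.div (by fun_prop) (by fun_prop) hden0
  exact (contDiff_of_hasDerivAt hF hpd').of_le (by norm_cast; omega)

/-- A periodic positive vector field on the line is conjugate to a constant one. -/
theorem exists_circle_conjugacy {m : ℕ} {γ : ℝ → ℝ} (hγ : ContDiff ℝ m γ)
    (hp : ∀ x, γ (x + 1) = γ x) {ω₀ ν : ℝ} (hω₀ : 0 < ω₀) (hν : ν ≤ ω₀ / 2)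
    (hγν : ∀ x, |γ x - ω₀| ≤ ν) :
    ∃ (ω : ℝ) (f : ℝ → ℝ), 0 < ω ∧ ContDiff ℝ m f ∧ (∀ θ, f (θ + 1) = f θ + 1) ∧
      (∀ θ, HasDerivAt f (γ (f θ) / ω) θ) ∧ |ω - ω₀| ≤ ν ∧ ∀ θ, |f θ - θ| ≤ 4 * ν / ω₀ := by
  have hlow : ∀ x, ω₀ / 2 ≤ γ x := fun x => by have := (abs_le.1 (hγν x)).1; linarith
  have hup : ∀ x, γ x ≤ 2 * ω₀ := fun x => by have := (abs_le.1 (hγν x)).2; linarith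
  have hpos : ∀ x, 0 < γ x := fun x => lt_of_lt_of_le (by positivity) (hlow x)
  have hinv : Continuous fun x => (γ x)⁻¹ := hγ.continuous.inv₀ fun x => (hpos x).ne'
  -- The travel time from `0` to `x`. Its inverse is the flow, `τ 1` is the period, and rescaling
  -- time by the period gives `f` with `ω = 1 / τ 1`.
  let τ : ℝ → ℝ := fun x => ∫ y in (0 : ℝ)..x, (γ y)⁻¹
  have hτ : ∀ x, HasDerivAt τ (γ x)⁻¹ x := fun x => (hinv.integral_hasStrictDerivAt 0 x).hasDerivAt
  have hτc : Continuous τ := continuous_iff_continuousAt.2 fun x => (hτ x).continuousAt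
  have hmono : StrictMono τ := strictMono_of_hasDerivAt_pos hτ fun x => inv_pos.2 (hpos x)
  have hmono' : Monotone fun x => τ x - (2 * ω₀)⁻¹ * x := by
    refine monotone_of_hasDerivAt_nonneg (f' := fun x => (γ x)⁻¹ - (2 * ω₀)⁻¹)
      (fun x => ?_) fun x => ?_
    · simpa using (hτ x).fun_sub ((hasDerivAt_id x).const_mul (2 * ω₀)⁻¹)
    · exact sub_nonneg.2 (inv_anti₀ (hpos x) (hup x))
  have hτ0 : τ 0 = 0 := by simp [τ]
  have hk : 0 < (2 * ω₀)⁻¹ := by positivity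
  have htop : Tendsto τ atTop atTop := by
    refine tendsto_atTop_mono' _ ?_ (tendsto_id.const_mul_atTop hk)
    filter_upwards [eventually_ge_atTop 0] with x hx
    have := hmono' hx
    simp only [hτ0, mul_zero, sub_zero] at this
    simp only [id]
    linarith
  have hbot : Tendsto τ atBot atBot := by
    refine tendsto_atBot_mono' _ ?_ (tendsto_id.const_mul_atBot hk)
    filter_upwards [eventually_le_atBot 0] with x hx
    have := hmono' hx
    simp only [hτ0, mul_zero, sub_zero] at this
    simp only [id]
    linarith
  let e := hmono.orderIsoOfSurjective τ (hτc.surjective htop hbot)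
  have he : ∀ y, τ (e.symm y) = y := fun y => e.apply_symm_apply y
  have hesymm : ∀ y, HasDerivAt e.symm (γ (e.symm y)) y := fun y => by
    have := HasDerivAt.of_local_left_inverse e.symm.continuous.continuousAt (hτ (e.symm y))
      (inv_ne_zero (hpos _).ne') (Eventually.of_forall he)
    rwa [inv_inv] at this
  have hτ1 : ∀ x, τ (x + 1) = τ x + τ 1 := fun x => by
    have h1 : Function.Periodic (fun y => (γ y)⁻¹) 1 := fun y => by simp [hp]
    have h2 := h1.intervalIntegral_add_eq x 0
    rw [zero_add] at h2
    simp only [τ]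
    rw [← h2, intervalIntegral.integral_add_adjacent_intervals] <;>
    exact hinv.intervalIntegrable _ _
  have hT : 0 < τ 1 := by rw [← hτ0]; exact hmono one_pos
  let f : ℝ → ℝ := fun θ => e.symm (τ 1 * θ)
  have hf1 : ∀ θ, f (θ + 1) = f θ + 1 := fun θ => by
    apply hmono.injective
    simp only [f]
    rw [hτ1, he, he]
    ring
  have hfd : ∀ θ, HasDerivAt f (γ (f θ) / (τ 1)⁻¹) θ := fun θ => by
    have h1 : HasDerivAt (fun θ => τ 1 * θ) (τ 1) θ := by
      simpa using (hasDerivAt_id θ).const_mul (τ 1)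
    refine ((hesymm (τ 1 * θ)).comp θ h1).congr_deriv ?_
    simp [f]
  have hf0 : f 0 = 0 := by
    apply hmono.injective
    simp only [f]
    rw [he, hτ0, mul_zero]
  have hfc : Continuous f := continuous_iff_continuousAt.2 fun x => (hfd x).continuousAt
  -- Since `f` grows by one over a unit interval, the mean value theorem finds a point where `γ ∘ f`
  -- equals the frequency.
  have hωω : |(τ 1)⁻¹ - ω₀| ≤ ν := by
    obtain ⟨ξ, _, hξ⟩ := exists_hasDerivAt_eq_slope f (fun θ => γ (f θ) / (τ 1)⁻¹) one_pos
      hfc.continuousOn (fun x _ => hfd x)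
    have hf1' : f 1 = 1 := by simpa [hf0] using hf1 0
    rw [hf1', hf0, sub_zero, div_one, div_eq_one_iff_eq (inv_ne_zero hT.ne')] at hξ
    rw [← hξ]
    exact hγν _
  refine ⟨(τ 1)⁻¹, f, inv_pos.2 hT, ?_, hf1, hfd, hωω, ?_⟩
  · exact (contDiff_of_hasDerivAt (F := fun w => γ w.2 / (τ 1)⁻¹) (by fun_prop) hfd).of_le
      (by norm_cast; omega)
  · have hper : Function.Periodic (fun θ => |f θ - θ|) 1 := fun θ => by
      simp only [hf1, add_sub_add_right_eq_sub]
    intro θ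
    obtain ⟨x, hx, hxe⟩ := hper.exists_mem_Ico₀ one_pos θ
    rw [show |f θ - θ| = |f x - x| from hxe]
    have hω2 : ω₀ / 2 ≤ (τ 1)⁻¹ := by have := (abs_le.1 hωω).1; linarith
    have h1 := Convex.norm_image_sub_le_of_norm_hasDerivWithin_le (s := univ)
      (f := fun θ => f θ - θ) (f' := fun θ => γ (f θ) / (τ 1)⁻¹ - 1) (C := 4 * ν / ω₀)
      (x := 0) (y := x) (fun y _ => ((hfd y).sub (hasDerivAt_id y)).hasDerivWithinAt)
      (fun y _ => ?_) convex_univ (mem_univ _) (mem_univ _)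
    · simp only [hf0, sub_zero, Real.norm_eq_abs] at h1
      refine h1.trans ?_
      have hν0 : 0 ≤ ν := (abs_nonneg _).trans (hγν 0)
      rw [abs_of_nonneg hx.1]
      exact mul_le_of_le_one_right (by positivity) hx.2.le
    · have hν0 : 0 ≤ ν := (abs_nonneg _).trans (hγν 0)
      rw [div_sub_one (inv_ne_zero hT.ne'), norm_div, Real.norm_eq_abs, Real.norm_eq_abs,
        abs_of_pos (inv_pos.2 hT), div_le_div_iff₀ (inv_pos.2 hT) hω₀]
      have h2 : |γ (f y) - (τ 1)⁻¹| ≤ 2 * ν := by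
        have h3 := abs_sub_le (γ (f y)) ω₀ (τ 1)⁻¹
        have h4 := hγν (f y)
        rw [abs_sub_comm] at hωω
        linarith
      nlinarith

end PeriodicOrbit

/-! ### Floquet normal form near the invariant circle -/

section Floquet

theorem ContinuousLinearMap.isInvertible_of_injective {E : Type*} [NormedAddCommGroup E]
    [NormedSpace ℝ E] [FiniteDimensional ℝ E] {L : E →L[ℝ] E} (hL : Function.Injective L) :
    L.IsInvertible :=
  ⟨(LinearEquiv.ofInjectiveEndo L.toLinearMap hL).toContinuousLinearEquiv, by ext; rfl⟩

/-- Tubular coordinates `(θ, y) ↦ (f θ, P θ + c θ y)` around the graph of a function. -/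
def tubularCoord (f P c : ℝ → ℝ) (x : ℝ × ℝ) : ℝ × ℝ := (f x.1, P x.1 + c x.1 * x.2)

theorem hasFDerivAt_tubularCoord {f P c : ℝ → ℝ} {x : ℝ × ℝ} {f' P' c' : ℝ}
    (hf : HasDerivAt f f' x.1) (hP : HasDerivAt P P' x.1) (hc : HasDerivAt c c' x.1) :
    ∃ L : ℝ × ℝ →L[ℝ] ℝ × ℝ, HasFDerivAt (tubularCoord f P c) L x ∧
      ∀ v : ℝ × ℝ, L v = (f' * v.1, (P' + c' * x.2) * v.1 + c x.1 * v.2) := by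
  have h1 := hf.hasFDerivAt.comp x hasFDerivAt_fst
  have h2 := hP.hasFDerivAt.comp x hasFDerivAt_fst
  have h3 := (hc.hasFDerivAt.comp x hasFDerivAt_fst).mul (hasFDerivAt_snd (𝕜 := ℝ) (p := x))
  refine ⟨_, h1.prodMk (h2.add h3), fun v => ?_⟩
  ext
  · simp; ring
  · simp; ring

theorem taylor_one {G : ℝ × ℝ → ℝ × ℝ} (hG : ContDiff ℝ 1 G) (a z ξ : ℝ) :
    G (a, z + ξ) = G (a, z) + ξ • ∫ σ in (0 : ℝ)..1, fderiv ℝ G (a, z + σ * ξ) (0, 1) := by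
  have h1 : ∀ σ ∈ uIcc (0 : ℝ) 1, HasDerivAt (fun σ : ℝ => G (a, z + σ * ξ))
      (ξ • fderiv ℝ G (a, z + σ * ξ) (0, 1)) σ := fun σ _ => by
    have h2 : HasDerivAt (fun σ : ℝ => (a, z + σ * ξ)) ((0 : ℝ), ξ) σ := by
      simpa using (hasDerivAt_const σ a).prodMk (((hasDerivAt_id σ).mul_const ξ).const_add z)
    have h3 := ((hG.differentiable (by norm_num)) (a, z + σ * ξ)).hasFDerivAt.comp_hasDerivAt σ h2
    rw [show ((0 : ℝ), ξ) = ξ • ((0 : ℝ), (1 : ℝ)) by simp, map_smul] at h3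
    exact h3
  have hc : Continuous fun σ : ℝ => fderiv ℝ G (a, z + σ * ξ) (0, 1) := by
    have := hG.continuous_fderiv (by norm_num)
    fun_prop
  have h4 := intervalIntegral.integral_eq_sub_of_hasDerivAt h1 ((hc.const_smul ξ).intervalIntegrable _ _)
  rw [intervalIntegral.integral_smul] at h4
  simp only [one_mul, zero_mul, add_zero] at h4
  rw [h4]
  abel

/-- Applied to the transverse derivative of a field, this expands the first-order remainder of
`taylor_one` once more. The second-order remainder is an integral depending smoothly on its
arguments, so no division by `ξ` occurs. -/
theorem taylor_two {G : ℝ × ℝ → ℝ × ℝ} (hG : ContDiff ℝ 1 G) (a z ξ : ℝ) :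
    ∫ τ in (0 : ℝ)..1, G (a, z + τ * ξ) = G (a, z) + ξ • ∫ τ in (0 : ℝ)..1,
      τ • ∫ σ in (0 : ℝ)..1, fderiv ℝ G (a, z + σ * (τ * ξ)) (0, 1) := by
  have hc : Continuous fun τ : ℝ => ξ • τ • ∫ σ in (0 : ℝ)..1,
      fderiv ℝ G (a, z + σ * (τ * ξ)) (0, 1) := by
    have := hG.continuous_fderiv (by norm_num)
    refine (continuous_id.smul ?_).const_smul ξ
    exact intervalIntegral.continuous_parametric_intervalIntegral_of_continuous' (by fun_prop) _ _
  have h1 : ∀ τ : ℝ, G (a, z + τ * ξ) = G (a, z) + ξ • (τ • ∫ σ in (0 : ℝ)..1,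
      fderiv ℝ G (a, z + σ * (τ * ξ)) (0, 1)) := fun τ => by
    rw [taylor_one hG a z (τ * ξ), smul_smul, mul_comm ξ τ]
  simp_rw [h1]
  rw [intervalIntegral.integral_add (by simp) (hc.intervalIntegrable _ _),
    intervalIntegral.integral_smul]
  simp

/-- Floquet coordinates around a periodic orbit of a planar vector field. -/
theorem exists_floquet_coordinates {n : ℕ} {G : ℝ × ℝ → ℝ × ℝ} (hG : ContDiff ℝ (n + 2 : ℕ) G)
    (hGp : ∀ w, G (w + (1, 0)) = G w) {p f : ℝ → ℝ} {ω : ℝ} (hω : 0 < ω)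
    (hp : ContDiff ℝ (n + 2 : ℕ) p) (hp1 : ∀ θ, p (θ + 1) = p θ)
    (hf : ContDiff ℝ (n + 2 : ℕ) f) (hf1 : ∀ θ, f (θ + 1) = f θ + 1)
    (hpos : ∀ θ, 0 < (G (θ, p θ)).1)
    (hpd : ∀ θ, HasDerivAt p ((G (θ, p θ)).2 / (G (θ, p θ)).1) θ)
    (hfd : ∀ θ, HasDerivAt f ((G (f θ, p (f θ))).1 / ω) θ) {lam : ℝ}
    (hlam : lam = ∫ θ in (0 : ℝ)..1, ((fderiv ℝ G (f θ, p (f θ)) (0, 1)).2 -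
      deriv p (f θ) * (fderiv ℝ G (f θ, p (f θ)) (0, 1)).1)) :
    ∃ (Ω : ℝ × ℝ → ℝ × ℝ) (α β : ℝ × ℝ → ℝ), ContDiff ℝ n Ω ∧ ContDiff ℝ n α ∧ ContDiff ℝ n β ∧
      (∀ x, Ω (x + (1, 0)) = Ω x + (1, 0)) ∧ (∀ x, α (x + (1, 0)) = α x) ∧
      (∀ x, β (x + (1, 0)) = β x) ∧ (∀ θ, Ω (θ, 0) = (f θ, p (f θ))) ∧ Differentiable ℝ Ω ∧
      (∀ x : ℝ × ℝ, fderiv ℝ Ω x (ω + x.2 * α x, lam * x.2 + x.2 ^ 2 * β x) = G (Ω x)) ∧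
      ∀ θ, (fderiv ℝ Ω (θ, 0)).IsInvertible := by
  set G' : ℝ × ℝ → ℝ × ℝ := fun w => fderiv ℝ G w (0, 1) with hG'
  have hG'c : ContDiff ℝ (n + 1 : ℕ) G' := (hG.fderiv_right (by norm_cast)).clm_apply contDiff_const
  set G'' : ℝ × ℝ → ℝ × ℝ := fun w => fderiv ℝ G' w (0, 1) with hG''
  have hG''c : ContDiff ℝ n G'' := (hG'c.fderiv_right (by norm_cast)).clm_apply contDiff_const
  have hG'p : ∀ w, G' (w + (1, 0)) = G' w := fun w => by
    simp only [hG']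
    rw [← fderiv_comp_add_right]
    simp only [hGp]
  have hG''p : ∀ w, G'' (w + (1, 0)) = G'' w := fun w => by
    simp only [hG'']
    rw [← fderiv_comp_add_right]
    simp only [hG'p]
  have hGn : ContDiff ℝ (n + 1 : ℕ) G := hG.of_le (by norm_cast; omega)
  have hpn : ContDiff ℝ (n + 1 : ℕ) p := hp.of_le (by norm_cast; omega)
  have hfn : ContDiff ℝ (n + 1 : ℕ) f := hf.of_le (by norm_cast; omega)
  set p' : ℝ → ℝ := fun θ => deriv p (f θ) with hp'
  have hp'c : ContDiff ℝ (n + 1 : ℕ) p' := by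
    have : ContDiff ℝ ((n + 1 : ℕ) + 1) p := by exact_mod_cast hp
    exact (contDiff_succ_iff_deriv.1 this).2.2.comp hfn
  have hp'p : ∀ θ, p' (θ + 1) = p' θ := fun θ => by
    simp only [hp', hf1]
    rw [← deriv_comp_add_const]
    simp only [hp1]
  set P : ℝ → ℝ := fun θ => p (f θ) with hP
  have hPc : ContDiff ℝ (n + 1 : ℕ) P := hpn.comp hfn
  have hPp : ∀ θ, P (θ + 1) = P θ := fun θ => by simp only [hP, hf1, hp1]
  -- The rate at which a displacement transverse to the graph grows under the linearized flow.
  set A : ℝ → ℝ := fun θ => (G' (f θ, P θ)).2 - p' θ * (G' (f θ, P θ)).1 with hA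
  have hAc : ContDiff ℝ (n + 1 : ℕ) A := by fun_prop
  have hshift : ∀ θ z, ((f (θ + 1), z) : ℝ × ℝ) = (f θ, z) + (1, 0) := fun θ z => by
    simp [hf1]
  have hAp : Function.Periodic A 1 := fun θ => by
    simp only [hA, hPp, hp'p, hshift, hG'p]
  set f' : ℝ → ℝ := fun θ => (G (f θ, P θ)).1 / ω with hf'
  have hf'0 : ∀ θ, f' θ ≠ 0 := fun θ => (div_pos (hpos _) hω).ne'
  have hf'c : ContDiff ℝ (n + 1 : ℕ) f' := by fun_prop
  -- The Floquet factor absorbs the oscillation of `A` about its mean `lam`. It is periodic because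
  -- `A - lam` has mean zero, which is the choice of `lam` in `hlam`.
  set c : ℝ → ℝ := fun θ => Real.exp (ω⁻¹ * ∫ τ in (0 : ℝ)..θ, (A τ - lam)) with hc
  have hcd : ∀ θ, HasDerivAt c (c θ * (ω⁻¹ * (A θ - lam))) θ := fun θ => by
    have hcont : Continuous fun τ => A τ - lam := by have := hAc.continuous; fun_prop
    exact ((hcont.integral_hasStrictDerivAt 0 θ).hasDerivAt.const_mul ω⁻¹).exp
  have hcc : ContDiff ℝ (n + 1 : ℕ) c :=
    (contDiff_of_hasDerivAt (F := fun w => w.2 * (ω⁻¹ * (A w.1 - lam))) (m := n + 1)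
      (by fun_prop) hcd).of_le (by norm_cast; omega)
  have hcp : ∀ θ, c (θ + 1) = c θ := fun θ => by
    have hcont : Continuous fun τ => A τ - lam := by have := hAc.continuous; fun_prop
    have h1 : Function.Periodic (fun τ => A τ - lam) 1 := fun y => by simp only [hAp y]
    have h2 := h1.intervalIntegral_add_eq θ 0
    have h3 : ∫ τ in (0 : ℝ)..(0 + 1), (A τ - lam) = 0 := by
      rw [zero_add, intervalIntegral.integral_sub (hAc.continuous.intervalIntegrable _ _) (by simp)]
      simp only [intervalIntegral.integral_const, sub_zero, one_smul]
      rw [hlam]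
      exact sub_self _
    simp only [hc]
    rw [← intervalIntegral.integral_add_adjacent_intervals (hcont.intervalIntegrable 0 θ)
      (hcont.intervalIntegrable θ (θ + 1)), h2, h3, add_zero]
  have hc0 : ∀ θ, c θ ≠ 0 := fun θ => (Real.exp_pos _).ne'
  -- first and second order Taylor remainders
  set D₁ : ℝ × ℝ → ℝ × ℝ := fun x =>
    ∫ τ in (0 : ℝ)..1, G' (f x.1, P x.1 + τ * (c x.1 * x.2)) with hD₁
  set D₂ : ℝ × ℝ → ℝ × ℝ := fun x => ∫ τ in (0 : ℝ)..1, τ • ∫ σ in (0 : ℝ)..1,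
    G'' (f x.1, P x.1 + σ * (τ * (c x.1 * x.2))) with hD₂
  have hfn' : ContDiff ℝ n f := hfn.of_le (by norm_cast; omega)
  have hPn' : ContDiff ℝ n P := hPc.of_le (by norm_cast; omega)
  have hcn' : ContDiff ℝ n c := hcc.of_le (by norm_cast; omega)
  have hAn' : ContDiff ℝ n A := hAc.of_le (by norm_cast; omega)
  have hp'n' : ContDiff ℝ n p' := hp'c.of_le (by norm_cast; omega)
  have hf'n' : ContDiff ℝ n f' := hf'c.of_le (by norm_cast; omega)
  have hG'n' : ContDiff ℝ n G' := hG'c.of_le (by norm_cast; omega)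
  have hD₁c : ContDiff ℝ n D₁ := contDiff_intervalIntegral
    (Φ := fun τ (x : ℝ × ℝ) => G' (f x.1, P x.1 + τ * (c x.1 * x.2)))
    (hG'n'.comp (f := fun q : ℝ × ℝ × ℝ => (f q.2.1, P q.2.1 + q.1 * (c q.2.1 * q.2.2)))
      (by fun_prop))
  have hD₂c : ContDiff ℝ n D₂ := by
    refine contDiff_intervalIntegral (Φ := fun τ (x : ℝ × ℝ) => τ • ∫ σ in (0 : ℝ)..1,
      G'' (f x.1, P x.1 + σ * (τ * (c x.1 * x.2)))) ?_
    refine contDiff_fst.smul (contDiff_intervalIntegral (Φ := fun σ (q : ℝ × ℝ × ℝ) =>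
      G'' (f q.2.1, P q.2.1 + σ * (q.1 * (c q.2.1 * q.2.2)))) ?_)
    exact hG''c.comp (f := fun q : ℝ × ℝ × ℝ × ℝ =>
      (f q.2.2.1, P q.2.2.1 + q.1 * (q.2.1 * (c q.2.2.1 * q.2.2.2)))) (by fun_prop)
  have hD₁p : ∀ x, D₁ (x + (1, 0)) = D₁ x := fun x => by
    have h1 : ∀ a z, G' (a + 1, z) = G' (a, z) := fun a z => by simpa using hG'p (a, z)
    simp [hD₁, hPp, hcp, hf1, h1]
  have hD₂p : ∀ x, D₂ (x + (1, 0)) = D₂ x := fun x => by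
    have h1 : ∀ a z, G'' (a + 1, z) = G'' (a, z) := fun a z => by simpa using hG''p (a, z)
    simp [hD₂, hPp, hcp, hf1, h1]
  have hT1 : ∀ x : ℝ × ℝ, G (f x.1, P x.1 + c x.1 * x.2) =
      G (f x.1, P x.1) + (c x.1 * x.2) • D₁ x := fun x =>
    taylor_one (hG.of_le (by norm_cast; omega)) _ _ _
  have hT2 : ∀ x : ℝ × ℝ, D₁ x = G' (f x.1, P x.1) + (c x.1 * x.2) • D₂ x := fun x =>
     taylor_two (hG'c.of_le (by norm_cast; omega)) _ _ _
  -- With `c` chosen so, the transverse component has no linear term besides `lam y`. What remains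
  -- is exactly `y α` in the angle and `y² β` across; `α` and `β` are found by comparing components
  -- of `DΩ` applied to the new field with `G ∘ Ω`.
  set α : ℝ × ℝ → ℝ := fun x => c x.1 * (D₁ x).1 / f' x.1 with hα
  set β : ℝ × ℝ → ℝ := fun x => c x.1 * ((D₂ x).2 - p' x.1 * (D₂ x).1) -
    (ω⁻¹ * (A x.1 - lam)) * α x with hβ
  have hαc : ContDiff ℝ n α := ContDiff.div (by fun_prop) (by fun_prop) fun x => hf'0 _
  have hβc : ContDiff ℝ n β := by fun_prop
  have hf'p : ∀ θ, f' (θ + 1) = f' θ := fun θ => by simp only [hf', hPp, hshift, hGp]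
  have hαp : ∀ x, α (x + (1, 0)) = α x := fun x => by
    simp only [hα, hD₁p, Prod.fst_add, hcp, hf'p]
  have hPd : ∀ θ, HasDerivAt P (p' θ * f' θ) θ := fun θ => by
    have h1 := hpd (f θ)
    rw [← h1.deriv] at h1
    exact h1.comp θ (hfd θ)
  have hΩd := fun x : ℝ × ℝ => hasFDerivAt_tubularCoord (hfd x.1) (hPd x.1) (hcd x.1)
  have hΩf : ∀ x v : ℝ × ℝ, fderiv ℝ (tubularCoord f P c) x v =
      (f' x.1 * v.1, (p' x.1 * f' x.1 + c x.1 * (ω⁻¹ * (A x.1 - lam)) * x.2) * v.1 + c x.1 * v.2) :=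
    fun x v => by
      obtain ⟨L, hL, hv⟩ := hΩd x
      rw [hL.fderiv, hv]
  refine ⟨tubularCoord f P c, α, β, ?_, hαc, hβc, ?_, hαp, ?_, ?_, ?_, ?_, ?_⟩
  · unfold tubularCoord
    fun_prop
  · intro x
    simp [tubularCoord, hf1, hPp, hcp]
  · intro x
    simp only [hβ, hαp, hD₂p, Prod.fst_add, hcp, hp'p]
    rw [hAp]
  · intro θ
    simp [tubularCoord, hP]
  · intro x
    obtain ⟨L, hL, -⟩ := hΩd x
    exact hL.differentiableAt
  · intro x
    rw [hΩf]
    have e0 : f' x.1 * ω = (G (f x.1, P x.1)).1 := by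
      simp only [hf']; field_simp
    have e1 : f' x.1 * α x = c x.1 * (D₁ x).1 := by
      simp only [hα]
      have := hf'0 x.1
      field_simp
    have e2 : p' x.1 * (G (f x.1, P x.1)).1 = (G (f x.1, P x.1)).2 := by
      have := (hpos (f x.1)).ne'
      simp only [hp', (hpd (f x.1)).deriv, hP]
      field_simp
    have e3 : A x.1 = (G' (f x.1, P x.1)).2 - p' x.1 * (G' (f x.1, P x.1)).1 := rfl
    have e4 : β x = c x.1 * ((D₂ x).2 - p' x.1 * (D₂ x).1) - (ω⁻¹ * (A x.1 - lam)) * α x := rfl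
    have e5 := congrArg Prod.fst (hT2 x)
    have e6 := congrArg Prod.snd (hT2 x)
    simp only [Prod.fst_add, Prod.snd_add, Prod.smul_fst, Prod.smul_snd, smul_eq_mul] at e5 e6
    have e7 : ω⁻¹ * ω = 1 := inv_mul_cancel₀ hω.ne'
    unfold tubularCoord
    rw [hT1]
    ext
    · simp only [Prod.fst_add, Prod.smul_fst, smul_eq_mul]
      linear_combination e0 + x.2 * e1
    · simp only [Prod.snd_add, Prod.smul_snd, smul_eq_mul]
      rw [e4]
      linear_combination p' x.1 * e0 + p' x.1 * x.2 * e1 + e2 +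
        c x.1 * x.2 * (A x.1 - lam) * e7 + c x.1 * x.2 * e3 - c x.1 * x.2 * e6
        + c x.1 * x.2 * p' x.1 * e5
  · intro θ
    refine ContinuousLinearMap.isInvertible_of_injective ?_
    rw [injective_iff_map_eq_zero]
    intro v hv
    rw [hΩf] at hv
    have h1 := congrArg Prod.fst hv
    have h2 := congrArg Prod.snd hv
    simp only [Prod.fst_zero, Prod.snd_zero] at h1 h2
    have h3 : v.1 = 0 := (mul_eq_zero.1 h1).resolve_left (hf'0 θ)
    rw [h3] at h2
    simp only [mul_zero, zero_add] at h2
    exact Prod.ext h3 ((mul_eq_zero.1 h2).resolve_left (hc0 θ))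

end Floquet

/-! ### Perron's method for semilinear equations along the linear flow -/

section Semilinear

/-- The flow of `(ω, lam s)`. -/
noncomputable def linearFlow (ω lam τ : ℝ) (x : ℝ × ℝ) : ℝ × ℝ :=
  (x.1 + ω * τ, x.2 * Real.exp (lam * τ))

/-- Perron's integral along the linear flow. -/
noncomputable def perronIntegral (ω lam : ℝ) (M : (ℝ × ℝ) × (ℝ × ℝ) → ℝ × ℝ)
    (H : ℝ × ℝ → ℝ × ℝ) (x : ℝ × ℝ) : ℝ × ℝ :=
  ∫ τ in Ioi (0 : ℝ), Real.exp (lam * τ) • M (linearFlow ω lam τ x, H (linearFlow ω lam τ x))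

/-- Functions bounded by `1` in `C^n` and periodic in the first variable. -/
def IsUnitAnglePeriodic (n : ℕ) (H : ℝ × ℝ → ℝ × ℝ) : Prop :=
  ContDiff ℝ n H ∧ (∀ j ≤ n, ∀ x, ‖iteratedFDeriv ℝ j H x‖ ≤ 1) ∧ ∀ x, H (x + (1, 0)) = H x

theorem uBdd_isUnitAnglePeriodic (n : ℕ) :
    UBdd 0 n (fun H : {H : ℝ × ℝ → ℝ × ℝ // IsUnitAnglePeriodic n H} => H.1) :=
  ⟨fun H => H.2.1, 1, fun H j _ hj x => H.2.2.1 j hj x⟩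

variable {ι : Type*} {ω lam : ℝ} {n : ℕ} {M : ι → (ℝ × ℝ) × (ℝ × ℝ) → ℝ × ℝ}

theorem linearFlow_add (τ : ℝ) (x : ℝ × ℝ) :
    linearFlow ω lam τ (x + (1, 0)) = linearFlow ω lam τ x + (1, 0) := by
  ext
  · simp [linearFlow]; ring
  · simp [linearFlow]

theorem linearFlow_linearFlow (t τ : ℝ) (x : ℝ × ℝ) :
    linearFlow ω lam τ (linearFlow ω lam t x) = linearFlow ω lam (t + τ) x := by
  ext
  · simp [linearFlow]; ring
  · simp [linearFlow, mul_add, Real.exp_add, mul_assoc]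

/-- For `τ ≥ 0` and `lam < 0` the derivative has norm at most one, uniformly in `τ`. The translation
of the angle is unbounded, hence bounds from order `1`. -/
theorem uBdd_linearFlow (hlam : lam < 0) :
    UBdd 1 n (fun τ : Ici (0 : ℝ) => linearFlow ω lam τ) := by
  have h := UBdd.affine (n := n) (C := 1)
    (fun τ : Ici (0 : ℝ) => (ContinuousLinearMap.fst ℝ ℝ ℝ).prod
      (Real.exp (lam * τ) • ContinuousLinearMap.snd ℝ ℝ ℝ)) (fun τ => (ω * (τ : ℝ), 0)) ?_
  · refine cast ?_ h
    congr 1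
    ext1 τ
    ext1 x
    simp [linearFlow, mul_comm]
  · intro τ
    refine ContinuousLinearMap.opNorm_le_bound _ zero_le_one fun x => ?_
    rw [one_mul, ContinuousLinearMap.prod_apply, Prod.norm_mk]
    refine max_le (norm_fst_le x) ?_
    simp only [_root_.smul_apply, ContinuousLinearMap.coe_snd', norm_smul,
      Real.norm_eq_abs, Real.abs_exp]
    have : Real.exp (lam * τ) ≤ 1 := Real.exp_le_one_iff.2 (by nlinarith [τ.2.out])
    exact (mul_le_of_le_one_left (abs_nonneg _) this).trans (norm_snd_le x)

theorem integrable_perron (hlam : lam < 0) {N : (ℝ × ℝ) × (ℝ × ℝ) → ℝ × ℝ} (hN : Continuous N)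
    {C : ℝ} (hC : ∀ q, ‖N q‖ ≤ C) {H : ℝ × ℝ → ℝ × ℝ} (hH : Continuous H) (x : ℝ × ℝ) (a : ℝ) :
    IntegrableOn (fun τ => Real.exp (lam * τ) • N (linearFlow ω lam τ x, H (linearFlow ω lam τ x)))
      (Ioi a) := by
  refine Integrable.mono' ((integrableOn_exp_mul_Ioi hlam a).mul_const C) ?_ ?_
  · refine Continuous.aestronglyMeasurable ?_
    unfold linearFlow
    fun_prop
  · refine Eventually.of_forall fun τ => ?_
    rw [norm_smul, Real.norm_eq_abs, Real.abs_exp]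
    gcongr
    exact hC _

/-- Forward along the flow the integrand is uniformly bounded in `C^n` up to the factor `exp (lam
τ)`, which is integrable; no derivative is lost. -/
theorem uBdd_perronIntegral (hlam : lam < 0) (hM : UBdd 0 n M) {κ : Type*}
    {H : κ → ℝ × ℝ → ℝ × ℝ} (hH : UBdd 0 n H) (e : κ → ι) :
    UBdd 0 n (fun i => perronIntegral ω lam (M (e i)) (H i)) := by
  have hA : UBdd 1 n (fun i : κ × Ici (0 : ℝ) => linearFlow ω lam i.2) :=
    (uBdd_linearFlow hlam).reindex Prod.snd
  have h1 := (hM.reindex (fun i : κ × Ici (0 : ℝ) => e i.1)).comp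
    (hA.prodMk (((hH.reindex Prod.fst).comp hA).mono zero_le_one le_rfl))
  obtain ⟨B, hB0, hB⟩ := h1.nonneg_bound
  refine UBdd.integral (μ := volume.restrict (Ioi (0 : ℝ))) (b := fun τ => Real.exp (lam * τ) * B)
    ((integrableOn_exp_mul_Ioi hlam 0).mul_const B) (fun i => ?_) ?_
  · have hMi := hM.1 (e i)
    have hHi := hH.1 i
    have hL : ContDiff ℝ n (fun q : ℝ × ℝ × ℝ => linearFlow ω lam q.1 q.2) := by
      unfold linearFlow
      fun_prop
    exact ContDiff.smul (f := fun q : ℝ × ℝ × ℝ => Real.exp (lam * q.1))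
      (g := fun q : ℝ × ℝ × ℝ =>
        M (e i) (linearFlow ω lam q.1 q.2, H i (linearFlow ω lam q.1 q.2)))
      (by fun_prop) (by fun_prop)
  · filter_upwards [ae_restrict_mem measurableSet_Ioi] with τ hτ i j hj x
    have hcd := h1.1 (i, ⟨τ, hτ.out.le⟩)
    have e1 : (fun x => Real.exp (lam * τ) • M (e i)
        (linearFlow ω lam τ x, H i (linearFlow ω lam τ x))) =
        Real.exp (lam * τ) • fun x => M (e i)
          (linearFlow ω lam τ x, H i (linearFlow ω lam τ x)) := rfl
    rw [e1, iteratedFDeriv_const_smul_apply (hcd.contDiffAt.of_le (by exact_mod_cast hj)),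
      norm_smul, Real.norm_eq_abs, Real.abs_exp]
    gcongr
    exact hB (i, ⟨τ, hτ.out.le⟩) j (Nat.zero_le _) hj x

/-- Solvability, for small `δ`, of Perron's integral equation. -/
theorem exists_perron_fixedPoint (hlam : lam < 0) (hM : UBdd 0 (n + 1) M)
    (hM1 : ∀ i x v, M i (x + (1, 0), v) = M i (x, v)) {c : ℝ → ℝ}
    (hc : UBdd 0 (n + 1) (fun _ : Unit => c)) :
    ∃ δ₀ : ℝ, 0 < δ₀ ∧ ∀ δ, 0 ≤ δ → δ ≤ δ₀ → ∀ i, ∃ H : ℝ × ℝ → ℝ × ℝ, ContDiff ℝ n H ∧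
      (∀ x, ‖H x‖ ≤ 1) ∧ (∀ x, H (x + (1, 0)) = H x) ∧
      ∀ x, H x = -((δ * c x.2) • perronIntegral ω lam (M i) H x) := by
  let J := {H : ℝ × ℝ → ℝ × ℝ // IsUnitAnglePeriodic (n + 1) H}
  have hI : UBdd 0 (n + 1) (fun (p : J × ι) (x : ℝ × ℝ) =>
      c x.2 • perronIntegral ω lam (M p.2) p.1.1 x) := by
    refine UBdd.smul ?_ (uBdd_perronIntegral hlam hM
      ((uBdd_isUnitAnglePeriodic (n + 1)).reindex Prod.fst) Prod.snd)
    exact (hc.reindex fun _ => ()).comp (UBdd.clm (ContinuousLinearMap.snd ℝ ℝ ℝ))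
  obtain ⟨C₁, hC₁0, hC₁⟩ := hI.nonneg_bound
  obtain ⟨L, hL0, hL⟩ := hM.lipschitz zero_le_one (by omega)
  obtain ⟨B, hB0, hB⟩ := hM.norm_le
  obtain ⟨C₂, hC₂0, hC₂⟩ := hc.norm_le
  set I : ℝ := ∫ τ in Ioi (0 : ℝ), Real.exp (lam * τ) with hIdef
  have hI0 : 0 ≤ I := integral_nonneg fun τ => (Real.exp_pos _).le
  refine ⟨min (1 / (C₁ + 1)) (1 / (2 * (C₂ * (L * I) + 1))), lt_min (by positivity)
    (by positivity), fun δ hδ hδle i => ?_⟩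
  have hδ1 : δ * (C₁ + 1) ≤ 1 := (le_div_iff₀ (by positivity)).1 (hδle.trans (min_le_left _ _))
  have hδ2 : δ * (2 * (C₂ * (L * I) + 1)) ≤ 1 :=
    (le_div_iff₀ (by positivity)).1 (hδle.trans (min_le_right _ _))
  have hMc : Continuous (M i) := (hM.1 i).continuous
  obtain ⟨H, hHn, hfix, v, hv, hvlim⟩ := exists_contDiff_fixedPoint (N := n)
    (fun H x => -δ • c x.2 • perronIntegral ω lam (M i) H x) (IsUnitAnglePeriodic (n + 1)) 0
    ⟨contDiff_const, fun j _ x => by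
      rw [show (0 : ℝ × ℝ → ℝ × ℝ) = fun _ => 0 from rfl]; simp, fun _ => rfl⟩
    (fun H hH => ⟨(hI.1 (⟨H, hH⟩, i)).const_smul (-δ), fun j hj x => by
        have hcd := hI.1 (⟨H, hH⟩, i)
        have e1 : (fun x : ℝ × ℝ => -δ • c x.2 • perronIntegral ω lam (M i) H x) =
          -δ • fun x : ℝ × ℝ => c x.2 • perronIntegral ω lam (M i) H x := rfl
        rw [e1, iteratedFDeriv_const_smul_apply (hcd.contDiffAt.of_le (by exact_mod_cast hj)),
          norm_smul, norm_neg, Real.norm_eq_abs, abs_of_nonneg hδ]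
        have := hC₁ (⟨H, hH⟩, i) j (Nat.zero_le _) hj x
        calc _ ≤ δ * C₁ := by gcongr
          _ ≤ 1 := by nlinarith,
      fun x => by simp [perronIntegral, linearFlow_add, hM1, hH.2.2]⟩)
    (uBdd_isUnitAnglePeriodic (n + 1)) (κ := 1 / 2) (by norm_num) (by norm_num)
    (fun H H' d hH hH' hd x => by
      have hd0 : 0 ≤ d := (norm_nonneg _).trans (hd x)
      rw [← smul_sub, ← smul_sub, norm_smul, norm_smul, norm_neg, Real.norm_eq_abs,
        abs_of_nonneg hδ]
      have h1 : ‖perronIntegral ω lam (M i) H x - perronIntegral ω lam (M i) H' x‖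
          ≤ I * (L * d) := by
        unfold perronIntegral
        rw [← integral_sub (integrable_perron hlam hMc (hB i) hH.1.continuous x 0)
          (integrable_perron hlam hMc (hB i) hH' x 0), hIdef, ← integral_mul_const]
        refine norm_integral_le_of_norm_le
          ((integrableOn_exp_mul_Ioi hlam 0).mul_const (L * d)) (Eventually.of_forall fun τ => ?_)
        rw [← smul_sub, norm_smul, Real.norm_eq_abs, Real.abs_exp]
        gcongr
        refine (hL _ _ _).trans ?_
        gcongr
        simpa [Prod.norm_def] using hd _
      calc δ * (‖c x.2‖ * ‖perronIntegral ω lam (M i) H x - perronIntegral ω lam (M i) H' x‖)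
          ≤ δ * (C₂ * (I * (L * d))) := by
            gcongr
            exact hC₂ () _
        _ = δ * (C₂ * (L * I)) * d := by ring
        _ ≤ 1 / 2 * d := by
            gcongr
            nlinarith)
  refine ⟨H, hHn, fun x => ?_, fun x => ?_, fun x => ?_⟩
  · refine le_of_tendsto (hvlim x).norm (Eventually.of_forall fun k => ?_)
    simpa using (hv k).2.1 0 (Nat.zero_le _) x
  · exact tendsto_nhds_unique (hvlim _) ((hvlim x).congr fun k => ((hv k).2.2 x).symm)
  · conv_lhs => rw [← hfix]
    simp [mul_smul]

/-- By the group property of the linear flow, the weighted Perron integral at the transported point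
is the tail over `(t, ∞)` of one fixed integrand, so its derivative is minus that integrand. -/
theorem hasDerivAt_perronIntegral (hlam : lam < 0) {N : (ℝ × ℝ) × (ℝ × ℝ) → ℝ × ℝ}
    (hN : Continuous N) {C : ℝ} (hC : ∀ q, ‖N q‖ ≤ C) {H : ℝ × ℝ → ℝ × ℝ} (hH : Continuous H)
    (x : ℝ × ℝ) :
    HasDerivAt (fun t => Real.exp (lam * t) • perronIntegral ω lam N H (linearFlow ω lam t x))
      (-N (x, H x)) 0 := by
  set k : ℝ → ℝ × ℝ := fun τ =>
    Real.exp (lam * τ) • N (linearFlow ω lam τ x, H (linearFlow ω lam τ x)) with hk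
  have hkc : Continuous k := by
    simp only [hk]
    unfold linearFlow
    fun_prop
  have hki : ∀ a, IntegrableOn k (Ioi a) := integrable_perron hlam hN hC hH x
  have e : (fun t => Real.exp (lam * t) • perronIntegral ω lam N H (linearFlow ω lam t x)) =
      fun t => (∫ τ in Ioi (0 : ℝ), k τ) - ∫ τ in (0 : ℝ)..t, k τ := by
    ext1 t
    rw [← intervalIntegral.integral_Ioi_sub_Ioi' (hki 0) (hki t), sub_sub_cancel,
      ← (measurePreserving_add_left volume t).setIntegral_preimage_emb
        (measurableEmbedding_addLeft t)]
    unfold perronIntegral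
    rw [← integral_smul]
    simp only [preimage_const_add_Ioi, sub_self, hk, linearFlow_linearFlow, smul_smul,
      ← Real.exp_add, ← mul_add]
  rw [e]
  have h1 := (hkc.integral_hasStrictDerivAt 0 0).hasDerivAt.const_sub (∫ τ in Ioi (0 : ℝ), k τ)
  simpa [hk, linearFlow] using h1

/-- A semilinear equation along the linear flow whose right-hand side vanishes at `s = 0` has a
solution that vanishes at `s = 0`. -/
theorem exists_semilinear_solution (ω : ℝ) (hlam : lam < 0) {F : (ℝ × ℝ) × (ℝ × ℝ) → ℝ × ℝ}
    (hF : ContDiff ℝ (n + 1 : ℕ) F) (hF1 : ∀ x v, F (x + (1, 0), v) = F (x, v)) :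
    ∃ (δ : ℝ) (H : ℝ × ℝ → ℝ × ℝ), 0 < δ ∧ ContDiff ℝ n H ∧ (∀ x, H (x + (1, 0)) = H x) ∧
      (∀ θ, H (θ, 0) = 0) ∧ ∀ x : ℝ × ℝ, |x.2| < δ →
        HasDerivAt (fun t => H (linearFlow ω lam t x)) (x.2 • F (x, H x)) 0 := by
  obtain ⟨b, hb, hb1, hb0, -, -⟩ := exists_smooth_cutoff 1 one_pos
  have hbn := hb (n + 1)
  -- The right-hand side after rescaling `s = δ y`. The prefactor `s` of the equation then supplies
  -- the small factor `δ` of the contraction. The cut-offs give bounds uniform in `δ ∈ [0,1]`, and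
  -- are inactive for `|y| ≤ 1` and `‖H‖ ≤ 1`.
  let f : ((ℝ × ℝ) × (ℝ × ℝ)) × ℝ → ℝ × ℝ := fun q =>
    (b q.1.1.2 * b q.1.2.1 * b q.1.2.2 * b q.2) • F ((q.1.1.1, q.2 * q.1.1.2), q.1.2)
  have hf : ContDiff ℝ (n + 1 : ℕ) f := by
    simp only [f]
    fun_prop
  have hF1' : ∀ θ s v, F ((θ + 1, s), v) = F ((θ, s), v) := fun θ s v => by
    simpa using hF1 (θ, s) v
  have hfp : Function.Periodic f (((1, 0), 0), 0) := fun q => by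
    simp [f, hF1']
  have hfU : UBdd 0 (n + 1) (fun _ : Icc (0 : ℝ) 1 => f) := by
    refine UBdd.of_periodic hf (isCompact_closedBall (0 : ((ℝ × ℝ) × (ℝ × ℝ)) × ℝ) 2) ?_
    rintro ⟨⟨⟨a1, a2⟩, ⟨b1, b2⟩⟩, ε⟩
    by_cases hq : |a2| ≤ 2 ∧ |b1| ≤ 2 ∧ |b2| ≤ 2 ∧ |ε| ≤ 2
    · left
      refine ⟨(-⌊a1⌋) • (((1, 0), 0), 0), hfp.zsmul _, ?_⟩
      have h1 := Int.fract_nonneg a1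
      have h2 := (Int.fract_lt_one a1).le
      rw [← Int.self_sub_floor] at h1 h2
      simp only [mem_closedBall_zero_iff, Prod.norm_def, Real.norm_eq_abs, sup_le_iff]
      simp
      refine ⟨⟨⟨?_, hq.1⟩, hq.2.1, hq.2.2.1⟩, hq.2.2.2⟩
      rw [abs_le]; constructor <;> linarith
    · right
      have hop : IsOpen {q : ((ℝ × ℝ) × (ℝ × ℝ)) × ℝ |
          ¬ (|q.1.1.2| ≤ 2 ∧ |q.1.2.1| ≤ 2 ∧ |q.1.2.2| ≤ 2 ∧ |q.2| ≤ 2)} := by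
        rw [← compl_ofPred, isOpen_compl_iff]
        simp only [ofPred_and]
        refine IsClosed.inter ?_ (IsClosed.inter ?_ (IsClosed.inter ?_ ?_)) <;>
        exact isClosed_le (by fun_prop) continuous_const
      filter_upwards [hop.mem_nhds hq] with q hq
      simp only [not_and_or, not_le] at hq
      have h0 : ∀ t, 2 < |t| → b t = 0 := fun t ht => hb0 t (by linarith)
      rcases hq with h | h | h | h <;> simp [f, h0 _ h]
  have hM : UBdd 0 (n + 1) (fun (δ : Icc (0 : ℝ) 1) (q : (ℝ × ℝ) × (ℝ × ℝ)) => f (q, δ)) := by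
    refine hfU.comp ?_
    simpa using UBdd.affine (n := n + 1)
      (fun _ : Icc (0 : ℝ) 1 => ContinuousLinearMap.inl ℝ ((ℝ × ℝ) × (ℝ × ℝ)) ℝ)
      (fun ε => (0, (ε : ℝ))) (fun _ => le_rfl)
  have hc : UBdd 0 (n + 1) (fun (_ : Unit) (t : ℝ) => t * b t) := by
    refine UBdd.of_hasCompactSupport (by fun_prop) (HasCompactSupport.intro
      (isCompact_closedBall (0 : ℝ) 2) fun t ht => ?_)
    simp only [mem_closedBall_zero_iff, Real.norm_eq_abs, not_le] at ht
    simp [hb0 t (by linarith)]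
  obtain ⟨δ₀, hδ₀, hδ⟩ := exists_perron_fixedPoint (ω := ω) hlam hM (fun i x v => by
    simp [f, hF1']) hc
  set δ := min δ₀ 1 with hδdef
  have hδ0 : 0 < δ := lt_min hδ₀ one_pos
  have hδI : δ ∈ Icc (0 : ℝ) 1 := ⟨hδ0.le, min_le_right _ _⟩
  obtain ⟨H, hHn, hH1, hHp, hHfix⟩ := hδ δ hδ0.le (min_le_left _ _) ⟨δ, hδI⟩
  obtain ⟨C, -, hC⟩ := hM.norm_le
  refine ⟨δ, fun x => H (x.1, x.2 / δ), hδ0, ?_, fun x => ?_, fun θ => ?_, fun x hx => ?_⟩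
  · exact hHn.comp (f := fun x : ℝ × ℝ => (x.1, x.2 / δ)) (by fun_prop)
  · simpa using hHp (x.1, x.2 / δ)
  · change H (θ, 0 / δ) = 0
    rw [hHfix]
    simp
  · set y : ℝ × ℝ := (x.1, x.2 / δ) with hy
    have hy2 : |y.2| < 1 := by
      rw [hy, abs_div, abs_of_pos hδ0, div_lt_one hδ0]
      exact hx
    have e1 : ∀ t, ((linearFlow ω lam t x).1, (linearFlow ω lam t x).2 / δ) =
        linearFlow ω lam t y := fun t => by
      simp [linearFlow, hy]; ring
    simp only [e1]
    -- Near `t = 0` the cut-off in `y` is one, and the prefactor `y₂` at the transported point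
    -- contributes the weight `exp (lam t)` of the Perron integral.
    have hev : (fun t => H (linearFlow ω lam t y)) =ᶠ[𝓝 0] fun t => -(δ * y.2) •
        (Real.exp (lam * t) • perronIntegral ω lam (fun q => f (q, δ)) H (linearFlow ω lam t y)) := by
      have : ∀ᶠ t in 𝓝 (0 : ℝ), |y.2 * Real.exp (lam * t)| < 1 :=
        ContinuousAt.eventually_lt (by fun_prop) continuousAt_const (by simpa using hy2)
      filter_upwards [this] with t ht
      conv_lhs => rw [hHfix]
      simp only [linearFlow] at ht ⊢
      rw [hb1 _ ht.le, smul_smul, ← neg_smul]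
      congr 1
      ring
    have hd := (hasDerivAt_perronIntegral (ω := ω) hlam (hM.1 ⟨δ, hδI⟩).continuous (hC ⟨δ, hδI⟩)
      hHn.continuous y).const_smul (-(δ * y.2))
    refine (hd.congr_of_eventuallyEq hev).congr_deriv ?_
    have hbH : ∀ t : ℝ, |t| ≤ ‖H y‖ → b t = 1 := fun t ht => hb1 t (ht.trans (hH1 y))
    simp only [f, hb1 _ hy2.le, hbH _ (norm_fst_le (H y)), hbH _ (norm_snd_le (H y)),
      hb1 δ (by rw [abs_of_pos hδ0]; exact hδI.2), mul_one, one_smul, smul_neg, neg_smul, neg_neg]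
    have e2 : δ * y.2 = x.2 := by
      simp only [hy]
      field_simp
    rw [e2]

end Semilinear

/-! ### Linearization of the planar field -/

section Planar

variable {ω lam : ℝ} {H : ℝ × ℝ → ℝ × ℝ}

theorem hasDerivAt_comp_linearFlow {W : ℝ × ℝ → ℝ × ℝ} {x : ℝ × ℝ} (hW : DifferentiableAt ℝ W x) :
    HasDerivAt (fun t => W (linearFlow ω lam t x)) (fderiv ℝ W x (ω, lam * x.2)) 0 := by
  have h := hasDerivAt_characteristic ω lam x.1 x.2 0
  have h0 : x = (x.1 + ω * 0, x.2 * Real.exp (lam * 0)) := by simp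
  have hW' : HasFDerivAt W (fderiv ℝ W x) (x.1 + ω * 0, x.2 * Real.exp (lam * 0)) := by
    rw [← h0]
    exact hW.hasFDerivAt
  refine (hW'.comp_hasDerivAt (0 : ℝ) h).congr_deriv ?_
  simp

/-- The change of coordinates `(θ, s) ↦ (θ + H₁, s exp H₂)`. -/
noncomputable def shearMap (H : ℝ × ℝ → ℝ × ℝ) (x : ℝ × ℝ) : ℝ × ℝ :=
  (x.1 + (H x).1, x.2 * Real.exp (H x).2)

theorem shearMap_add (hH : ∀ x, H (x + (1, 0)) = H x) (x : ℝ × ℝ) :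
    shearMap H (x + (1, 0)) = shearMap H x + (1, 0) := by
  simp only [shearMap, hH]
  ext
  · simp; ring
  · simp

/-- Since `H` vanishes on `s = 0`, so does its angular derivative there, and the derivative of the
shear is triangular with unit diagonal. -/
theorem isInvertible_fderiv_shearMap (hH : Differentiable ℝ H) (hH0 : ∀ θ, H (θ, 0) = 0) (θ : ℝ) :
    (fderiv ℝ (shearMap H) (θ, 0)).IsInvertible := by
  have h1 : HasFDerivAt H (fderiv ℝ H (θ, 0)) (θ, 0) := (hH _).hasFDerivAt
  have h2 : fderiv ℝ H (θ, 0) (1, 0) = 0 := by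
    have e : HasDerivAt (fun t : ℝ => (t, (0 : ℝ))) (1, 0) θ :=
      (hasDerivAt_id θ).prodMk (hasDerivAt_const θ 0)
    have := h1.comp_hasDerivAt θ e
    have h0 : (H ∘ fun t : ℝ => (t, (0 : ℝ))) = fun _ => 0 := funext hH0
    rw [h0] at this
    exact this.unique (hasDerivAt_const _ _)
  have h3 := (hasFDerivAt_fst (𝕜 := ℝ) (p := (θ, (0 : ℝ)))).add h1.fst
  have h4 := (hasFDerivAt_snd (𝕜 := ℝ) (p := (θ, (0 : ℝ)))).mul h1.snd.exp
  have h5 : HasFDerivAt (shearMap H) _ (θ, 0) := h3.prodMk h4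
  rw [h5.fderiv]
  refine ContinuousLinearMap.isInvertible_of_injective ((injective_iff_map_eq_zero _).2 fun v hv => ?_)
  have hv1 := congrArg Prod.fst hv
  have hv2 := congrArg Prod.snd hv
  simp [hH0] at hv1 hv2
  have hv' : v = v.1 • (1, 0) := by ext <;> simp [hv2]
  have h6 : fderiv ℝ H (θ, 0) v = 0 := by rw [hv', map_smul, h2, smul_zero]
  rw [h6] at hv1
  simp at hv1
  exact Prod.ext hv1 hv2

/-- A planar field given near its limit cycle by Floquet coordinates is linearizable with loss of
finitely many derivatives. -/
theorem exists_linearization {n : ℕ} (hlam : lam < 0) {G Ω : ℝ × ℝ → ℝ × ℝ} {α β : ℝ × ℝ → ℝ}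
    (hΩ : ContDiff ℝ (n + 2 : ℕ) Ω) (hα : ContDiff ℝ (n + 2 : ℕ) α)
    (hβ : ContDiff ℝ (n + 2 : ℕ) β) (hΩ1 : ∀ x, Ω (x + (1, 0)) = Ω x + (1, 0))
    (hα1 : ∀ x, α (x + (1, 0)) = α x) (hβ1 : ∀ x, β (x + (1, 0)) = β x)
    (hG : ∀ x : ℝ × ℝ, fderiv ℝ Ω x (ω + x.2 * α x, lam * x.2 + x.2 ^ 2 * β x) = G (Ω x))
    (hinv : ∀ θ, (fderiv ℝ Ω (θ, 0)).IsInvertible) :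
    ∃ (δ : ℝ) (W : ℝ × ℝ → ℝ × ℝ), 0 < δ ∧ ContDiff ℝ (n + 1 : ℕ) W ∧
      (∀ x, W (x + (1, 0)) = W x + (1, 0)) ∧ (∀ θ, W (θ, 0) = Ω (θ, 0)) ∧
      (∀ x : ℝ × ℝ, |x.2| < δ → fderiv ℝ W x (ω, lam * x.2) = G (W x)) ∧
      ∀ θ, (fderiv ℝ W (θ, 0)).IsInvertible := by
  let y : (ℝ × ℝ) × (ℝ × ℝ) → ℝ × ℝ := fun q => (q.1.1 + q.2.1, q.1.2 * Real.exp q.2.2)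
  have hy1 : ∀ x v, y (x + (1, 0), v) = y (x, v) + (1, 0) := fun x v => by
    ext
    · simp [y]; ring
    · simp [y]
  -- Requiring `(θ + H₁, s exp H₂)` to carry `(ω, lam s)` to `(ω + y α, lam y + y² β)` means that
  -- the derivatives of `H₁` and `H₂` along the flow are `s exp H₂ α` and `s exp H₂ β`. The common
  -- factor `s` is what the semilinear lemma needs.
  obtain ⟨δ, H, hδ, hH, hH1, hH0, hHd⟩ := exists_semilinear_solution (n := n + 1) ω hlam
    (F := fun q => (Real.exp q.2.2 * α (y q), Real.exp q.2.2 * β (y q)))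
    (by
      have hy : ContDiff ℝ (n + 1 + 1 : ℕ) y := by
        simp only [y]
        fun_prop
      have he : ContDiff ℝ (n + 1 + 1 : ℕ) fun q : (ℝ × ℝ) × (ℝ × ℝ) => Real.exp q.2.2 := by fun_prop
      exact (he.mul (hα.comp hy)).prodMk (he.mul (hβ.comp hy)))
    (fun x v => by simp only [hy1, hα1, hβ1])
  have hHdiff : Differentiable ℝ H := hH.differentiable (by norm_cast)
  have hΩdiff : Differentiable ℝ Ω := hΩ.differentiable (by norm_cast)
  have hS : ContDiff ℝ (n + 1 : ℕ) (shearMap H) := by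
    unfold shearMap
    fun_prop
  have hS0 : ∀ θ, shearMap H (θ, 0) = (θ, 0) := fun θ => by simp [shearMap, hH0]
  have hSdiff : Differentiable ℝ (shearMap H) := hS.differentiable (by norm_cast)
  have hW : ContDiff ℝ (n + 1 : ℕ) fun x => Ω (shearMap H x) :=
    (hΩ.of_le (by norm_cast; omega)).comp hS
  refine ⟨δ, fun x => Ω (shearMap H x), hδ, hW, fun x => ?_, fun θ => ?_, fun x hx => ?_,
    fun θ => ?_⟩
  · simp only [shearMap_add hH1, hΩ1]
  · simp only [hS0]
  · have h1 := hHd x hx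
    have h2 := hasDerivAt_characteristic ω lam x.1 x.2 0
    have hfst : ∀ {u : ℝ → ℝ × ℝ} {u' : ℝ × ℝ}, HasDerivAt u u' 0 →
        HasDerivAt (fun t => (u t).1) u'.1 0 := fun h =>
          (ContinuousLinearMap.fst ℝ ℝ ℝ).hasFDerivAt.comp_hasDerivAt (0 : ℝ) h
    have hsnd : ∀ {u : ℝ → ℝ × ℝ} {u' : ℝ × ℝ}, HasDerivAt u u' 0 →
        HasDerivAt (fun t => (u t).2) u'.2 0 := fun h =>
          (ContinuousLinearMap.snd ℝ ℝ ℝ).hasFDerivAt.comp_hasDerivAt (0 : ℝ) h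
    have h3 := (hfst h2).add (hfst h1)
    have h4 := (hsnd h2).mul (hsnd h1).exp
    have h5 : HasDerivAt (fun t => shearMap H (linearFlow ω lam t x)) _ 0 := h3.prodMk h4
    have e0 : linearFlow ω lam 0 x = x := by simp [linearFlow]
    have h6 := (hΩdiff (shearMap H (linearFlow ω lam 0 x))).hasFDerivAt.comp_hasDerivAt (0 : ℝ) h5
    have h7 := hasDerivAt_comp_linearFlow (ω := ω) (lam := lam)
      (hW.differentiable (by norm_cast) x)
    rw [h7.unique h6, ← hG, e0]
    congr 1
    ext
    · simp [shearMap, y]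
      ring
    · simp [shearMap, y]
      ring
  · have h1 : HasFDerivAt (fun x => Ω (shearMap H x)) _ (θ, 0) :=
      ((hΩdiff (shearMap H (θ, 0))).hasFDerivAt).comp (θ, 0) (hSdiff (θ, 0)).hasFDerivAt
    rw [h1.fderiv, hS0]
    exact (hinv θ).comp (isInvertible_fderiv_shearMap hHdiff hH0 θ)

/-- Small periodic perturbations of `(ω₀, lam₀ s)` have a limit cycle near `s = 0`, and are
linearizable near it. -/
theorem exists_linearization_of_small {ω₀ lam₀ : ℝ} (hω₀ : 0 < ω₀) (hlam₀ : lam₀ < 0) :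
    ∃ ν₀ C : ℝ, 0 < ν₀ ∧ 0 ≤ C ∧ ∀ ν : ℝ, 0 ≤ ν → ν ≤ ν₀ → ∀ (n : ℕ) (g : ℝ × ℝ → ℝ × ℝ),
      ContDiff ℝ (n + 4 : ℕ) g → (∀ w, g (w + (1, 0)) = g w) → (∀ w, ‖g w‖ ≤ ν) →
      (∀ w w', ‖g w - g w'‖ ≤ ν * ‖w - w'‖) →
      ∃ (ω lam δ : ℝ) (W : ℝ × ℝ → ℝ × ℝ), 0 < ω ∧ lam < 0 ∧ |ω - ω₀| ≤ C * ν ∧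
        |lam - lam₀| ≤ C * ν ∧ 0 < δ ∧ ContDiff ℝ (n + 1 : ℕ) W ∧
        (∀ x, W (x + (1, 0)) = W x + (1, 0)) ∧ (∀ θ, ‖W (θ, 0) - (θ, 0)‖ ≤ C * ν) ∧
        (∀ x : ℝ × ℝ, |x.2| < δ →
          fderiv ℝ W x (ω, lam * x.2) = (ω₀, lam₀ * (W x).2) + g (W x)) ∧
        ∀ θ, (fderiv ℝ W (θ, 0)).IsInvertible := by
  obtain ⟨ν₁, C, hν₁, hC, hgraph⟩ := exists_invariant_graph hω₀ hlam₀
  set D := 2 * (-lam₀ * C + 1) / ω₀ with hD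
  have hD0 : 0 ≤ D := by
    have := neg_pos.2 hlam₀
    positivity
  set C' := 1 + D + 4 / ω₀ + C with hC'
  have hω4 : 0 < 4 / ω₀ := by positivity
  have hC'0 : 0 < C' := by linarith
  refine ⟨min (min ν₁ 1) (min (ω₀ / 2) (-lam₀ / (2 * C'))), C', ?_, hC'0.le, ?_⟩
  · refine lt_min (lt_min hν₁ one_pos) (lt_min (by positivity) (div_pos (by linarith) (by linarith)))
  intro ν hν hνle n g hg hg1 hgν hgL
  have hνν₁ : ν ≤ ν₁ := hνle.trans ((min_le_left _ _).trans (min_le_left _ _))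
  have hν1 : ν ≤ 1 := hνle.trans ((min_le_left _ _).trans (min_le_right _ _))
  have hνω : ν ≤ ω₀ / 2 := hνle.trans ((min_le_right _ _).trans (min_le_left _ _))
  have hνlam : ν * (2 * C') ≤ -lam₀ := (le_div_iff₀ (by positivity)).1
    (hνle.trans ((min_le_right _ _).trans (min_le_right _ _)))
  -- Count of derivatives: the graph and the conjugacy keep `n + 4`, Floquet coordinates are
  -- `C^(n+2)`, and the linearization is `C^(n+1)`.
  obtain ⟨p, hp, hp1, hpC, hpd⟩ := hgraph ν hν hνν₁ (n + 4) g hg hg1 hgν hgL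
  have hgp : ContDiff ℝ (n + 4 : ℕ) fun θ => g (θ, p θ) := by fun_prop
  have hg1' : ∀ θ s, g (θ + 1, s) = g (θ, s) := fun θ s => by simpa using hg1 (θ, s)
  obtain ⟨ω, f, hω, hf, hf1, hfd, hων, hfν⟩ := exists_circle_conjugacy
    (m := n + 4) (γ := fun θ => ω₀ + (g (θ, p θ)).1) (by fun_prop)
    (fun θ => by simp only [hp1, hg1']) hω₀ hνω
    (fun θ => by simpa using (norm_fst_le _).trans (hgν (θ, p θ)))
  set G : ℝ × ℝ → ℝ × ℝ := fun w => (ω₀, lam₀ * w.2) + g w with hGdef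
  have hG : ContDiff ℝ (n + 4 : ℕ) G := by
    simp only [hGdef]
    fun_prop
  have hGlow : ∀ θ, ω₀ / 2 ≤ (G (θ, p θ)).1 := fun θ => by
    have := (abs_le.1 ((norm_fst_le _).trans (hgν (θ, p θ)))).1
    simp only [hGdef, Prod.fst_add]
    linarith
  have hGpos : ∀ θ, 0 < (G (θ, p θ)).1 := fun θ => lt_of_lt_of_le (by positivity) (hGlow θ)
  have hgdiff : Differentiable ℝ g := hg.differentiable (by norm_cast)
  set g' : ℝ × ℝ → ℝ × ℝ := fun w => fderiv ℝ g w (0, 1) with hg'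
  have hg'c : Continuous g' :=
    (hg.continuous_fderiv (by norm_cast)).clm_apply continuous_const
  have hg'ν : ∀ w, ‖g' w‖ ≤ ν := fun w => by
    have h1 : ‖fderiv ℝ g w‖ ≤ ν := by
      refine norm_fderiv_le_of_lipschitz ℝ (C := ⟨ν, hν⟩) (LipschitzWith.of_dist_le_mul fun a b => ?_)
      rw [dist_eq_norm, dist_eq_norm]
      exact hgL a b
    refine ((fderiv ℝ g w).le_of_opNorm_le h1 _).trans ?_
    simp [Prod.norm_def]
  have hG' : ∀ w, fderiv ℝ G w (0, 1) = (0, lam₀) + g' w := fun w => by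
    have h1 : HasFDerivAt (fun w : ℝ × ℝ => (ω₀, lam₀ * w.2))
        ((0 : ℝ × ℝ →L[ℝ] ℝ).prod (lam₀ • ContinuousLinearMap.snd ℝ ℝ ℝ)) w :=
      (hasFDerivAt_const ω₀ w).prodMk (hasFDerivAt_snd.const_mul lam₀)
    have h2 : HasFDerivAt G _ w := h1.add (hgdiff w).hasFDerivAt
    rw [h2.fderiv]
    simp [hg']
  have hpd' : ∀ θ, HasDerivAt p ((G (θ, p θ)).2 / (G (θ, p θ)).1) θ := fun θ => by
    simpa [hGdef] using hpd θ
  have hpD : ∀ θ, |deriv p θ| ≤ D * ν := fun θ => by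
    rw [(hpd' θ).deriv, abs_div, abs_of_pos (hGpos θ), div_le_iff₀ (hGpos θ)]
    have h1 : |(G (θ, p θ)).2| ≤ -lam₀ * (C * ν) + ν := by
      simp only [hGdef, Prod.snd_add]
      refine (abs_add_le _ _).trans (add_le_add ?_ ((norm_snd_le _).trans (hgν _)))
      rw [abs_mul, abs_of_neg hlam₀]
      exact mul_le_mul_of_nonneg_left (hpC θ) (by linarith)
    calc _ ≤ -lam₀ * (C * ν) + ν := h1
      _ = D * ν * (ω₀ / 2) := by rw [hD]; field_simp
      _ ≤ D * ν * (G (θ, p θ)).1 := by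
        gcongr
        exact hGlow θ
  have hp'c : Continuous (deriv p) := hp.continuous_deriv (by norm_cast; omega)
  have hfc : Continuous f := hf.continuous
  have hpc : Continuous p := hp.continuous
  -- The mean transverse rate along the orbit. It differs from `lam₀` by an integral of first
  -- derivatives of `g` and a product with `p'`, all of order `ν`.
  obtain ⟨lam, hlam⟩ : ∃ lam, lam = ∫ θ in (0 : ℝ)..1, ((fderiv ℝ G (f θ, p (f θ)) (0, 1)).2 -
      deriv p (f θ) * (fderiv ℝ G (f θ, p (f θ)) (0, 1)).1) := ⟨_, rfl⟩
  have hlamν : |lam - lam₀| ≤ (1 + D) * ν := by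
    have e : lam - lam₀ = ∫ θ in (0 : ℝ)..1,
        ((g' (f θ, p (f θ))).2 - deriv p (f θ) * (g' (f θ, p (f θ))).1) := by
      have hc : Continuous fun θ =>
          (g' (f θ, p (f θ))).2 - deriv p (f θ) * (g' (f θ, p (f θ))).1 := by fun_prop
      have h1 : lam = ∫ θ in (0 : ℝ)..1, (lam₀ +
          ((g' (f θ, p (f θ))).2 - deriv p (f θ) * (g' (f θ, p (f θ))).1)) := by
        rw [hlam]
        refine intervalIntegral.integral_congr fun θ _ => ?_
        simp only [hG', Prod.fst_add, Prod.snd_add]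
        ring
      rw [h1, intervalIntegral.integral_add (continuous_const.intervalIntegrable _ _)
        (hc.intervalIntegrable _ _)]
      simp
    rw [e, ← Real.norm_eq_abs]
    refine (intervalIntegral.norm_integral_le_of_norm_le_const (C := (1 + D) * ν)
      fun θ _ => ?_).trans (by simp)
    have h1 := (norm_fst_le _).trans (hg'ν (f θ, p (f θ)))
    have h2 := (norm_snd_le _).trans (hg'ν (f θ, p (f θ)))
    have h3 : ‖deriv p (f θ) * (g' (f θ, p (f θ))).1‖ ≤ (D * ν) * 1 := by
      rw [norm_mul]
      exact mul_le_mul (hpD _) (h1.trans hν1) (norm_nonneg _) (by positivity)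
    refine (norm_sub_le _ _).trans ?_
    linarith
  have hlamC : |lam - lam₀| ≤ C' * ν := hlamν.trans (by gcongr; linarith)
  have hlam0 : lam < 0 := by
    have := (abs_le.1 hlamC).2
    nlinarith
  obtain ⟨Ω, α, β, hΩ, hα, hβ, hΩ1, hα1, hβ1, hΩ0, -, hΩG, hΩi⟩ := exists_floquet_coordinates
    (n := n + 2) (G := G) hG (fun w => by simp [hGdef, hg1]) hω hp hp1 hf hf1 hGpos hpd'
    (fun θ => by simpa [hGdef] using hfd θ) hlam
  obtain ⟨δ, W, hδ, hW, hW1, hW0, hWG, hWi⟩ :=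
    exists_linearization hlam0 hΩ hα hβ hΩ1 hα1 hβ1 hΩG hΩi
  refine ⟨ω, lam, δ, W, hω, hlam0, hων.trans ?_, hlamC, hδ, hW, hW1, fun θ => ?_, hWG, hWi⟩
  · nlinarith
  · rw [hW0, hΩ0, Prod.mk_sub_mk, sub_zero, Prod.norm_mk]
    refine max_le ((hfν θ).trans ?_) ((hpC _).trans ?_)
    · rw [show 4 * ν / ω₀ = 4 / ω₀ * ν by ring]
      gcongr
      linarith
    · gcongr
      linarith

end Planar

/-! ### Solutions of the extended invariance equation -/

section Main

variable {X : (ℝ × ℝ) × (ℝ × ℝ) → ℝ × ℝ} {r : ℝ × ℝ → ℝ} {h : ℝ} {K : ℝ × ℝ → ℝ × ℝ} {φ : ℝ → ℝ}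
  {ω₀ lam₀ ε ω lam : ℝ} {g W : ℝ × ℝ → ℝ × ℝ} {U : ℝ → ℝ × ℝ → ℝ × ℝ}

/-- Linearizations of the reduced planar field solve the extended invariance equation. -/
theorem solvesExtInvariance_of_linearization (hrh : ∀ x, r x ∈ Icc 0 h) (hφ : IsCutoff φ)
    {L δ : ℝ} (hgL : ∀ w w', ‖g w - g w'‖ ≤ L * ‖w - w'‖)
    (hgY : ∀ w, g w = ε • extY X K φ w (U (-extDelay r K φ w) w) ε)
    (hU0 : ∀ w : ℝ × ℝ, |w.2| ≤ 1 → U 0 w = w)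
    (hU : ∀ w, ∀ t ∈ Icc (-h) 0, HasDerivAt (fun t => U t w)
      ((ω₀, lam₀ * (U t w).2) + g (U t w)) t)
    (hlam : lam < 0) (hδ : 0 < δ) (hW : Differentiable ℝ W)
    (hW1 : ∀ x, W (x + (1, 0)) = W x + (1, 0)) (hW0 : ∀ θ, |(W (θ, 0)).2| < 1)
    (hWG : ∀ x : ℝ × ℝ, |x.2| < δ →
      fderiv ℝ W x (ω, lam * x.2) = (ω₀, lam₀ * (W x).2) + g (W x)) :
    SolvesExtInvariance X r K φ ω₀ lam₀ ε ω lam W := by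
  have hh : 0 ≤ h := (hrh 0).1.trans (hrh 0).2
  have hper : ∀ θ s, W (θ + 1, s) = W (θ, s) + (1, 0) := fun θ s => by simpa using hW1 (θ, s)
  refine ⟨hW.continuous, hper, ?_⟩
  obtain ⟨δ₁, hδ₁, hstrip⟩ := exists_strip (P := fun x => |(W x).2| < 1)
    (fun θ s => by simp [hper]) (fun θ => by
      have hc := hW.continuous
      exact ContinuousAt.eventually_lt (by fun_prop) continuousAt_const (hW0 θ))
  have hexp : Real.exp (-lam * h) * Real.exp (lam * h) = 1 := by rw [← Real.exp_add]; simp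
  -- The strip shrinks by `exp (lam h)` so that the characteristic stays in `|s| < δ` back to time
  -- `-h`.
  refine ⟨min δ₁ (δ * Real.exp (lam * h)), lt_min hδ₁ (by positivity), fun θ s hs => ?_⟩
  have hs1 : |s| < δ₁ := hs.trans_le (min_le_left _ _)
  have hs2 : ∀ t ∈ Icc (-h) 0, |s * Real.exp (lam * t)| < δ := fun t ht => by
    rw [abs_mul, Real.abs_exp]
    calc |s| * Real.exp (lam * t) ≤ |s| * Real.exp (-lam * h) :=
          mul_le_mul_of_nonneg_left (Real.exp_le_exp.2 (by nlinarith [ht.1])) (abs_nonneg s)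
      _ < δ * Real.exp (lam * h) * Real.exp (-lam * h) := by
          gcongr
          exact hs.trans_le (min_le_right _ _)
      _ = δ := by rw [mul_assoc, mul_comm (Real.exp (lam * h)), hexp, mul_one]
  refine ⟨hW _, ?_⟩
  have hs0 : |s| < δ := by simpa using hs2 0 ⟨by linarith, le_rfl⟩
  set w := W (θ, s) with hw
  have hLip : LipschitzWith (Real.toNNReal (|lam₀| + L))
      (fun w : ℝ × ℝ => (ω₀, lam₀ * w.2) + g w) := by
    refine LipschitzWith.of_dist_le_mul fun a b => ?_
    have h1 := hgL a b
    have h2 : ‖((ω₀, lam₀ * a.2) : ℝ × ℝ) - (ω₀, lam₀ * b.2)‖ ≤ |lam₀| * ‖a - b‖ := by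
      rw [Prod.mk_sub_mk, sub_self, ← mul_sub, Prod.norm_mk, norm_zero, norm_mul]
      exact max_le (by positivity)
        (mul_le_mul_of_nonneg_left (norm_snd_le (a - b)) (norm_nonneg _))
    rw [dist_eq_norm, dist_eq_norm, add_sub_add_comm]
    refine (norm_add_le _ _).trans ((add_le_add h2 h1).trans ?_)
    rw [← add_mul]
    gcongr
    exact Real.le_coe_toNNReal _
  have hWd : ∀ t ∈ Icc (-h) 0, HasDerivAt (fun t => W (θ + ω * t, s * Real.exp (lam * t)))
      ((ω₀, lam₀ * (W (θ + ω * t, s * Real.exp (lam * t))).2) +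
        g (W (θ + ω * t, s * Real.exp (lam * t)))) t := fun t ht => by
    rw [← hWG _ (hs2 t ht)]
    exact DifferentiableAt.hasDerivAt_comp_characteristic (hW _)
  -- Both `U (·) w` and `W` along the characteristic through `(θ, s)` solve the planar equation on
  -- `[-h, 0]` and equal `w` at time `0`. Uniqueness identifies the delayed argument built into `g`
  -- with the delayed term of `W`.
  have huniq := ODE_solution_unique_of_mem_Icc_left (a := -h) (b := 0)
    (v := fun _ w => (ω₀, lam₀ * w.2) + g w) (s := fun _ => univ)
    (f := fun t => U t w) (g := fun t => W (θ + ω * t, s * Real.exp (lam * t)))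
    (fun t _ => hLip.lipschitzOnWith)
    (fun t ht => (hU w t ht).continuousAt.continuousWithinAt)
    (fun t ht => (hU w t (Ioc_subset_Icc_self ht)).hasDerivWithinAt) (fun _ _ => mem_univ _)
    (fun t ht => (hWd t ht).continuousAt.continuousWithinAt)
    (fun t ht => (hWd t (Ioc_subset_Icc_self ht)).hasDerivWithinAt) (fun _ _ => mem_univ _)
    (by simpa [← hw] using hU0 w (hstrip θ s hs1.le).le)
  have hρ := extDelay_mem_Icc (K := K) hrh hφ w
  have hdel : U (-extDelay r K φ w) w = delayedW r K φ ω lam W θ s := by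
    have := huniq (x := -extDelay r K φ w) ⟨by linarith [hρ.2], by linarith [hρ.1]⟩
    simp only at this
    rw [this, delayedW, ← hw]
    congr 2
    · ring
    · ring_nf
  rw [hWG _ hs0, ← hw, ← hdel, ← hgY]

/-- Invertible linear maps form an open set and the derivative of `K ∘ W` is continuous, so
invertibility at one point spreads to a neighborhood. -/
theorem eventually_isInvertible_fderiv {X₀ : ℝ × ℝ → ℝ × ℝ} (hK : IsLimitCycleParam X₀ K ω₀ lam₀)
    (hW : ContDiff ℝ 1 W) {x : ℝ × ℝ} (hx : |(W x).2| < 1) (hi : (fderiv ℝ W x).IsInvertible) :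
    ∀ᶠ z in 𝓝 x, (fderiv ℝ (fun p => K (W p)) z).IsInvertible := by
  have hKW : ContDiffAt ℝ 1 (fun p => K (W p)) x :=
    (hK.contDiffAt hx.le 1).comp x hW.contDiffAt
  have hc : ContinuousAt (fderiv ℝ (fun p => K (W p))) x :=
    (hKW.fderiv_right (m := 0) (by norm_num)).continuousAt
  have hx' : (fderiv ℝ (fun p => K (W p)) x).IsInvertible := by
    have h1 := (((hK.contDiffAt hx.le 1).differentiableAt (by norm_num)).hasFDerivAt).comp x
      (hW.differentiable (by norm_num) x).hasFDerivAt
    have h2 : HasFDerivAt (fun p => K (W p)) _ x := h1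
    rw [h2.fderiv]
    exact (hK.localDiffeo (W x).1 (W x).2 hx.le).comp hi
  obtain ⟨e, he⟩ := hx'
  have hn := e.nhds
  rw [he] at hn
  filter_upwards [hc.eventually hn] with z hz
  obtain ⟨e', he'⟩ := hz
  exact ⟨e', he'⟩

theorem exists_strip_isInvertible_fderiv {X₀ : ℝ × ℝ → ℝ × ℝ}
    (hK : IsLimitCycleParam X₀ K ω₀ lam₀) (hW : ContDiff ℝ 1 W)
    (hW1 : ∀ x, W (x + (1, 0)) = W x + (1, 0)) (hW0 : ∀ θ, |(W (θ, 0)).2| < 1)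
    (hi : ∀ θ, (fderiv ℝ W (θ, 0)).IsInvertible) :
    ∃ δ : ℝ, 0 < δ ∧ ∀ θ s, |s| ≤ δ → (fderiv ℝ (fun p => K (W p)) (θ, s)).IsInvertible := by
  have hW1' : ∀ θ s, W (θ + 1, s) = W (θ, s) + (1, 0) := fun θ s => by simpa using hW1 (θ, s)
  -- The bound on `W₂` belongs to the predicate because `K ∘ W` is periodic near a point only while
  -- `W` stays where `K` is periodic.
  obtain ⟨δ, hδ, h⟩ := exists_strip (P := fun x => |(W x).2| < 1 ∧
      ((fderiv ℝ (fun p => K (W p)) x).IsInvertible))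
    (fun θ s => by
      rw [hW1', Prod.snd_add, add_zero]
      refine and_congr_right fun hs => ?_
      have h1 : (fun p => K (W (p + (1, 0)))) =ᶠ[𝓝 (θ, s)] fun p => K (W p) := by
        have hc := hW.continuous
        have : ∀ᶠ p in 𝓝 (θ, s), |(W p).2| < 1 :=
          ContinuousAt.eventually_lt (by fun_prop) continuousAt_const hs
        filter_upwards [this] with p hp
        rw [hW1]
        have h2 := hK.periodic (W p).1 (W p).2 hp.le
        rwa [show ((W p).1 + 1, (W p).2) = W p + (1, 0) by ext <;> simp] at h2
      rw [← h1.fderiv_eq, fderiv_comp_add_right (f := fun p => K (W p))]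
      simp)
    (fun θ => by
      have hc := hW.continuous
      have : ∀ᶠ p in 𝓝 (θ, (0 : ℝ)), |(W p).2| < 1 :=
        ContinuousAt.eventually_lt (by fun_prop) continuousAt_const (hW0 θ)
      exact this.and (eventually_isInvertible_fderiv hK hW (hW0 θ) (hi θ)))
  exact ⟨δ, hδ, fun θ s hs => (h θ s hs).2⟩

/-- Existence of solutions of the extended invariance equation close to the unperturbed one. -/
theorem exists_solvesExtInvariance (hX : AnalyticOnNhd ℝ X univ)
    (hr : ContDiff ℝ (⊤ : ℕ∞) r) (hrh : ∀ x, r x ∈ Icc 0 h)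
    (hK : IsLimitCycleParam (fun x => X (x, 0)) K ω₀ lam₀) (hφ : IsCutoff φ) (k : ℕ) {η : ℝ}
    (hη : 0 < η) :
    ∃ ε₀ : ℝ, 0 < ε₀ ∧ ∀ ε : ℝ, 0 ≤ ε → ε < ε₀ → ∃ (ω lam : ℝ) (W : ℝ × ℝ → ℝ × ℝ) (s₁ : ℝ),
      0 < ω ∧ lam < 0 ∧ SolvesExtInvariance X r K φ ω₀ lam₀ ε ω lam W ∧ ContDiff ℝ k W ∧
        |ω - ω₀| ≤ η ∧ |lam - lam₀| ≤ η ∧ (∀ θ : ℝ, ‖W (θ, 0) - (θ, 0)‖ ≤ η) ∧ 0 < s₁ ∧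
        ∀ θ s : ℝ, |s| ≤ s₁ → (fderiv ℝ (fun p => K (W p)) (θ, s)).IsInvertible := by
  have hh : 0 ≤ h := (hrh 0).1.trans (hrh 0).2
  obtain ⟨ε₁, C, hε₁, hC, hred⟩ := exists_reducedField (Y := extY X K φ) (ρ := extDelay r K φ)
    (ω₀ := ω₀) (lam₀ := lam₀) hh (uBdd_extY hX hK hφ) (extY_add_left hK hφ) (extY_add_right hK hφ)
    (fun a v ε ha => extY_eq_zero hφ ha v ε) (uBdd_extDelay hr hK hφ) (extDelay_periodic hK hφ)
    (k + 4)
  obtain ⟨ν₀, C', hν₀, hC', hlin⟩ := exists_linearization_of_small hK.omega_pos hK.lam_neg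
  -- The entry `1/2` keeps the circle inside `|W₂| < 1`, where `K` is a local diffeomorphism and `U
  -- 0 w = w`; the entry `η` gives the required closeness.
  set c := min ν₀ (min η (1 / 2) / (C' + 1)) with hc
  have hη' : 0 < min η (1 / 2) := lt_min hη (by norm_num)
  have hc0 : 0 < c := lt_min hν₀ (by positivity)
  refine ⟨min ε₁ (c / (C + 1)), lt_min hε₁ (by positivity), fun ε hε hεlt => ?_⟩
  obtain ⟨g, U, hg, hg1, hgb, hgL, -, hgY, hU0, hU⟩ := hred ε hε (hεlt.trans_le (min_le_left _ _))
  have hεc : ε * (C + 1) ≤ c :=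
    (le_div_iff₀ (by positivity)).1 (hεlt.le.trans (min_le_right _ _))
  have hν : ε * C ≤ c := by nlinarith
  have hCν : C' * (ε * C) ≤ min η (1 / 2) := by
    have h1 : c * (C' + 1) ≤ min η (1 / 2) := (le_div_iff₀ (by positivity)).1 (min_le_right _ _)
    nlinarith
  obtain ⟨ω, lam, δ, W, hω, hlam, hω', hlam', hδ, hW, hW1, hW0, hWG, hWi⟩ :=
    hlin (ε * C) (by positivity) (hν.trans (min_le_left _ _)) k g hg hg1 hgb hgL
  have hW0' : ∀ θ, |(W (θ, 0)).2| < 1 := fun θ => by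
    have := (norm_snd_le _).trans ((hW0 θ).trans (hCν.trans (min_le_right _ _)))
    simp only [Prod.snd_sub, sub_zero, Real.norm_eq_abs] at this
    linarith
  obtain ⟨s₁, hs₁, hinv⟩ := exists_strip_isInvertible_fderiv hK
    (hW.of_le (by norm_cast; omega)) hW1 hW0' hWi
  have hη1 := hCν.trans (min_le_left _ _)
  exact ⟨ω, lam, W, s₁, hω, hlam, solvesExtInvariance_of_linearization hrh hφ hgL hgY hU0 hU hlam hδ
    (hW.differentiable (by norm_cast)) hW1 hW0' hWG, hW.of_le (by norm_cast; omega),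
    hω'.trans hη1, hlam'.trans hη1, fun θ => (hW0 θ).trans hη1, hs₁, hinv⟩

end Main

theorem mainTheorem5
    (X : (ℝ × ℝ) × (ℝ × ℝ) → ℝ × ℝ) (hX : AnalyticOnNhd ℝ X Set.univ)
    (r : ℝ × ℝ → ℝ) (h : ℝ) (hr : ContDiff ℝ (⊤ : ℕ∞) r) (hrh : ∀ x, r x ∈ Set.Icc 0 h)
    (K : ℝ × ℝ → ℝ × ℝ) (ω₀ lam₀ : ℝ)
    (hK : IsLimitCycleParam (fun x => X (x, 0)) K ω₀ lam₀)
    (φ : ℝ → ℝ) (hφ : IsCutoff φ)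
    (k : ℕ) (η : ℝ) (hη : 0 < η) :
    ∃ ε₀ : ℝ, 0 < ε₀ ∧ ∀ ε : ℝ, 0 ≤ ε → ε < ε₀ →
      (∃ (ω lam : ℝ) (W : ℝ × ℝ → ℝ × ℝ) (s₀ : ℝ),
        0 < ω ∧ lam < 0 ∧
        SolvesExtInvariance X r K φ ω₀ lam₀ ε ω lam W ∧
        ContDiff ℝ k W ∧
        |ω - ω₀| ≤ η ∧ |lam - lam₀| ≤ η ∧ (∀ θ : ℝ, ‖W (θ, 0) - (θ, 0)‖ ≤ η) ∧
        0 < s₀ ∧ s₀ < 1 / 2 ∧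
        ParamCycleAndIsochrons X r h K ε ω lam W s₀ ∧
        ∀ θ s : ℝ, |s| ≤ s₀ → (fderiv ℝ (fun p => K (W p)) (θ, s)).IsInvertible) ∧
      (∀ (ω lam : ℝ) (W : ℝ × ℝ → ℝ × ℝ),
        0 < ω → lam < 0 →
        SolvesExtInvariance X r K φ ω₀ lam₀ ε ω lam W →
        ∃ s₀ : ℝ, 0 < s₀ ∧ s₀ < 1 / 2 ∧
          ParamCycleAndIsochrons X r h K ε ω lam W s₀) := by
  obtain ⟨ε₁, hε₁, hpar⟩ := SolvesExtInvariance.paramCycleAndIsochrons hX hrh hK hφ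
  obtain ⟨ε₂, hε₂, hex⟩ := exists_solvesExtInvariance hX hr hrh hK hφ k hη
  refine ⟨min ε₁ ε₂, lt_min hε₁ hε₂, fun ε hε hεlt => ⟨?_, fun ω lam W hω hlam hS => ?_⟩⟩
  · obtain ⟨ω, lam, W, s₂, hω, hlam, hS, hW, h1, h2, h3, hs₂, hinv⟩ :=
      hex ε hε (hεlt.trans_le (min_le_right _ _))
    obtain ⟨s₁, hs₁, hP⟩ := hpar ε hε (hεlt.trans_le (min_le_left _ _)) ω lam W hω hlam hS
    have hs0 : 0 < min s₁ (min s₂ (1 / 4)) := lt_min hs₁ (lt_min hs₂ (by norm_num))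
    have hs4 : min s₁ (min s₂ (1 / 4)) ≤ 1 / 4 := (min_le_right _ _).trans (min_le_right _ _)
    exact ⟨ω, lam, W, min s₁ (min s₂ (1 / 4)), hω, hlam, hS, hW, h1, h2, h3, hs0, by linarith,
      hP _ hs0 (min_le_left _ _), fun θ s hs =>
        hinv θ s (hs.trans ((min_le_right _ _).trans (min_le_left _ _)))⟩
  · obtain ⟨s₁, hs₁, hP⟩ := hpar ε hε (hεlt.trans_le (min_le_left _ _)) ω lam W hω hlam hS
    have hs4 : min s₁ (1 / 4) ≤ 1 / 4 := min_le_right _ _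
    exact ⟨min s₁ (1 / 4), lt_min hs₁ (by norm_num), by linarith,
      hP _ (lt_min hs₁ (by norm_num)) (min_le_left _ _)⟩
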